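/- Let $n\ge 3$, let $\Omega\subset\mathbb R^n$ be a bounded domain (nonempty, open, connected) with $C^2$ boundary and exterior unit normal $\nu$, and let $q\in L^\infty(\Omega)$ be possibly complex valued. All function spaces are complex, and differential equations in $\Omega$ are understood in the sense of distributions. Put $$H_\Delta(\Omega)=\{u\in L^2(\Omega):\Delta u\in L^2(\Omega)\},\qquad b_q=\{u\in L^2(\Omega):(-\Delta+q)u=0 \text{ in }\Omega\}\subset H_\Delta(\Omega).$$ Let $\mathrm{tr}:H_\Delta(\Omega)\to H^{-1/2}(\partial\Omega)$ be the continuous extension of the restriction map $u\mapsto u|_{\partial\Omega}$, that is, the linear map with $$\langle \mathrm{tr}\,u,\ \partial_\nu w\rangle=\int_\Omega (u\,\Delta w-w\,\Delta u)\,dx$$ for all $w\in C^2(\overline\Omega)$ vanishing on $\partial\Omega$, where $\langle\cdot,\cdot\rangle$ is the bilinear pairing of $H^{-1/2}(\partial\Omega)$ and $H^{1/2}(\partial\Omega)$. Let $\mathcal H(\partial\Omega)=\{\mathrm{tr}\,u:u\in H_\Delta(\Omega)\}$. If $0$ is not a Dirichlet eigenvalue of $-\Delta+q$ in $\Omega$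 (that is, the only $v\in H^1_0(\Omega)$ with $(-\Delta+q)v=0$ is $v=0$), then the trace map $\mathrm{tr}:b_q\to\mathcal H(\partial\Omega)$ is one-to-one and onto. -/

import Mathlib

namespace PDETrace

open MeasureTheory Filter Topology Metric
open scoped ContDiff ENNReal Laplacian InnerProductSpace

/-- Euclidean space `ℝⁿ`. -/
abbrev Rn (n : ℕ) := EuclideanSpace ℝ (Fin n)

variable {n : ℕ}

theorem laplacian_apply (f : Rn n → ℂ) (x : Rn n) :
    Δ f x = ∑ i, fderiv ℝ (fderiv ℝ f) x (EuclideanSpace.basisFun (Fin n) ℝ i)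
      (EuclideanSpace.basisFun (Fin n) ℝ i) := by
  rw [InnerProductSpace.laplacian_eq_iteratedFDeriv_orthonormalBasis f
    (EuclideanSpace.basisFun (Fin n) ℝ)]
  simp [iteratedFDeriv_two_apply]

theorem continuous_laplacian {f : Rn n → ℂ} (hf : ContDiff ℝ 2 f) : Continuous (Δ f) := by
  have h1 : ContDiff ℝ 1 (fderiv ℝ f) := hf.fderiv_right (by norm_num)
  have h2 : Continuous (fderiv ℝ (fderiv ℝ f)) := h1.continuous_fderiv (by norm_num)
  have : Δ f = fun x => ∑ i, fderiv ℝ (fderiv ℝ f) x (EuclideanSpace.basisFun (Fin n) ℝ i)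
      (EuclideanSpace.basisFun (Fin n) ℝ i) := funext (laplacian_apply f)
  rw [this]
  fun_prop

theorem laplacian_comp_affine {f : Rn n → ℂ} (hf : ContDiff ℝ 2 f) (a : Rn n) (c : ℝ)
    (x : Rn n) : Δ (fun z => f (a + c • z)) x = (c : ℂ) ^ 2 * Δ f (a + c • x) := by
  have h1 : ContDiff ℝ 1 (fderiv ℝ f) := hf.fderiv_right (by norm_num)
  have aux : ∀ z, HasFDerivAt (fun z : Rn n => a + c • z)
      (c • ContinuousLinearMap.id ℝ (Rn n)) z := fun z =>
    ((hasFDerivAt_id z).const_smul c).const_add a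
  have e1 : fderiv ℝ (fun z => f (a + c • z)) = fun z => c • fderiv ℝ f (a + c • z) := by
    funext z
    have := ((hf.differentiable (by norm_num)) (a + c • z)).hasFDerivAt.comp z (aux z)
    rw [show (fun z => f (a + c • z)) = f ∘ fun z => a + c • z from rfl, this.fderiv]
    ext v; simp
  have e2 : fderiv ℝ (fderiv ℝ (fun z => f (a + c • z))) x
      = c • c • fderiv ℝ (fderiv ℝ f) (a + c • x) := by
    rw [e1]
    have := (((h1.differentiable (by norm_num)) (a + c • x)).hasFDerivAt.comp x (aux x)).const_smul c
    have h3 : (fun z => c • fderiv ℝ f (a + c • z)) =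
      c • (fderiv ℝ f ∘ fun z => a + c • z) := rfl
    rw [h3, this.fderiv]
    ext v; simp
  rw [laplacian_apply, laplacian_apply, e2, Finset.mul_sum]
  refine Finset.sum_congr rfl fun i _ => ?_
  simp [pow_two, mul_assoc]

theorem integral_mul_laplacian {f g : Rn n → ℂ} (hf : ContDiff ℝ 2 f) (hg : ContDiff ℝ 2 g)
    (hc : HasCompactSupport g) : ∫ x, f x * Δ g x = ∫ x, Δ f x * g x := by
  have f1 : ContDiff ℝ 1 (fderiv ℝ f) := hf.fderiv_right (by norm_num)
  have g1 : ContDiff ℝ 1 (fderiv ℝ g) := hg.fderiv_right (by norm_num)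
  have f2 : Continuous (fderiv ℝ (fderiv ℝ f)) := f1.continuous_fderiv (by norm_num)
  have g2 : Continuous (fderiv ℝ (fderiv ℝ g)) := g1.continuous_fderiv (by norm_num)
  have f0 := hf.continuous
  have g0 := hg.continuous
  have f1c := f1.continuous
  have g1c := g1.continuous
  have hc1 : HasCompactSupport (fderiv ℝ g) := hc.fderiv ℝ
  have hc2 : HasCompactSupport (fderiv ℝ (fderiv ℝ g)) := hc1.fderiv ℝ
  have hc1v : ∀ v, HasCompactSupport (fun x => fderiv ℝ g x v) := fun v =>
    hc1.comp_left (g := fun L : Rn n →L[ℝ] ℂ => L v) rfl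
  have hc2v : ∀ v, HasCompactSupport (fun x => fderiv ℝ (fderiv ℝ g) x v v) := fun v =>
    hc2.comp_left (g := fun L : Rn n →L[ℝ] Rn n →L[ℝ] ℂ => L v v) rfl
  have key : ∀ (h : Rn n → ℂ), ContDiff ℝ 2 h → ∀ v, fderiv ℝ (fun y => fderiv ℝ h y v)
      = fun x => (fderiv ℝ (fderiv ℝ h) x).flip v := by
    intro h hh v
    funext x
    have h1 : ContDiff ℝ 1 (fderiv ℝ h) := hh.fderiv_right (by norm_num)
    have := ((h1.differentiable (by norm_num)) x).hasFDerivAt.clm_apply (hasFDerivAt_const v x)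
    rw [this.fderiv]; ext w; simp
  have kf : ∀ v, Differentiable ℝ (fun y => fderiv ℝ f y v) := fun v =>
    (f1.clm_apply contDiff_const).differentiable (by norm_num)
  have kg : ∀ v, Differentiable ℝ (fun y => fderiv ℝ g y v) := fun v =>
    (g1.clm_apply contDiff_const).differentiable (by norm_num)
  have main : ∀ v, ∫ x, f x * fderiv ℝ (fderiv ℝ g) x v v
      = ∫ x, fderiv ℝ (fderiv ℝ f) x v v * g x := by
    intro v
    have s1 := integral_mul_fderiv_eq_neg_fderiv_mul_of_integrable (𝕜 := ℂ) (μ := volume)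
      (f := f) (g := fun y => fderiv ℝ g y v) (v := v)
      (Continuous.integrable_of_hasCompactSupport (by fun_prop) (hc1v v).mul_left)
      (by
        rw [key g hg v]
        exact Continuous.integrable_of_hasCompactSupport (by simp only [ContinuousLinearMap.flip_apply]; fun_prop) (hc2v v).mul_left)
      (Continuous.integrable_of_hasCompactSupport (by fun_prop) (hc1v v).mul_left)
      (fun x _ => hf.differentiable (by norm_num) x) (fun x _ => kg v x)
    have s2 := integral_mul_fderiv_eq_neg_fderiv_mul_of_integrable (𝕜 := ℂ) (μ := volume)
      (f := fun y => fderiv ℝ f y v) (g := g) (v := v)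
      (by
        rw [key f hf v]
        exact Continuous.integrable_of_hasCompactSupport (by simp only [ContinuousLinearMap.flip_apply]; fun_prop) hc.mul_left)
      (Continuous.integrable_of_hasCompactSupport (by fun_prop) (hc1v v).mul_left)
      (Continuous.integrable_of_hasCompactSupport (by fun_prop) hc.mul_left)
      (fun x _ => kf v x) (fun x _ => hg.differentiable (by norm_num) x)
    rw [key g hg v] at s1
    rw [key f hf v] at s2
    simp only [ContinuousLinearMap.flip_apply] at s1 s2
    rw [s1, s2, neg_neg]
  simp only [laplacian_apply, Finset.mul_sum, Finset.sum_mul]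
  rw [integral_finsetSum, integral_finsetSum]
  · exact Finset.sum_congr rfl fun i _ => main _
  · exact fun i _ => Continuous.integrable_of_hasCompactSupport (by fun_prop) hc.mul_left
  · exact fun i _ => Continuous.integrable_of_hasCompactSupport (by fun_prop) (hc2v _).mul_left

/-- `φ ∈ C_c^∞(Ω)`, complex valued. -/
structure IsTestFunction (Ω : Set (Rn n)) (φ : Rn n → ℂ) : Prop where
  smooth : ContDiff ℝ ∞ φ
  compact : HasCompactSupport φ
  support_subset : tsupport φ ⊆ Ω

/-- `Δ u = f` in `Ω` in the sense of distributions. -/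
def HasDistribLaplacian (Ω : Set (Rn n)) (u f : Rn n → ℂ) : Prop :=
  ∀ φ, IsTestFunction Ω φ → ∫ x in Ω, u x * Δ φ x = ∫ x in Ω, f x * φ x

theorem exists_frontier_near {Ω : Set (Rn n)} {x z : Rn n} (hx : x ∈ Ω) (hz : z ∉ Ω) :
    ∃ p ∈ frontier Ω, p ∈ segment ℝ x z := by
  by_contra! h
  have hpre : IsPreconnected (segment ℝ x z) := (convex_segment x z).isPreconnected
  have hsub : segment ℝ x z ⊆ interior Ω ∪ interior Ωᶜ := by
    intro p hp
    by_contra hc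
    apply h p _ hp
    rw [Set.mem_union, not_or] at hc
    rw [frontier_eq_closure_inter_closure, Set.mem_inter_iff]
    rw [interior_compl] at hc
    refine ⟨by simpa using hc.2, ?_⟩
    rw [closure_compl]; exact hc.1
  rcases isPreconnected_iff_subset_of_disjoint.1 hpre _ _ isOpen_interior isOpen_interior hsub
    (by
      ext p; simp only [Set.mem_inter_iff, Set.mem_empty_iff_false, iff_false, not_and]
      intro _ h1 h2; exact (interior_subset h2) (interior_subset h1)) with h1 | h1
  · exact hz (interior_subset (h1 (right_mem_segment ℝ x z)))
  · exact (interior_subset (h1 (left_mem_segment ℝ x z))) hx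

theorem quadratic_bound {Ω : Set (Rn n)} (hb : Bornology.IsBounded Ω) {w : Rn n → ℂ}
    (hw : ContDiff ℝ 2 w) (h0 : ∀ x ∈ frontier Ω, w x = 0)
    (h1 : ∀ x ∈ frontier Ω, fderiv ℝ w x = 0) :
    ∃ M : ℝ, 0 ≤ M ∧ ∀ y ∈ Ω, ∀ p ∈ frontier Ω, ‖w y‖ ≤ M * ‖y - p‖ ^ 2 := by
  obtain ⟨R, hR⟩ := hb.closure.subset_closedBall (0 : Rn n)
  have w1 : ContDiff ℝ 1 (fderiv ℝ w) := hw.fderiv_right (by norm_num)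
  have w2n : Continuous fun x => ‖iteratedFDeriv ℝ 2 w x‖ :=
    (hw.continuous_iteratedFDeriv le_rfl).norm
  obtain ⟨M, hM'⟩ := (isCompact_closedBall (0 : Rn n) R).bddAbove_image w2n.continuousOn
  have hM : ∀ x ∈ closedBall (0 : Rn n) R, ‖fderiv ℝ (fderiv ℝ w) x‖ ≤ M := fun x hx => by
    have := hM' (Set.mem_image_of_mem _ hx)
    rwa [← norm_iteratedFDeriv_fderiv (n := 1), norm_iteratedFDeriv_one] at this
  refine ⟨max M 0, le_max_right _ _, fun y hy p hp => ?_⟩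
  have hyB : y ∈ closedBall (0 : Rn n) R := hR (subset_closure hy)
  have hpB : p ∈ closedBall (0 : Rn n) R := hR (frontier_subset_closure hp)
  have d1 : ∀ z ∈ closedBall (0 : Rn n) R, ‖fderiv ℝ w z‖ ≤ max M 0 * ‖z - p‖ := by
    intro z hz
    have := (convex_closedBall (0 : Rn n) R).norm_image_sub_le_of_norm_fderiv_le (𝕜 := ℝ)
      (f := fderiv ℝ w) (C := max M 0)
      (fun x _ => w1.differentiable (by norm_num) x)
      (fun x hx => (hM x hx).trans (le_max_left _ _)) hpB hz
    simpa [h1 p hp] using this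
  have hs : segment ℝ p y ⊆ closedBall (0 : Rn n) R :=
    (convex_closedBall (0 : Rn n) R).segment_subset hpB hyB
  have := (convex_segment p y).norm_image_sub_le_of_norm_fderiv_le (𝕜 := ℝ)
      (f := w) (C := max M 0 * ‖y - p‖)
      (fun x _ => hw.differentiable (by norm_num) x)
      (fun x hx => (d1 x (hs hx)).trans (by
        gcongr
        obtain ⟨a, b, ha, hb', hab, rfl⟩ := hx
        have : a • p + b • y - p = b • (y - p) := by
          rw [show a = 1 - b by linarith]; module
        rw [this, norm_smul, Real.norm_of_nonneg hb']
        have : b ≤ 1 := by linarith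
        nlinarith [norm_nonneg (y - p)])) (left_mem_segment ℝ p y) (right_mem_segment ℝ p y)
  rw [h0 p hp, sub_zero] at this
  calc ‖w y‖ ≤ _ := this
    _ = _ := by ring

/-- The points of `Ω` at distance more than `ε` from the complement of `Ω`; only used in proofs. -/
def innerRegion (Ω : Set (Rn n)) (ε : ℝ) : Set (Rn n) := (cthickening ε Ωᶜ)ᶜ

theorem isOpen_innerRegion (Ω : Set (Rn n)) (ε : ℝ) : IsOpen (innerRegion Ω ε) :=
  isClosed_cthickening.isOpen_compl

theorem closedBall_subset_of_inner {Ω : Set (Rn n)} {ε : ℝ} {y : Rn n} (hy : y ∈ innerRegion Ω ε) :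
    closedBall y ε ⊆ Ω := by
  intro z hz
  by_contra h
  exact hy (closedBall_subset_cthickening (show z ∈ Ωᶜ from h) ε (mem_closedBall_comm.1 hz))

theorem inner_subset {Ω : Set (Rn n)} {ε : ℝ} (hε : 0 ≤ ε) : innerRegion Ω ε ⊆ Ω := fun _ hy =>
  closedBall_subset_of_inner hy (mem_closedBall_self hε)

theorem sub_mem_inner {Ω : Set (Rn n)} {ε : ℝ} (hε : 0 ≤ ε) {x z : Rn n} (hx : x ∈ innerRegion Ω (2 * ε))
    (hz : ‖z‖ ≤ ε) : x - z ∈ innerRegion Ω ε := by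
  intro h
  apply hx
  rw [mem_cthickening_iff] at h ⊢
  calc infEDist x Ωᶜ ≤ edist x (x - z) + infEDist (x - z) Ωᶜ := infEDist_le_edist_add_infEDist
    _ ≤ ENNReal.ofReal ε + ENNReal.ofReal ε := by
        gcongr
        rw [edist_dist]; apply ENNReal.ofReal_le_ofReal
        simpa [dist_eq_norm] using hz
    _ = ENNReal.ofReal (2 * ε) := by rw [← ENNReal.ofReal_add hε hε, two_mul]

theorem exists_frontier_of_not_inner {Ω : Set (Rn n)} {ε : ℝ} (hε : 0 < ε) {x : Rn n} (hx : x ∈ Ω)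
    (h : x ∉ innerRegion Ω (2 * ε)) : ∃ p ∈ frontier Ω, ‖x - p‖ ≤ 3 * ε := by
  have h1 : x ∈ cthickening (2 * ε) Ωᶜ := by simpa only [innerRegion, Set.mem_compl_iff, not_not] using h
  have h2 := cthickening_subset_thickening' (show 0 < 3 * ε by linarith)
    (show 2 * ε < 3 * ε by linarith) Ωᶜ h1
  obtain ⟨z, hz, hd⟩ := mem_thickening_iff.1 h2
  obtain ⟨p, hp, hps⟩ := exists_frontier_near hx hz
  refine ⟨p, hp, ?_⟩
  obtain ⟨a, b, ha, hb, hab, rfl⟩ := hps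
  have : x - (a • x + b • z) = b • (x - z) := by
    rw [show a = 1 - b by linarith]; module
  rw [this, norm_smul, Real.norm_of_nonneg hb]
  rw [dist_eq_norm] at hd
  have : b ≤ 1 := by linarith
  nlinarith [norm_nonneg (x - z)]

theorem eventually_mem_inner {Ω : Set (Rn n)} (hΩ : IsOpen Ω) {x : Rn n} (hx : x ∈ Ω)
    {ε : ℕ → ℝ} (hε : Tendsto ε atTop (𝓝 0)) : ∀ᶠ k in atTop, x ∈ innerRegion Ω (2 * ε k) := by
  obtain ⟨r, hr, hb⟩ := Metric.isOpen_iff.1 hΩ x hx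
  have : Tendsto (fun k => 2 * ε k) atTop (𝓝 0) := by simpa using hε.const_mul 2
  filter_upwards [this.eventually (gt_mem_nhds hr)] with k hk h
  have h2 := cthickening_subset_thickening' hr hk Ωᶜ h
  obtain ⟨z, hz, hd⟩ := mem_thickening_iff.1 h2
  exact hz (hb (by rwa [mem_ball']))

theorem kernel_eq (Ω : Set (Rn n)) {ε : ℝ} (hε : 0 < ε) (w φ : Rn n → ℂ) (x : Rn n) :
    ∫ y in innerRegion Ω ε, w y * φ (ε⁻¹ • x + (-ε⁻¹) • y) =
      ε ^ n * ∫ z, (innerRegion Ω ε).indicator w (x - ε • z) * φ z := by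
  rw [← integral_indicator (isOpen_innerRegion Ω ε).measurableSet]
  have h1 := integral_sub_left_eq_self (μ := (volume : Measure (Rn n)))
    (fun y => (innerRegion Ω ε).indicator (fun y => w y * φ (ε⁻¹ • x + (-ε⁻¹) • y)) y) x
  rw [← h1]
  have h2 := Measure.integral_comp_smul (μ := (volume : Measure (Rn n)))
    (fun y => (innerRegion Ω ε).indicator (fun y => w y * φ (ε⁻¹ • x + (-ε⁻¹) • y)) (x - y)) ε
  have h3 : ∀ z, (innerRegion Ω ε).indicator (fun y => w y * φ (ε⁻¹ • x + (-ε⁻¹) • y)) (x - ε • z)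
      = (innerRegion Ω ε).indicator w (x - ε • z) * φ z := by
    intro z
    have : ε⁻¹ • x + (-ε⁻¹) • (x - ε • z) = z := by
      rw [smul_sub, smul_smul, neg_mul, inv_mul_cancel₀ hε.ne']; module
    by_cases h : x - ε • z ∈ innerRegion Ω ε
    · rw [Set.indicator_of_mem h, Set.indicator_of_mem h, this]
    · simp [h]
  simp only [h3] at h2
  rw [h2]
  have : (0:ℝ) < ε ^ n := by positivity
  simp only [finrank_euclideanSpace, Fintype.card_fin, abs_inv, abs_of_pos this,
    Complex.real_smul]
  push_cast
  rw [mul_inv_cancel_left₀]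
  exact_mod_cast this.ne'

theorem mollify_identity {Ω : Set (Rn n)} {u f w : Rn n → ℂ}
    (hu : Integrable u (volume.restrict Ω)) (hf : Integrable f (volume.restrict Ω))
    (hw : Continuous w) (hb : Bornology.IsBounded Ω) (h : HasDistribLaplacian Ω u f)
    {η : Rn n → ℂ} (hη : ContDiff ℝ ∞ η) (hηs : tsupport η ⊆ closedBall 0 1)
    {ε : ℝ} (hε : 0 < ε) :
    ∫ x in Ω, u x * ((ε : ℂ)⁻¹ ^ 2 * ∫ z, (innerRegion Ω ε).indicator w (x - ε • z) * Δ η z) =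
    ∫ x in Ω, f x * ∫ z, (innerRegion Ω ε).indicator w (x - ε • z) * η z := by
  have hηc : HasCompactSupport η := (isCompact_closedBall (0 : Rn n) 1).of_isClosed_subset
    (isClosed_tsupport η) hηs
  have hη2 : ContDiff ℝ 2 η := hη.of_le (by norm_cast)
  have hLc : Continuous (Δ η) := continuous_laplacian hη2
  have hbdd : ∀ g : Rn n → ℂ, Continuous g → HasCompactSupport g → ∃ C, ∀ x, ‖g x‖ ≤ C :=
    fun g hg hs => hs.exists_bound_of_continuous hg
  have hLs : HasCompactSupport (Δ η) := by
    have : Δ η = (fun L : Rn n →L[ℝ] Rn n →L[ℝ] ℂ =>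
        ∑ i, L (EuclideanSpace.basisFun (Fin n) ℝ i) (EuclideanSpace.basisFun (Fin n) ℝ i)) ∘
        fderiv ℝ (fderiv ℝ η) := funext (laplacian_apply η)
    rw [this]
    exact ((hηc.fderiv ℝ).fderiv ℝ).comp_left (by simp)
  have hwi : IntegrableOn w (innerRegion Ω ε) := by
    obtain ⟨R, hR⟩ := hb.subset_closedBall (0 : Rn n)
    exact (hw.continuousOn.integrableOn_compact (isCompact_closedBall (0 : Rn n) R)).mono_set
      ((inner_subset hε.le).trans hR)
  have swap : ∀ (a φ : Rn n → ℂ), Integrable a (volume.restrict Ω) → Continuous φ →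
      HasCompactSupport φ →
      ∫ x in Ω, a x * ∫ y in innerRegion Ω ε, w y * φ (ε⁻¹ • x + (-ε⁻¹) • y) =
      ∫ y in innerRegion Ω ε, w y * ∫ x in Ω, a x * φ (ε⁻¹ • x + (-ε⁻¹) • y) := by
    intro a φ ha hφ hφs
    obtain ⟨C, hC⟩ := hbdd φ hφ hφs
    have hint : Integrable (Function.uncurry fun x y => a x * (w y * φ (ε⁻¹ • x + (-ε⁻¹) • y)))
        ((volume.restrict Ω).prod (volume.restrict (innerRegion Ω ε))) := by
      have := (ha.mul_prod hwi).mul_bdd (c := C)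
        (g := fun p : Rn n × Rn n => φ (ε⁻¹ • p.1 + (-ε⁻¹) • p.2))
        (Continuous.aestronglyMeasurable (by fun_prop)) (ae_of_all _ fun p => hC _)
      refine this.congr (ae_of_all _ fun p => ?_)
      simp [Function.uncurry, mul_assoc]
    simp only [← integral_const_mul]
    rw [integral_integral_swap hint]
    refine integral_congr_ae (ae_of_all _ fun y => integral_congr_ae (ae_of_all _ fun x => ?_))
    simp only; ring
  have e1 := swap u (Δ η) hu hLc hLs
  have e2 := swap f η hf hη.continuous hηc
  have e3 : ∀ y ∈ innerRegion Ω ε, (ε : ℂ)⁻¹ ^ 2 * ∫ x in Ω, u x * Δ η (ε⁻¹ • x + (-ε⁻¹) • y) =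
      ∫ x in Ω, f x * η (ε⁻¹ • x + (-ε⁻¹) • y) := by
    intro y hy
    have hs : tsupport (fun x => η ((-ε⁻¹) • y + ε⁻¹ • x)) ⊆ closedBall y ε := by
      apply closure_minimal _ isClosed_closedBall
      intro x hx
      have := hηs (subset_tsupport η hx)
      rw [mem_closedBall_zero_iff] at this
      have e : (-ε⁻¹) • y + ε⁻¹ • x = ε⁻¹ • (x - y) := by module
      rw [e, norm_smul, norm_inv, Real.norm_of_nonneg hε.le, inv_mul_le_one₀ hε] at this
      rwa [mem_closedBall, dist_eq_norm]
    have ht : IsTestFunction Ω (fun x => η ((-ε⁻¹) • y + ε⁻¹ • x)) :=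
      ⟨hη.comp (by fun_prop), (isCompact_closedBall y ε).of_isClosed_subset
        (isClosed_tsupport _) hs, hs.trans (closedBall_subset_of_inner hy)⟩
    have := h _ ht
    simp only [laplacian_comp_affine hη2] at this
    rw [← integral_const_mul]
    refine Eq.trans ?_ (this.trans ?_)
    · refine integral_congr_ae (ae_of_all _ fun x => ?_)
      simp only; rw [add_comm (ε⁻¹ • x)]; push_cast; ring
    · refine integral_congr_ae (ae_of_all _ fun x => ?_)
      simp only; rw [add_comm (ε⁻¹ • x)]
  have hεn : ((ε : ℂ) ^ n) ≠ 0 := pow_ne_zero _ (by exact_mod_cast hε.ne')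
  simp only [kernel_eq Ω hε] at e1 e2
  have e4 : ∫ y in innerRegion Ω ε, w y * ∫ x in Ω, f x * η (ε⁻¹ • x + (-ε⁻¹) • y) =
      (ε : ℂ)⁻¹ ^ 2 * ∫ y in innerRegion Ω ε, w y * ∫ x in Ω, u x * Δ η (ε⁻¹ • x + (-ε⁻¹) • y) := by
    rw [← integral_const_mul]
    refine setIntegral_congr_fun (isOpen_innerRegion Ω ε).measurableSet fun y hy => ?_
    simp only [← e3 y hy]; ring
  rw [← e1, ← e2] at e4
  apply mul_left_cancel₀ hεn
  rw [← integral_const_mul, ← integral_const_mul]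
  rw [← integral_const_mul] at e4
  refine Eq.trans ?_ (e4.symm.trans ?_)
  · exact integral_congr_ae (ae_of_all _ fun x => by simp only; ring)
  · exact integral_congr_ae (ae_of_all _ fun x => by simp only; ring)

theorem tendsto_mollify {g η : Rn n → ℂ} (hg : Continuous g) (hη : Continuous η)
    (hηs : tsupport η ⊆ closedBall 0 1) (h1 : ∫ z, η z = 1) (x : Rn n) {ε : ℕ → ℝ}
    (hε : Tendsto ε atTop (𝓝 0)) :
    Tendsto (fun k => ∫ z, g (x - ε k • z) * η z) atTop (𝓝 (g x)) := by
  have hz : ∀ z, z ∉ closedBall (0 : Rn n) 1 → η z = 0 := fun z hz =>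
    image_eq_zero_of_notMem_tsupport fun h => hz (hηs h)
  have e : ∀ t : ℝ, ∫ z, g (x - t • z) * η z
      = ∫ z in closedBall (0 : Rn n) 1, g (x - t • z) * η z := fun t =>
    (setIntegral_eq_integral_of_forall_compl_eq_zero fun z h => by simp [hz z h]).symm
  have hc : Continuous fun t : ℝ => ∫ z in closedBall (0 : Rn n) 1, g (x - t • z) * η z := by
    apply continuous_parametric_integral_of_continuous _ (isCompact_closedBall _ _)
    simp only [Function.uncurry_def]; fun_prop
  have := (hc.tendsto 0).comp hε
  simp only [Function.comp_def, ← e] at this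
  simpa [integral_const_mul, h1] using this

theorem integral_bound {g φ : Rn n → ℂ} {A C : ℝ} (hC : 0 ≤ C)
    (hg : ∀ z ∈ closedBall (0 : Rn n) 1, ‖g z‖ ≤ C) (hφ : Continuous φ)
    (hφs : tsupport φ ⊆ closedBall 0 1) (hA : ∫ z, ‖φ z‖ ≤ A) :
    ‖∫ z, g z * φ z‖ ≤ C * A := by
  have hφc : HasCompactSupport φ := (isCompact_closedBall (0 : Rn n) 1).of_isClosed_subset
    (isClosed_tsupport φ) hφs
  calc ‖∫ z, g z * φ z‖ ≤ ∫ z, C * ‖φ z‖ := by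
        apply norm_integral_le_of_norm_le
          ((hφ.integrable_of_hasCompactSupport hφc).norm.const_mul C)
        refine ae_of_all _ fun z => ?_
        rw [norm_mul]
        by_cases hz : z ∈ closedBall (0 : Rn n) 1
        · gcongr; exact hg z hz
        · have : φ z = 0 := image_eq_zero_of_notMem_tsupport fun h => hz (hφs h)
          simp [this]
    _ = C * ∫ z, ‖φ z‖ := integral_const_mul _ _
    _ ≤ C * A := by gcongr

theorem exists_mollifier (n : ℕ) : ∃ η : Rn n → ℂ, ContDiff ℝ ∞ η ∧
    tsupport η ⊆ closedBall 0 1 ∧ ∫ z, η z = 1 := by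
  let b : ContDiffBump (0 : Rn n) := ⟨1 / 2, 1, by norm_num, by norm_num⟩
  refine ⟨fun z => ((b.normed volume z : ℝ) : ℂ), ?_, ?_, ?_⟩
  · exact Complex.ofRealCLM.contDiff.comp b.contDiff_normed
  · refine (closure_mono fun z hz => ?_).trans (b.tsupport_normed_eq (μ := volume)).subset
    simpa using hz
  · rw [integral_complex_ofReal, b.integral_normed]; simp

/-- If `Δ u = f` in `Ω` in the sense of distributions, and `w` is `C²` and vanishes together with
its gradient on `∂Ω`, then `∫ u Δw = ∫ f w`. This makes the trace below well defined. -/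
theorem green_of_cauchy_zero {Ω : Set (Rn n)} (hΩ : IsOpen Ω) (hb : Bornology.IsBounded Ω)
    {u f w : Rn n → ℂ} (hu : Integrable u (volume.restrict Ω))
    (hf : Integrable f (volume.restrict Ω)) (h : HasDistribLaplacian Ω u f)
    (hw : ContDiff ℝ 2 w) (h0 : ∀ x ∈ frontier Ω, w x = 0)
    (h1 : ∀ x ∈ frontier Ω, fderiv ℝ w x = 0) :
    ∫ x in Ω, u x * Δ w x = ∫ x in Ω, f x * w x := by
  obtain ⟨η, hη, hηs, hη1⟩ := exists_mollifier n
  have hηc : HasCompactSupport η := (isCompact_closedBall (0 : Rn n) 1).of_isClosed_subset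
    (isClosed_tsupport η) hηs
  have hη2 : ContDiff ℝ 2 η := hη.of_le (by norm_cast)
  have hLc : Continuous (Δ η) := continuous_laplacian hη2
  have hwL : Continuous (Δ w) := continuous_laplacian hw
  have hLs : tsupport (Δ η) ⊆ closedBall 0 1 := by
    refine (closure_minimal (fun z hz => ?_) (isClosed_tsupport η)).trans hηs
    by_contra hzn
    have : η =ᶠ[𝓝 z] fun _ => 0 := notMem_tsupport_iff_eventuallyEq.1 hzn
    apply hz
    have h2 := (this.fderiv (𝕜 := ℝ)).fderiv (𝕜 := ℝ)
    simp [laplacian_apply, h2.eq_of_nhds]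
  let ε : ℕ → ℝ := fun k => 1 / ((k : ℝ) + 1)
  have hεp : ∀ k, 0 < ε k := fun k => by positivity
  have hε1 : ∀ k, ε k ≤ 1 := fun k => by
    simp only [ε]; rw [div_le_one (by positivity)]; linarith [(Nat.cast_nonneg k : (0:ℝ) ≤ k)]
  have hε : Tendsto ε atTop (𝓝 0) := tendsto_one_div_add_atTop_nhds_zero_nat
  obtain ⟨R, hR⟩ := hb.subset_closedBall (0 : Rn n)
  obtain ⟨M, hM0, hM⟩ := quadratic_bound hb hw h0 h1
  obtain ⟨C0, hC0'⟩ := (isCompact_closedBall (0 : Rn n) R).exists_bound_of_continuousOn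
    hw.continuous.continuousOn
  obtain ⟨C2, hC2'⟩ := (isCompact_closedBall (0 : Rn n) R).exists_bound_of_continuousOn
    hwL.continuousOn
  have hC0 : ∀ x ∈ Ω, ‖w x‖ ≤ max C0 0 := fun x hx => (hC0' x (hR hx)).trans (le_max_left _ _)
  have hC2 : ∀ x ∈ Ω, ‖Δ w x‖ ≤ max C2 0 := fun x hx => (hC2' x (hR hx)).trans (le_max_left _ _)
  set K : ℕ → Rn n → ℂ := fun k x =>
    ((ε k : ℂ)⁻¹ ^ 2 * ∫ z, (innerRegion Ω (ε k)).indicator w (x - ε k • z) * Δ η z) with hK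
  set J : ℕ → Rn n → ℂ := fun k x =>
    ∫ z, (innerRegion Ω (ε k)).indicator w (x - ε k • z) * η z with hJ
  have farJ : ∀ φ : Rn n → ℂ, tsupport φ ⊆ closedBall 0 1 → ∀ k x, x ∈ innerRegion Ω (2 * ε k) →
      ∫ z, (innerRegion Ω (ε k)).indicator w (x - ε k • z) * φ z = ∫ z, w (x - ε k • z) * φ z := by
    intro φ hφs k x hx
    refine integral_congr_ae (ae_of_all _ fun z => ?_)
    by_cases hz : z ∈ closedBall (0 : Rn n) 1
    · have : x - ε k • z ∈ innerRegion Ω (ε k) := by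
        apply sub_mem_inner (hεp k).le hx
        rw [norm_smul, Real.norm_of_nonneg (hεp k).le]
        rw [mem_closedBall_zero_iff] at hz
        nlinarith [hεp k]
      simp [this]
    · have : φ z = 0 := image_eq_zero_of_notMem_tsupport fun h => hz (hφs h)
      simp [this]
  have farK : ∀ k x, x ∈ innerRegion Ω (2 * ε k) → K k x = ∫ z, Δ w (x - ε k • z) * η z := by
    intro k x hx
    have e : ∀ z, x - ε k • z = x + (-ε k) • z := fun z => by module
    have hne : (ε k : ℂ) ≠ 0 := by exact_mod_cast (hεp k).ne'
    simp only [hK]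
    rw [farJ (Δ η) hLs k x hx]
    simp only [e]
    have hcw : ContDiff ℝ 2 fun z => w (x + (-ε k) • z) := hw.comp (by fun_prop)
    rw [integral_mul_laplacian hcw hη2 hηc, ← integral_const_mul]
    refine integral_congr_ae (ae_of_all _ fun z => ?_)
    simp only [laplacian_comp_affine hw]
    push_cast
    field_simp
  have limK : ∀ x ∈ Ω, Tendsto (fun k => K k x) atTop (𝓝 (Δ w x)) := by
    intro x hx
    refine (tendsto_mollify hwL hη.continuous hηs hη1 x hε).congr' ?_
    filter_upwards [eventually_mem_inner hΩ hx hε] with k hk using (farK k x hk).symm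
  have limJ : ∀ x ∈ Ω, Tendsto (fun k => J k x) atTop (𝓝 (w x)) := by
    intro x hx
    refine (tendsto_mollify hw.continuous hη.continuous hηs hη1 x hε).congr' ?_
    filter_upwards [eventually_mem_inner hΩ hx hε] with k hk using (farJ η hηs k x hk).symm
  have bndJ : ∀ k x, ‖J k x‖ ≤ max C0 0 * ∫ z, ‖η z‖ := by
    intro k x
    refine integral_bound (le_max_right _ _) (fun z _ => ?_) hη.continuous hηs le_rfl
    by_cases hz : x - ε k • z ∈ innerRegion Ω (ε k)
    · simpa [hz] using hC0 _ (inner_subset (hεp k).le hz)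
    · simp [hz]
  have bndK : ∀ k, ∀ x ∈ Ω, ‖K k x‖ ≤
      max (max C2 0 * ∫ z, ‖η z‖) (16 * M * ∫ z, ‖Δ η z‖) := by
    intro k x hx
    by_cases hfar : x ∈ innerRegion Ω (2 * ε k)
    · refine le_trans ?_ (le_max_left _ _)
      rw [farK k x hfar]
      refine integral_bound (le_max_right _ _) (fun z hz => ?_) hη.continuous hηs le_rfl
      apply hC2
      apply inner_subset (hεp k).le
      apply sub_mem_inner (hεp k).le hfar
      rw [norm_smul, Real.norm_of_nonneg (hεp k).le]
      rw [mem_closedBall_zero_iff] at hz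
      nlinarith [hεp k]
    · refine le_trans ?_ (le_max_right _ _)
      obtain ⟨p, hp, hxp⟩ := exists_frontier_of_not_inner (hεp k) hx hfar
      have hb1 : ‖∫ z, (innerRegion Ω (ε k)).indicator w (x - ε k • z) * Δ η z‖ ≤
          (M * (4 * ε k) ^ 2) * ∫ z, ‖Δ η z‖ := by
        refine integral_bound (by positivity) (fun z hz => ?_) hLc hLs le_rfl
        by_cases hzi : x - ε k • z ∈ innerRegion Ω (ε k)
        · rw [Set.indicator_of_mem hzi]
          refine (hM _ (inner_subset (hεp k).le hzi) p hp).trans ?_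
          gcongr
          calc ‖x - ε k • z - p‖ = ‖(x - p) - ε k • z‖ := by congr 1; module
            _ ≤ ‖x - p‖ + ‖ε k • z‖ := norm_sub_le _ _
            _ ≤ 3 * ε k + ε k := by
              gcongr
              rw [norm_smul, Real.norm_of_nonneg (hεp k).le]
              rw [mem_closedBall_zero_iff] at hz
              nlinarith [hεp k]
            _ = 4 * ε k := by ring
        · rw [Set.indicator_of_notMem hzi]; simp; positivity
      simp only [hK, norm_mul, norm_pow, norm_inv, Complex.norm_real]
      rw [Real.norm_of_nonneg (hεp k).le]
      calc (ε k)⁻¹ ^ 2 * ‖∫ z, (innerRegion Ω (ε k)).indicator w (x - ε k • z) * Δ η z‖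
          ≤ (ε k)⁻¹ ^ 2 * ((M * (4 * ε k) ^ 2) * ∫ z, ‖Δ η z‖) := by gcongr
        _ = 16 * M * ∫ z, ‖Δ η z‖ := by
          have := (hεp k).ne'
          field_simp; ring
  have meas : ∀ (φ : Rn n → ℂ), Continuous φ → ∀ k, AEStronglyMeasurable
      (fun x => ∫ z, (innerRegion Ω (ε k)).indicator w (x - ε k • z) * φ z) (volume.restrict Ω) := by
    intro φ hφ k
    have hind : StronglyMeasurable ((innerRegion Ω (ε k)).indicator w) :=
      hw.continuous.stronglyMeasurable.indicator (isOpen_innerRegion Ω _).measurableSet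
    have : StronglyMeasurable (Function.uncurry fun (x z : Rn n) =>
        (innerRegion Ω (ε k)).indicator w (x - ε k • z) * φ z) := by
      refine StronglyMeasurable.mul ?_ (hφ.stronglyMeasurable.comp_measurable measurable_snd)
      exact hind.comp_measurable
        (g := fun p : Rn n × Rn n => p.1 - ε k • p.2) (by fun_prop)
    exact this.integral_prod_right.aestronglyMeasurable
  have t1 : Tendsto (fun k => ∫ x in Ω, u x * K k x) atTop (𝓝 (∫ x in Ω, u x * Δ w x)) := by
    refine tendsto_integral_of_dominated_convergence
      (fun x => ‖u x‖ * max (max C2 0 * ∫ z, ‖η z‖) (16 * M * ∫ z, ‖Δ η z‖))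
      (fun k => hu.aestronglyMeasurable.mul ((meas _ hLc k).const_mul _))
      (hu.norm.mul_const _) (fun k => ?_) ?_
    · filter_upwards [ae_restrict_mem hΩ.measurableSet] with x hx
      rw [norm_mul]; gcongr; exact bndK k x hx
    · filter_upwards [ae_restrict_mem hΩ.measurableSet] with x hx
      exact (limK x hx).const_mul _
  have t2 : Tendsto (fun k => ∫ x in Ω, f x * J k x) atTop (𝓝 (∫ x in Ω, f x * w x)) := by
    refine tendsto_integral_of_dominated_convergence
      (fun x => ‖f x‖ * (max C0 0 * ∫ z, ‖η z‖))
      (fun k => hf.aestronglyMeasurable.mul (meas _ hη.continuous k))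
      (hf.norm.mul_const _) (fun k => ?_) ?_
    · refine ae_of_all _ fun x => ?_
      rw [norm_mul]; gcongr; exact bndJ k x
    · filter_upwards [ae_restrict_mem hΩ.measurableSet] with x hx
      exact (limJ x hx).const_mul _
  refine tendsto_nhds_unique t1 (t2.congr fun k => ?_)
  exact (mollify_identity hu hf hw.continuous hb h hη hηs (hεp k)).symm

theorem integrable_mul_continuous {Ω : Set (Rn n)} (hΩ : IsOpen Ω) (hb : Bornology.IsBounded Ω)
    {u g : Rn n → ℂ} (hu : Integrable u (volume.restrict Ω)) (hg : Continuous g) :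
    Integrable (fun x => u x * g x) (volume.restrict Ω) := by
  obtain ⟨R, hR⟩ := hb.subset_closedBall (0 : Rn n)
  obtain ⟨C, hC⟩ := (isCompact_closedBall (0 : Rn n) R).exists_bound_of_continuousOn
    hg.continuousOn
  refine hu.mul_bdd (c := C) hg.aestronglyMeasurable ?_
  filter_upwards [ae_restrict_mem hΩ.measurableSet] with x hx using hC x (hR hx)

theorem IsTestFunction.contDiff_two {Ω : Set (Rn n)} {φ : Rn n → ℂ} (h : IsTestFunction Ω φ) :
    ContDiff ℝ 2 φ := h.smooth.of_le (by norm_cast)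

theorem HasDistribLaplacian.congr {Ω : Set (Rn n)} {u f u' f' : Rn n → ℂ}
    (h : HasDistribLaplacian Ω u f) (hu : u =ᵐ[volume.restrict Ω] u')
    (hf : f =ᵐ[volume.restrict Ω] f') : HasDistribLaplacian Ω u' f' := by
  intro φ hφ
  have e1 : ∫ x in Ω, u' x * Δ φ x = ∫ x in Ω, u x * Δ φ x :=
    integral_congr_ae (by filter_upwards [hu] with x hx; rw [hx])
  have e2 : ∫ x in Ω, f' x * φ x = ∫ x in Ω, f x * φ x :=
    integral_congr_ae (by filter_upwards [hf] with x hx; rw [hx])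
  rw [e1, e2, h φ hφ]

theorem HasDistribLaplacian.add {Ω : Set (Rn n)} (hΩ : IsOpen Ω) (hb : Bornology.IsBounded Ω)
    {u f u' f' : Rn n → ℂ} (hu : Integrable u (volume.restrict Ω))
    (hf : Integrable f (volume.restrict Ω)) (hu' : Integrable u' (volume.restrict Ω))
    (hf' : Integrable f' (volume.restrict Ω))
    (h : HasDistribLaplacian Ω u f) (h' : HasDistribLaplacian Ω u' f') :
    HasDistribLaplacian Ω (fun x => u x + u' x) (fun x => f x + f' x) := by
  intro φ hφ
  have c1 := continuous_laplacian hφ.contDiff_two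
  have c2 := hφ.smooth.continuous
  simp only [add_mul]
  rw [integral_add (integrable_mul_continuous hΩ hb hu c1) (integrable_mul_continuous hΩ hb hu' c1),
    integral_add (integrable_mul_continuous hΩ hb hf c2) (integrable_mul_continuous hΩ hb hf' c2),
    h φ hφ, h' φ hφ]

theorem HasDistribLaplacian.const_mul {Ω : Set (Rn n)} {u f : Rn n → ℂ} (c : ℂ)
    (h : HasDistribLaplacian Ω u f) :
    HasDistribLaplacian Ω (fun x => c * u x) (fun x => c * f x) := by
  intro φ hφ
  simp only [mul_assoc]
  rw [integral_const_mul, integral_const_mul, h φ hφ]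

theorem HasDistribLaplacian.unique {Ω : Set (Rn n)} (hΩ : IsOpen Ω) (hb : Bornology.IsBounded Ω)
    {u f g : Rn n → ℂ} (hf : Integrable f (volume.restrict Ω))
    (hg : Integrable g (volume.restrict Ω)) (h : HasDistribLaplacian Ω u f)
    (h' : HasDistribLaplacian Ω u g) : f =ᵐ[volume.restrict Ω] g := by
  have hi : IntegrableOn (fun x => f x - g x) Ω := hf.sub hg
  have key := hΩ.ae_eq_zero_of_integral_contDiff_smul_eq_zero (μ := volume)
    (f := fun x => f x - g x) hi.locallyIntegrableOn (by
      intro φ hφ hc hs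
      have hs' : tsupport (fun x => (φ x : ℂ)) ⊆ tsupport φ :=
        closure_mono fun z hz => by simpa using hz
      have ht : IsTestFunction Ω fun x => (φ x : ℂ) :=
        ⟨Complex.ofRealCLM.contDiff.comp hφ, hc.of_isClosed_subset (isClosed_tsupport _) hs',
          hs'.trans hs⟩
      have e : ∫ x in Ω, f x * (φ x : ℂ) = ∫ x in Ω, g x * (φ x : ℂ) :=
        (h _ ht).symm.trans (h' _ ht)
      have c2 := ht.smooth.continuous
      have e2 : ∫ x in Ω, φ x • (f x - g x) = 0 := by
        calc ∫ x in Ω, φ x • (f x - g x) = ∫ x in Ω, (f x * (φ x : ℂ) - g x * (φ x : ℂ)) := by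
              refine integral_congr_ae (ae_of_all _ fun x => ?_)
              simp only [Complex.real_smul]; ring
          _ = 0 := by
              rw [integral_sub (integrable_mul_continuous hΩ hb hf c2)
                (integrable_mul_continuous hΩ hb hg c2), e, sub_self]
      rw [← e2]
      refine (setIntegral_eq_integral_of_forall_compl_eq_zero fun x hx => ?_).symm
      have : φ x = 0 := image_eq_zero_of_notMem_tsupport fun h => hx (hs h)
      simp [this])
  filter_upwards [ae_restrict_of_ae key, ae_restrict_mem hΩ.measurableSet] with x hx hxΩ
  exact sub_eq_zero.1 (hx hxΩ)

/-- `ρ` is a `C²` defining function of `Ω` near `x`: near `x` the set `Ω` is `{ρ < 0}`, and `∇ρ(x) ≠ 0`.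
(Then, near `x`, the boundary of `Ω` is the `C²` hypersurface `{ρ = 0}`.) -/
structure IsDefiningFunctionAt (Ω : Set (Rn n)) (ρ : Rn n → ℝ) (x : Rn n) : Prop where
  contDiffAt : ContDiffAt ℝ 2 ρ x
  gradient_ne_zero : gradient ρ x ≠ 0
  eventually_mem_iff : ∀ᶠ y in 𝓝 x, (y ∈ Ω ↔ ρ y < 0)

theorem IsDefiningFunctionAt.eventually_frontier {Ω : Set (Rn n)} {ρ : Rn n → ℝ} {x : Rn n}
    (h : IsDefiningFunctionAt Ω ρ x) : ∀ᶠ y in 𝓝 x, ρ y = 0 → y ∈ frontier Ω := by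
  have hd : fderiv ℝ ρ x ≠ 0 := fun h0 => h.gradient_ne_zero (by simp [gradient, h0])
  have hc : ContinuousAt (fderiv ℝ ρ) x :=
    (h.contDiffAt.fderiv_right (m := 1) (by norm_num)).continuousAt
  filter_upwards [h.eventually_mem_iff.eventually_nhds, hc.eventually_ne hd] with y hy hyd h0
  refine ⟨?_, fun hint => ?_⟩
  · by_contra hcl
    have hcl' : ∀ᶠ z in 𝓝 y, z ∉ Ω := by
      filter_upwards [isClosed_closure.isOpen_compl.mem_nhds hcl] with z hz h
      exact hz (subset_closure h)
    apply hyd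
    apply IsLocalMin.fderiv_eq_zero
    filter_upwards [hy, hcl'] with z hz hz'
    rw [h0]
    exact not_lt.1 fun hlt => hz' (hz.2 hlt)
  · have := (hy.self_of_nhds).1 (interior_subset hint)
    linarith

theorem IsDefiningFunctionAt.eq_zero {Ω : Set (Rn n)} {ρ : Rn n → ℝ} {x : Rn n}
    (h : IsDefiningFunctionAt Ω ρ x) (hx : x ∈ frontier Ω) : ρ x = 0 := by
  have hc : ContinuousAt ρ x := h.contDiffAt.continuousAt
  rcases lt_trichotomy (ρ x) 0 with h0 | h0 | h0
  · exfalso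
    apply hx.2
    rw [mem_interior_iff_mem_nhds]
    filter_upwards [h.eventually_mem_iff, hc.eventually_lt_const h0] with y hy h1 using hy.2 h1
  · exact h0
  · exfalso
    have : Ωᶜ ∈ 𝓝 x := by
      filter_upwards [h.eventually_mem_iff, hc.eventually_const_lt h0] with y hy h1 h2
      exact absurd (hy.1 h2) (not_lt.2 h1.le)
    rw [← mem_interior_iff_mem_nhds, interior_compl] at this
    exact this hx.1

theorem IsDefiningFunctionAt.fderiv_eq_zero {Ω : Set (Rn n)} {ρ : Rn n → ℝ} {x : Rn n}
    (h : IsDefiningFunctionAt Ω ρ x) (hx : x ∈ frontier Ω) {g : Rn n → ℝ} (hg : ContDiff ℝ 2 g)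
    (h0 : ∀ y ∈ frontier Ω, g y = 0) (h1 : fderiv ℝ g x (gradient ρ x) = 0) :
    fderiv ℝ g x = 0 := by
  have hρ : HasStrictFDerivAt ρ (fderiv ℝ ρ x) x := h.contDiffAt.hasStrictFDerivAt (by norm_num)
  have hg' : HasStrictFDerivAt g (fderiv ℝ g x) x :=
    hg.contDiffAt.hasStrictFDerivAt (by norm_num)
  have hρx := h.eq_zero hx
  have hext : IsLocalExtrOn g {y | ρ y = ρ x} x := by
    left
    have : ∀ᶠ y in 𝓝[{y | ρ y = ρ x}] x, ρ y = ρ x := eventually_mem_nhdsWithin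
    filter_upwards [this, nhdsWithin_le_nhds h.eventually_frontier] with y hy hy'
    rw [h0 y (hy' (hy.trans hρx)), h0 x hx]
  obtain ⟨a, b, hab, hs⟩ := hext.exists_multipliers_of_hasStrictFDerivAt_1d hρ hg'
  have hgrad : fderiv ℝ ρ x (gradient ρ x) = ‖gradient ρ x‖ ^ 2 := by
    have : fderiv ℝ ρ x = InnerProductSpace.toDual ℝ (Rn n) (gradient ρ x) := by simp [gradient]
    rw [this, InnerProductSpace.toDual_apply_apply, real_inner_self_eq_norm_sq]
  have hpos : ‖gradient ρ x‖ ^ 2 ≠ 0 := pow_ne_zero _ (norm_ne_zero_iff.2 h.gradient_ne_zero)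
  have e := congrArg (fun L => L (gradient ρ x)) hs
  simp only [add_apply, smul_apply, hgrad, h1, smul_eq_mul, mul_zero, add_zero,
    zero_apply] at e
  have ha : a = 0 := by simpa [hpos] using e
  subst ha
  have hb : b ≠ 0 := fun hb => hab (by simp [hb])
  simpa [hb] using hs

/-- A bounded domain (nonempty, open, connected, bounded set) in `ℝⁿ` with `C²` boundary. -/
structure C2Domain (n : ℕ) where
  carrier : Set (Rn n)
  isOpen : IsOpen carrier
  isConnected : IsConnected carrier
  isBounded : Bornology.IsBounded carrier
  exists_definingFunction : ∀ x ∈ frontier carrier, ∃ ρ, IsDefiningFunctionAt carrier ρ x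

namespace C2Domain

variable (Ω : C2Domain n)

/-- Lebesgue measure on `Ω`. -/
noncomputable abbrev measure : Measure (Rn n) := volume.restrict Ω.carrier

/-- The complex space `L²(Ω)`. -/
noncomputable abbrev L2 : Type := Lp ℂ 2 Ω.measure

/-- The complex space `L^∞(Ω)`. -/
noncomputable abbrev LInfty : Type := Lp ℂ ⊤ Ω.measure

instance : IsFiniteMeasure Ω.measure := ⟨by
  rw [Measure.restrict_apply_univ]; exact Ω.isBounded.measure_lt_top⟩

theorem integrable_L2 (u : Ω.L2) : Integrable u Ω.measure :=
  (Lp.memLp u).integrable (by norm_num)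

theorem memLp_potential_mul (q : Ω.LInfty) (u : Ω.L2) :
    MemLp (fun x => q x * u x) 2 Ω.measure := (Lp.memLp u).mul (Lp.memLp q)

/-- `H_Δ(Ω) = {u ∈ L²(Ω) : Δu ∈ L²(Ω)}`, the maximal domain of the Laplacian. -/
noncomputable def HDelta : Submodule ℂ Ω.L2 where
  carrier := {u | ∃ f : Ω.L2, HasDistribLaplacian Ω.carrier u f}
  zero_mem' := ⟨0, fun φ _ => by
    have h0 : ((0 : Ω.L2) : Rn n → ℂ) =ᵐ[Ω.measure] 0 := Lp.coeFn_zero ℂ 2 Ω.measure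
    rw [integral_eq_zero_of_ae (by filter_upwards [h0] with x hx; rw [hx]; simp),
      integral_eq_zero_of_ae (by filter_upwards [h0] with x hx; rw [hx]; simp)]⟩
  add_mem' := by
    rintro u v ⟨f, hf⟩ ⟨g, hg⟩
    exact ⟨f + g, (hf.add Ω.isOpen Ω.isBounded (Ω.integrable_L2 u) (Ω.integrable_L2 f)
      (Ω.integrable_L2 v) (Ω.integrable_L2 g) hg).congr (Lp.coeFn_add u v).symm
      (Lp.coeFn_add f g).symm⟩
  smul_mem' := by
    rintro c u ⟨f, hf⟩
    exact ⟨c • f, (hf.const_mul c).congr (Lp.coeFn_smul c u).symm (Lp.coeFn_smul c f).symm⟩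

/-- The distributional Laplacian `H_Δ(Ω) → L²(Ω)`; it is unique by `HasDistribLaplacian.unique`. -/
noncomputable def distribLaplacian : Ω.HDelta →ₗ[ℂ] Ω.L2 where
  toFun u := u.2.choose
  map_add' u v := Lp.ext <| HasDistribLaplacian.unique Ω.isOpen Ω.isBounded
    (Ω.integrable_L2 _) (Ω.integrable_L2 _) (u + v).2.choose_spec <|
    (u.2.choose_spec.add Ω.isOpen Ω.isBounded (Ω.integrable_L2 _) (Ω.integrable_L2 _)
      (Ω.integrable_L2 _) (Ω.integrable_L2 _) v.2.choose_spec).congr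
      (Lp.coeFn_add _ _).symm (Lp.coeFn_add _ _).symm
  map_smul' c u := Lp.ext <| HasDistribLaplacian.unique Ω.isOpen Ω.isBounded
    (Ω.integrable_L2 _) (Ω.integrable_L2 _) (c • u).2.choose_spec <|
    (u.2.choose_spec.const_mul c).congr (Lp.coeFn_smul c (u : Ω.L2)).symm
      (Lp.coeFn_smul c u.2.choose).symm

theorem hasDistribLaplacian (u : Ω.HDelta) :
    HasDistribLaplacian Ω.carrier (u : Ω.L2) (Ω.distribLaplacian u) := u.2.choose_spec

/-- The Bergman space `b_q = {u ∈ L²(Ω) : (-Δ + q) u = 0}`, the equation `Δu = qu` being understood in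
the sense of distributions. -/
noncomputable def bergman (q : Ω.LInfty) : Submodule ℂ Ω.L2 where
  carrier := {u | HasDistribLaplacian Ω.carrier u (fun x => q x * u x)}
  zero_mem' := fun φ _ => by
    have h0 : ((0 : Ω.L2) : Rn n → ℂ) =ᵐ[Ω.measure] 0 := Lp.coeFn_zero ℂ 2 Ω.measure
    rw [integral_eq_zero_of_ae (by filter_upwards [h0] with x hx; rw [hx]; simp),
      integral_eq_zero_of_ae (by filter_upwards [h0] with x hx; rw [hx]; simp)]
  add_mem' := by
    intro u v hu hv
    refine (HasDistribLaplacian.add Ω.isOpen Ω.isBounded (Ω.integrable_L2 u)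
      ((Ω.memLp_potential_mul q u).integrable (by norm_num)) (Ω.integrable_L2 v)
      ((Ω.memLp_potential_mul q v).integrable (by norm_num)) hu hv).congr
      (Lp.coeFn_add u v).symm ?_
    filter_upwards [Lp.coeFn_add u v] with x hx
    rw [hx, Pi.add_apply, mul_add]
  smul_mem' := by
    intro c u hu
    refine (HasDistribLaplacian.const_mul c hu).congr (Lp.coeFn_smul c u).symm ?_
    filter_upwards [Lp.coeFn_smul c u] with x hx
    rw [hx, Pi.smul_apply, smul_eq_mul]; ring

theorem bergman_le_HDelta (q : Ω.LInfty) : Ω.bergman q ≤ Ω.HDelta := fun u hu =>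
  ⟨(Ω.memLp_potential_mul q u).toLp _, HasDistribLaplacian.congr hu (ae_eq_refl _)
    (MemLp.coeFn_toLp _).symm⟩

/-- `v ∈ H¹₀(Ω)`: `v` belongs to the closure of `C_c^∞(Ω)` in `H¹(Ω)`, i.e. there are test functions
`φ k` with `φ k → v` and `∇(φ k) → G` in `L²(Ω)` for some `G` (which is then the weak gradient of `v`). -/
def MemH10 (v : Ω.L2) : Prop :=
  ∃ (φ : ℕ → Rn n → ℂ) (G : Rn n → Rn n →L[ℝ] ℂ), MemLp G 2 Ω.measure ∧
    (∀ k, IsTestFunction Ω.carrier (φ k)) ∧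
    Tendsto (fun k => eLpNorm (fun x => φ k x - v x) 2 Ω.measure) atTop (𝓝 0) ∧
    Tendsto (fun k => eLpNorm (fun x => fderiv ℝ (φ k) x - G x) 2 Ω.measure) atTop (𝓝 0)

/-- `lam` is a Dirichlet eigenvalue of `-Δ + q` in `Ω`: there is `v ∈ H¹₀(Ω)`, `v ≠ 0`, with
`(-Δ + q) v = lam v`, that is `Δv = (q - lam) v` in the sense of distributions. -/
def IsDirichletEigenvalue (q : Ω.LInfty) (lam : ℂ) : Prop :=
  ∃ v : Ω.L2, v ≠ 0 ∧ Ω.MemH10 v ∧ HasDistribLaplacian Ω.carrier v (fun x => (q x - lam) * v x)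

/-- The exterior unit normal `ν = ∇ρ / |∇ρ|` at a boundary point, `ρ` being a local defining function. -/
noncomputable def outerNormal (x : frontier Ω.carrier) : Rn n :=
  let ρ := (Ω.exists_definingFunction x x.2).choose
  ‖gradient ρ x‖⁻¹ • gradient ρ (x : Rn n)

/-- The functions of class `C²` (up to the boundary, given as `C²` functions on `ℝⁿ`) which vanish on
`∂Ω`. -/
noncomputable def C2Zero : Submodule ℂ (Rn n → ℂ) where
  carrier := {w | ContDiff ℝ 2 w ∧ ∀ x ∈ frontier Ω.carrier, w x = 0}
  zero_mem' := ⟨contDiff_const, fun _ _ => rfl⟩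
  add_mem' := fun ha hb => ⟨ha.1.add hb.1, fun x hx => by simp [ha.2 x hx, hb.2 x hx]⟩
  smul_mem' := fun c w hw => ⟨hw.1.const_smul c, fun x hx => by simp [hw.2 x hx]⟩

/-- The normal derivative `w ↦ ∂_ν w|_{∂Ω}`, for `w` of class `C²` vanishing on `∂Ω`. -/
noncomputable def normalDeriv : Ω.C2Zero →ₗ[ℂ] (frontier Ω.carrier → ℂ) where
  toFun w x := fderiv ℝ (w : Rn n → ℂ) x (Ω.outerNormal x)
  map_add' w v := by
    funext x
    have hw := w.2.1.differentiable (by norm_num) (x : Rn n)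
    have hv := v.2.1.differentiable (by norm_num) (x : Rn n)
    simp [fderiv_add hw hv]
  map_smul' c w := by
    funext x
    have hw := w.2.1.differentiable (by norm_num) (x : Rn n)
    simp [fderiv_const_smul hw c]

theorem fderiv_eq_zero_of_normalDeriv_eq_zero (w : Ω.C2Zero) (h : Ω.normalDeriv w = 0) :
    ∀ x ∈ frontier Ω.carrier, fderiv ℝ (w : Rn n → ℂ) x = 0 := by
  intro x hx
  have hρ := (Ω.exists_definingFunction x hx).choose_spec
  set ρ := (Ω.exists_definingFunction x hx).choose with hρdef
  have hn : fderiv ℝ (w : Rn n → ℂ) x (gradient ρ x) = 0 := by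
    have h1 := congrFun h ⟨x, hx⟩
    change fderiv ℝ (w : Rn n → ℂ) x (‖gradient ρ x‖⁻¹ • gradient ρ x) = 0 at h1
    rw [map_smul, smul_eq_zero] at h1
    exact h1.resolve_left (inv_ne_zero (norm_ne_zero_iff.2 hρ.gradient_ne_zero))
  have hd := (w.2.1.differentiable (by norm_num) x).hasFDerivAt
  have hre := (Complex.reCLM.hasFDerivAt.comp x hd).fderiv
  have him := (Complex.imCLM.hasFDerivAt.comp x hd).fderiv
  have r := hρ.fderiv_eq_zero hx (g := Complex.reCLM ∘ (w : Rn n → ℂ))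
    (Complex.reCLM.contDiff.comp w.2.1) (fun y hy => by simp [w.2.2 y hy])
    (by rw [hre]; simp [hn])
  have i := hρ.fderiv_eq_zero hx (g := Complex.imCLM ∘ (w : Rn n → ℂ))
    (Complex.imCLM.contDiff.comp w.2.1) (fun y hy => by simp [w.2.2 y hy])
    (by rw [him]; simp [hn])
  rw [hre] at r
  rw [him] at i
  ext v
  apply Complex.ext
  · simpa using congrArg (fun L => L v) r
  · simpa using congrArg (fun L => L v) i

/-- The norm of `H²(Ω)`, for functions of class `C²`. -/
noncomputable def normSobolev2 (w : Rn n → ℂ) : ℝ :=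
  √(∑ k ∈ Finset.range 3, ∫ x in Ω.carrier, ‖iteratedFDeriv ℝ k w x‖ ^ 2)

/-- The functions on `∂Ω` of the form `∂_ν w`, with `w ∈ C²(closure Ω)` vanishing on `∂Ω`. By the trace
theorem, `∂_ν` is bounded and surjective from `H²(Ω) ∩ H¹₀(Ω)` onto `H^{1/2}(∂Ω)`. So this is a dense
subspace of `H^{1/2}(∂Ω)`, on which the norm of `H^{1/2}(∂Ω)` is equivalent to the quotient norm
`φ ↦ inf {‖w‖_{H²(Ω)} : ∂_ν w = φ}`. -/
noncomputable def NormalData : Submodule ℂ (frontier Ω.carrier → ℂ) := LinearMap.range Ω.normalDeriv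

/-- The normal derivative as a map onto `NormalData`. -/
noncomputable def toNormalData : Ω.C2Zero →ₗ[ℂ] Ω.NormalData := Ω.normalDeriv.rangeRestrict

/-- `H^{-1/2}(∂Ω)`, the dual of `H^{1/2}(∂Ω)`: the linear functionals on the dense subspace `NormalData`
which are bounded for the norm `inf {‖w‖_{H²(Ω)} : ∂_ν w = φ}` of `H^{1/2}(∂Ω)`. A function `g` on `∂Ω`
is identified with the functional `φ ↦ ∫_{∂Ω} g φ dσ` (bilinear pairing). -/
noncomputable def HMinusHalf : Submodule ℂ (Module.Dual ℂ Ω.NormalData) where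
  carrier := {l | ∃ C : ℝ, ∀ w : Ω.C2Zero, ‖l (Ω.toNormalData w)‖ ≤ C * Ω.normSobolev2 w}
  zero_mem' := ⟨0, fun w => by simp⟩
  add_mem' := by
    rintro a b ⟨A, hA⟩ ⟨B, hB⟩
    refine ⟨A + B, fun w => ?_⟩
    rw [LinearMap.add_apply, add_mul]
    exact (norm_add_le _ _).trans (add_le_add (hA w) (hB w))
  smul_mem' := by
    rintro c a ⟨A, hA⟩
    refine ⟨‖c‖ * A, fun w => ?_⟩
    rw [LinearMap.smul_apply, norm_smul, mul_assoc]
    gcongr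
    exact hA w

theorem integrable_mul (u : Ω.L2) {g : Rn n → ℂ} (hg : Continuous g) :
    Integrable (fun x => u x * g x) Ω.measure :=
  integrable_mul_continuous Ω.isOpen Ω.isBounded (Ω.integrable_L2 u) hg

/-- Green's form `∫_Ω (u Δw - w Δu)`, for `u ∈ H_Δ(Ω)` and `w` of class `C²` vanishing on `∂Ω`.
For `u` of class `C²` up to the boundary it equals `∫_{∂Ω} u ∂_ν w dσ`, by Green's second identity. -/
noncomputable def greenForm : Ω.HDelta →ₗ[ℂ] Ω.C2Zero →ₗ[ℂ] ℂ :=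
  LinearMap.mk₂ ℂ
    (fun u w => ∫ x in Ω.carrier,
      ((u : Ω.L2) x * Δ (w : Rn n → ℂ) x - Ω.distribLaplacian u x * (w : Rn n → ℂ) x))
    (by
      intro u v w
      have c1 := continuous_laplacian w.2.1
      have c2 := w.2.1.continuous
      refine Eq.trans ?_ (integral_add ((Ω.integrable_mul u c1).sub (Ω.integrable_mul _ c2))
        ((Ω.integrable_mul v c1).sub (Ω.integrable_mul _ c2)))
      refine integral_congr_ae ?_
      rw [map_add]
      filter_upwards [Lp.coeFn_add (u : Ω.L2) v,
        Lp.coeFn_add (Ω.distribLaplacian u) (Ω.distribLaplacian v)] with x h1 h2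
      rw [Submodule.coe_add, h1, h2]
      simp only [Pi.add_apply]; ring)
    (by
      intro c u w
      rw [smul_eq_mul, ← integral_const_mul]
      refine integral_congr_ae ?_
      rw [map_smul]
      filter_upwards [Lp.coeFn_smul c (u : Ω.L2),
        Lp.coeFn_smul c (Ω.distribLaplacian u)] with x h1 h2
      rw [Submodule.coe_smul, h1, h2]
      simp only [Pi.smul_apply, smul_eq_mul]; ring)
    (by
      intro u w v
      have c1 := continuous_laplacian w.2.1
      have c2 := w.2.1.continuous
      have d1 := continuous_laplacian v.2.1
      have d2 := v.2.1.continuous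
      refine Eq.trans ?_ (integral_add ((Ω.integrable_mul u c1).sub (Ω.integrable_mul _ c2))
        ((Ω.integrable_mul u d1).sub (Ω.integrable_mul _ d2)))
      refine integral_congr_ae (ae_of_all _ fun x => ?_)
      simp only [Submodule.coe_add, Pi.add_apply]
      rw [w.2.1.contDiffAt.laplacian_add v.2.1.contDiffAt]
      ring)
    (by
      intro c u w
      rw [smul_eq_mul, ← integral_const_mul]
      refine integral_congr_ae (ae_of_all _ fun x => ?_)
      simp only [Submodule.coe_smul, Pi.smul_apply, smul_eq_mul]
      rw [InnerProductSpace.laplacian_smul c w.2.1.contDiffAt, smul_eq_mul]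
      ring)

theorem greenForm_apply (u : Ω.HDelta) (w : Ω.C2Zero) :
    Ω.greenForm u w = ∫ x in Ω.carrier,
      ((u : Ω.L2) x * Δ (w : Rn n → ℂ) x - Ω.distribLaplacian u x * (w : Rn n → ℂ) x) := rfl

theorem greenForm_eq_zero (u : Ω.HDelta) (w : Ω.C2Zero) (h : Ω.normalDeriv w = 0) :
    Ω.greenForm u w = 0 := by
  rw [greenForm_apply, integral_sub (Ω.integrable_mul _ (continuous_laplacian w.2.1))
    (Ω.integrable_mul _ w.2.1.continuous), sub_eq_zero]
  exact green_of_cauchy_zero Ω.isOpen Ω.isBounded (Ω.integrable_L2 _) (Ω.integrable_L2 _)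
    (Ω.hasDistribLaplacian u) w.2.1 w.2.2 (Ω.fderiv_eq_zero_of_normalDeriv_eq_zero w h)

theorem ker_le_ker_greenForm (u : Ω.HDelta) :
    LinearMap.ker Ω.normalDeriv ≤ LinearMap.ker (Ω.greenForm u) := fun w hw =>
  Ω.greenForm_eq_zero u w hw

/-- The functional `∂_ν w ↦ ∫_Ω (u Δw - w Δu)` on `NormalData`; see `traceFunctional_apply`. -/
noncomputable def traceFunctional (u : Ω.HDelta) : Module.Dual ℂ Ω.NormalData :=
  (LinearMap.ker Ω.normalDeriv).liftQ (Ω.greenForm u) (Ω.ker_le_ker_greenForm u) ∘ₗ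
    Ω.normalDeriv.quotKerEquivRange.symm.toLinearMap

theorem traceFunctional_apply (u : Ω.HDelta) (w : Ω.C2Zero) :
    Ω.traceFunctional u (Ω.toNormalData w) = Ω.greenForm u w := by
  have : Ω.normalDeriv.quotKerEquivRange.symm (Ω.toNormalData w) =
      (LinearMap.ker Ω.normalDeriv).mkQ w :=
    Ω.normalDeriv.quotKerEquivRange.symm_apply_eq.2 rfl
  change (LinearMap.ker Ω.normalDeriv).liftQ (Ω.greenForm u) (Ω.ker_le_ker_greenForm u)
    (Ω.normalDeriv.quotKerEquivRange.symm (Ω.toNormalData w)) = _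
  rw [this]; simp

theorem norm_integral_mul_le (u : Ω.L2) {g : Rn n → ℂ} (hg : Continuous g) {A : ℝ}
    (hA : ∫ x in Ω.carrier, ‖g x‖ ^ 2 ≤ A ^ 2) (hA0 : 0 ≤ A) :
    ‖∫ x in Ω.carrier, u x * g x‖ ≤ √(∫ x in Ω.carrier, ‖u x‖ ^ 2) * A := by
  obtain ⟨R, hR⟩ := Ω.isBounded.subset_closedBall (0 : Rn n)
  obtain ⟨C, hC⟩ := (isCompact_closedBall (0 : Rn n) R).exists_bound_of_continuousOn
    hg.continuousOn
  have hgm : MemLp g 2 Ω.measure := MemLp.of_bound hg.aestronglyMeasurable C (by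
    filter_upwards [ae_restrict_mem Ω.isOpen.measurableSet] with x hx using hC x (hR hx))
  have hh := integral_mul_norm_le_Lp_mul_Lq (μ := Ω.measure) (f := u) (g := g)
    (p := 2) (q := 2) ⟨by norm_num, by norm_num, by norm_num⟩ (by simpa using Lp.memLp u)
    (by simpa using hgm)
  calc ‖∫ x in Ω.carrier, u x * g x‖ ≤ ∫ x in Ω.carrier, ‖u x * g x‖ :=
        norm_integral_le_integral_norm _
    _ = ∫ x in Ω.carrier, ‖u x‖ * ‖g x‖ := by simp only [norm_mul]
    _ ≤ √(∫ x in Ω.carrier, ‖u x‖ ^ 2) * √(∫ x in Ω.carrier, ‖g x‖ ^ 2) := by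
        simpa [Real.sqrt_eq_rpow] using hh
    _ ≤ _ := by
        gcongr
        exact Real.sqrt_le_left hA0 |>.2 hA

theorem integral_sq_le_normSobolev2 {w : Rn n → ℂ} (k : ℕ) (hk : k < 3) :
    ∫ x in Ω.carrier, ‖iteratedFDeriv ℝ k w x‖ ^ 2 ≤ Ω.normSobolev2 w ^ 2 := by
  have hnn : ∀ j ∈ Finset.range 3, 0 ≤ ∫ x in Ω.carrier, ‖iteratedFDeriv ℝ j w x‖ ^ 2 :=
    fun j _ => integral_nonneg fun x => by positivity
  rw [normSobolev2, Real.sq_sqrt (Finset.sum_nonneg hnn)]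
  exact Finset.single_le_sum (f := fun j => ∫ x in Ω.carrier, ‖iteratedFDeriv ℝ j w x‖ ^ 2) hnn
    (Finset.mem_range.2 hk)

theorem traceFunctional_mem (u : Ω.HDelta) : Ω.traceFunctional u ∈ Ω.HMinusHalf := by
  refine ⟨√(∫ x in Ω.carrier, ‖(u : Ω.L2) x‖ ^ 2) * n +
    √(∫ x in Ω.carrier, ‖Ω.distribLaplacian u x‖ ^ 2), fun w => ?_⟩
  have hN : 0 ≤ Ω.normSobolev2 w := Real.sqrt_nonneg _
  have c1 := continuous_laplacian w.2.1
  have c2 := w.2.1.continuous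
  rw [traceFunctional_apply, greenForm_apply, integral_sub (Ω.integrable_mul _ c1)
    (Ω.integrable_mul _ c2)]
  have b0 : ∫ x in Ω.carrier, ‖(w : Rn n → ℂ) x‖ ^ 2 ≤ Ω.normSobolev2 w ^ 2 := by
    simpa using Ω.integral_sq_le_normSobolev2 (w := w) 0 (by norm_num)
  have hpt : ∀ x, ‖Δ (w : Rn n → ℂ) x‖ ≤ n * ‖iteratedFDeriv ℝ 2 (w : Rn n → ℂ) x‖ := by
    intro x
    rw [InnerProductSpace.laplacian_eq_iteratedFDeriv_orthonormalBasis _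
      (EuclideanSpace.basisFun (Fin n) ℝ)]
    refine (norm_sum_le _ _).trans ?_
    calc _ ≤ ∑ _i : Fin n, ‖iteratedFDeriv ℝ 2 (w : Rn n → ℂ) x‖ := by
          refine Finset.sum_le_sum fun i _ => ?_
          refine (ContinuousMultilinearMap.le_opNorm _ _).trans ?_
          simp [Fin.prod_univ_two]
      _ = _ := by simp
  have hsq : ContinuousOn (fun x => ‖iteratedFDeriv ℝ 2 (w : Rn n → ℂ) x‖ ^ 2) Set.univ :=
    ((w.2.1.continuous_iteratedFDeriv le_rfl).norm.pow 2).continuousOn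
  have intc : ∀ g : Rn n → ℝ, Continuous g → Integrable g Ω.measure := by
    intro g hg
    obtain ⟨R, hR⟩ := Ω.isBounded.subset_closedBall (0 : Rn n)
    exact (hg.continuousOn.integrableOn_compact (isCompact_closedBall (0 : Rn n) R)).mono_set hR
  have b2 : ∫ x in Ω.carrier, ‖Δ (w : Rn n → ℂ) x‖ ^ 2 ≤ (n * Ω.normSobolev2 w) ^ 2 := by
    calc ∫ x in Ω.carrier, ‖Δ (w : Rn n → ℂ) x‖ ^ 2
        ≤ ∫ x in Ω.carrier, (n : ℝ) ^ 2 * ‖iteratedFDeriv ℝ 2 (w : Rn n → ℂ) x‖ ^ 2 := by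
          refine integral_mono (intc _ (by fun_prop))
            ((intc _ (continuousOn_univ.1 hsq)).const_mul _) fun x => ?_
          simp only
          rw [← mul_pow]
          gcongr
          exact hpt x
      _ = (n : ℝ) ^ 2 * ∫ x in Ω.carrier, ‖iteratedFDeriv ℝ 2 (w : Rn n → ℂ) x‖ ^ 2 :=
          integral_const_mul _ _
      _ ≤ (n : ℝ) ^ 2 * Ω.normSobolev2 w ^ 2 := by
          gcongr
          exact Ω.integral_sq_le_normSobolev2 2 (by norm_num)
      _ = _ := by ring
  have k1 := Ω.norm_integral_mul_le (u : Ω.L2) c1 b2 (by positivity)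
  have k2 := Ω.norm_integral_mul_le (Ω.distribLaplacian u) c2 b0 hN
  calc _ ≤ _ := norm_sub_le _ _
    _ ≤ _ := add_le_add k1 k2
    _ = _ := by ring

/-- The trace map `tr : H_Δ(Ω) → H^{-1/2}(∂Ω)`, the continuous extension of the restriction map
`u ↦ u|_{∂Ω}`, given by `⟨tr u, ∂_ν w⟩ = ∫_Ω (u Δw - w Δu)`. -/
noncomputable def trace : Ω.HDelta →ₗ[ℂ] Ω.HMinusHalf where
  toFun u := ⟨Ω.traceFunctional u, Ω.traceFunctional_mem u⟩
  map_add' u v := by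
    apply Subtype.ext
    apply LinearMap.ext
    rintro ⟨_, w, rfl⟩
    change Ω.traceFunctional (u + v) (Ω.toNormalData w) = Ω.traceFunctional u (Ω.toNormalData w) +
      Ω.traceFunctional v (Ω.toNormalData w)
    simp only [traceFunctional_apply, map_add, LinearMap.add_apply]
  map_smul' c u := by
    apply Subtype.ext
    apply LinearMap.ext
    rintro ⟨_, w, rfl⟩
    change Ω.traceFunctional (c • u) (Ω.toNormalData w) = c • Ω.traceFunctional u (Ω.toNormalData w)
    simp only [traceFunctional_apply, map_smul, LinearMap.smul_apply]

/-- `ℋ(∂Ω) = {tr u : u ∈ H_Δ(Ω)} ⊆ H^{-1/2}(∂Ω)`. -/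
noncomputable def boundaryH : Submodule ℂ Ω.HMinusHalf := LinearMap.range Ω.trace

/-- The trace map restricted to the Bergman space, `tr : b_q → ℋ(∂Ω)`. -/
noncomputable def bergmanTrace (q : Ω.LInfty) : Ω.bergman q →ₗ[ℂ] Ω.boundaryH :=
  Ω.trace.rangeRestrict ∘ₗ Submodule.inclusion (Ω.bergman_le_HDelta q)

end C2Domain

end PDETrace

namespace PDETrace

open MeasureTheory Filter Topology Metric
open scoped ContDiff ENNReal Laplacian InnerProductSpace

variable {n : ℕ}

/-! ### The resolvent of the Laplacian on the whole space, by Fourier multipliers -/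

section Resolvent

open SchwartzMap LineDeriv FourierTransform
open scoped SchwartzMap

/-! Both halves rest on solving the Dirichlet problem in `H¹₀(Ω)`. For `lam > 0` let `R` be the
Dirichlet resolvent: `v = R g` lies in `H¹₀(Ω)` and `Δv = lam v - g` (`resolvent_spec`). The
embedding of `H¹₀(Ω)` in `L²(Ω)` is compact (`exists_sampling_le`), hence so is `R`, and since `0`
is not a Dirichlet eigenvalue the Fredholm alternative solves `v = R(g + lam v - q v)`, that is `Δv
= q v - g`, uniquely (`exists_eq_resolvent`). Elements of `H¹₀(Ω) ∩ H_Δ(Ω)` have trace zero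
(`HasH10Gradient.pairing_laplacian`).

Surjectivity: given `u ∈ H_Δ(Ω)`, pick `v ∈ H¹₀(Ω)` with `(Δ - q) v = (Δ - q) u`. Then `u - v` lies
in `b_q` and has the trace of `u`.

Injectivity is harder, because an element `u` of `b_q` with trace zero is only known to be in
`L²(Ω)`. Put `v = R(lam u - q u)`. Then `z = u - v` has trace zero and `Δz = lam z`, which means
that `z` annihilates `Δw - lam w` for every `C²` function `w` vanishing on `∂Ω`. If these functions
are dense in `L²(Ω)`, then `u = v ∈ H¹₀(Ω)` and the eigenvalue hypothesis gives `u = 0`.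

The density, for one large `lam`, is `exists_lam_orthogonal_eq_zero`; it takes the place of `H²`
regularity up to the boundary. Near a boundary point a chart `Φ`, with derivative the identity at
that point, sends `∂Ω` into a hyperplane. If `S` is the reflection in it and `W` is the `S`-odd
Schwartz solution of `ΔW - lam W = G - G ∘ S`, then `w = χ · (W ∘ Φ)` is an admissible function. Up
to errors, `Δw - lam w` is `χ · (G - G ∘ S) ∘ Φ`: the second order errors carry a small factor from
the chart, the lower order ones a factor `lam^(-1/2)`. Letting `G` approximate the pushforward of
the conjugate of `z χ`, and absorbing the small term, one gets `‖z χ‖ ≤ C lam^(-1/2) ‖z‖` with `C`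
independent of `lam`. A finite cover of the closure of `Ω` then forces `z = 0` for large `lam`. -/

theorem norm_fourierMultiplier_toLp_le {g : Rn n → ℂ} (hg : g.HasTemperateGrowth) {C : ℝ}
    (hC : ∀ ξ, ‖g ξ‖ ≤ C) (f : 𝓢(Rn n, ℂ)) :
    ‖(fourierMultiplierCLM ℂ g f).toLp 2‖ ≤ C * ‖f.toLp 2‖ := by
  rw [← norm_fourier_toL2_eq, ← norm_fourier_toL2_eq f, fourierMultiplierCLM_apply,
    fourier_fourierInv_eq]
  refine Lp.norm_le_mul_norm_of_ae_le_mul ?_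
  filter_upwards [(smulLeftCLM ℂ g (𝓕 f)).coeFn_toLp 2, (𝓕 f).coeFn_toLp 2] with ξ h1 h2
  rw [h1, h2, smulLeftCLM_apply_apply hg, norm_smul]
  gcongr
  exact hC ξ

theorem norm_smul_toLp (c : ℂ) (f : 𝓢(Rn n, ℂ)) : ‖(c • f).toLp 2‖ = ‖c‖ * ‖f.toLp 2‖ :=
  (congrArg norm ((toLpCLM ℂ ℂ 2 (volume : Measure (Rn n))).map_smul c f)).trans (norm_smul _ _)

/-- The Fourier symbol of `(Δ - lam)⁻¹`. -/
noncomputable def resolventSymbol (n : ℕ) (lam : ℝ) (ξ : Rn n) : ℝ :=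
  -(lam + (2 * Real.pi * ‖ξ‖) ^ 2)⁻¹

/-- The symbol is a dilation of `(1 + ‖x‖²)⁻¹`, taken at `x = 2πξ / √lam`, times `-1/lam`. -/
theorem hasTemperateGrowth_resolventSymbol {lam : ℝ} (hl : 0 < lam) :
    (resolventSymbol n lam).HasTemperateGrowth := by
  have e : resolventSymbol n lam = fun ξ => (-lam⁻¹) *
      (fun x : Rn n => (1 + ‖x‖ ^ 2) ^ (-1 : ℝ))
        (((2 * Real.pi / √lam) • ContinuousLinearMap.id ℝ (Rn n)) ξ) := by
    funext ξ
    have hs : √lam ^ 2 = lam := Real.sq_sqrt hl.le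
    have h1 : ‖((2 * Real.pi / √lam) • ContinuousLinearMap.id ℝ (Rn n)) ξ‖ ^ 2
        = (2 * Real.pi * ‖ξ‖) ^ 2 / lam := by
      rw [smul_apply, ContinuousLinearMap.id_apply, norm_smul, mul_pow, mul_pow,
        Real.norm_eq_abs, sq_abs, div_pow, hs]
      ring
    simp only [h1, Real.rpow_neg_one, resolventSymbol]
    rw [neg_mul, ← mul_inv]
    congr 2
    field_simp
  rw [e]
  exact (Function.HasTemperateGrowth.const _).mul
    ((Function.hasTemperateGrowth_one_add_norm_sq_rpow (Rn n) (-1)).comp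
      (ContinuousLinearMap.hasTemperateGrowth _))

/-- With `t = 2π‖ξ‖` the three bounds are `t² ≤ lam + t²`, `t √lam ≤ lam + t²` and `√lam ≤ lam`. Two
derivatives of the solution cost nothing, while at most one derivative gains `lam^(-1/2)`; the gain
of `1/lam` at order zero is not needed. -/
theorem abs_resolventSymbol_mul_le {lam : ℝ} (hl : 1 ≤ lam) (ξ : Rn n) :
    (2 * Real.pi * ‖ξ‖) ^ 2 * |resolventSymbol n lam ξ| ≤ 1 ∧
    (2 * Real.pi * ‖ξ‖) * |resolventSymbol n lam ξ| ≤ (√lam)⁻¹ ∧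
    |resolventSymbol n lam ξ| ≤ (√lam)⁻¹ := by
  set t := 2 * Real.pi * ‖ξ‖ with ht
  have ht0 : 0 ≤ t := by positivity
  have hp : 0 < lam + t ^ 2 := by positivity
  have hs : √lam ^ 2 = lam := Real.sq_sqrt (by linarith)
  have hs1 : 1 ≤ √lam := Real.one_le_sqrt.2 hl
  rw [resolventSymbol, abs_neg, abs_inv, abs_of_pos hp]
  refine ⟨?_, ?_, ?_⟩
  · rw [mul_inv_le_iff₀ hp]; linarith
  · rw [mul_inv_le_iff₀ hp, ← div_eq_inv_mul, le_div_iff₀ (by positivity)]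
    nlinarith [sq_nonneg (t - √lam)]
  · rw [inv_le_inv₀ hp (by positivity)]
    nlinarith [sq_nonneg t]

/-- The equation `Δ W - lam W = G` in Schwartz space, with the a priori estimates in `L²`. -/
theorem exists_resolvent_schwartz {lam : ℝ} (hl : 1 ≤ lam) (G : 𝓢(Rn n, ℂ)) :
    ∃ W : 𝓢(Rn n, ℂ), (∀ x, Δ (W : Rn n → ℂ) x - lam * W x = G x) ∧
      (∀ u v : Rn n, ‖(∂_{u} (∂_{v} W)).toLp 2‖ ≤ ‖u‖ * ‖v‖ * ‖G.toLp 2‖) ∧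
      (∀ v : Rn n, ‖(∂_{v} W).toLp 2‖ ≤ ‖v‖ * (√lam)⁻¹ * ‖G.toLp 2‖) ∧
      ‖W.toLp 2‖ ≤ (√lam)⁻¹ * ‖G.toLp 2‖ := by
  have hl0 : 0 < lam := by linarith
  have hm : (fun ξ => (resolventSymbol n lam ξ : ℂ)).HasTemperateGrowth := by
    exact Function.HasTemperateGrowth.comp Function.Complex.hasTemperateGrowth_ofReal
      (hasTemperateGrowth_resolventSymbol hl0)
  have hi : ∀ v : Rn n, (fun ξ : Rn n => ((inner ℝ ξ v : ℝ) : ℂ)).HasTemperateGrowth := fun v =>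
    Function.HasTemperateGrowth.comp (Function.Complex.hasTemperateGrowth_ofReal)
      (Function.hasTemperateGrowth_inner_left v)
  have hder : ∀ (v : Rn n) (f : 𝓢(Rn n, ℂ)), ∂_{v} f = (2 * Real.pi * Complex.I) •
      fourierMultiplierCLM ℂ (fun ξ : Rn n => ((inner ℝ ξ v : ℝ) : ℂ)) f := by
    intro v f
    rw [lineDeriv_eq_fourierMultiplierCLM, ← fourierMultiplierCLM_ofReal ℂ (by fun_prop)]
    rfl
  set W := fourierMultiplierCLM ℂ (fun ξ => (resolventSymbol n lam ξ : ℂ)) G with hW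
  have hin : ∀ (v ξ : Rn n), ‖((inner ℝ ξ v : ℝ) : ℂ)‖ ≤ ‖ξ‖ * ‖v‖ := fun v ξ => by
    rw [Complex.norm_real]; exact norm_inner_le_norm _ _
  have h2pi : ‖(2 * Real.pi * Complex.I : ℂ)‖ = 2 * Real.pi := by
    simp [abs_of_pos Real.pi_pos]
  refine ⟨W, fun x => ?_, fun u v => ?_, fun v => ?_, ?_⟩
  · have hL : Δ W = -(2 * Real.pi) ^ 2 • fourierMultiplierCLM ℂ
        (fun ξ : Rn n => ((‖ξ‖ ^ 2 : ℝ) : ℂ)) W := by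
      rw [laplacian_eq_fourierMultiplierCLM, ← fourierMultiplierCLM_ofReal ℂ
        (Function.hasTemperateGrowth_norm_sq (Rn n))]
      rfl
    have hn2 : (fun ξ : Rn n => ((‖ξ‖ ^ 2 : ℝ) : ℂ)).HasTemperateGrowth :=
      Function.HasTemperateGrowth.comp (Function.Complex.hasTemperateGrowth_ofReal)
        (Function.hasTemperateGrowth_norm_sq (Rn n))
    have key : Δ W - (lam : ℂ) • W = G := by
      apply (fourierCLE ℂ 𝓢(Rn n, ℂ)).injective
      simp only [fourierCLE_apply]
      ext ξ
      rw [hL, hW, fourierMultiplierCLM_fourierMultiplierCLM_apply hn2 hm]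
      simp only [sub_eq_add_neg, FourierTransform.fourier_add, ← neg_smul,
        FourierTransform.fourier_smul,
        fourierMultiplierCLM_apply, fourier_fourierInv_eq, add_apply, smul_apply,
        smulLeftCLM_apply_apply (hn2.mul hm), smulLeftCLM_apply_apply hm]
      have hp : (lam + (2 * Real.pi * ‖ξ‖) ^ 2 : ℂ) ≠ 0 := by
        have : 0 < lam + (2 * Real.pi * ‖ξ‖) ^ 2 := by positivity
        exact_mod_cast this.ne'
      simp only [Pi.mul_apply, resolventSymbol, smul_eq_mul, Complex.real_smul]
      push_cast
      have e := inv_mul_cancel₀ hp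
      linear_combination (𝓕 G ξ) * e
    have := congrArg (fun f : 𝓢(Rn n, ℂ) => f x) key
    rw [← SchwartzMap.laplacian_apply]
    simpa using this
  · rw [hder u, hder v, map_smul, hW, fourierMultiplierCLM_fourierMultiplierCLM_apply (hi v) hm,
      fourierMultiplierCLM_fourierMultiplierCLM_apply (hi u) ((hi v).mul hm), smul_smul,
      norm_smul_toLp, norm_mul, h2pi]
    -- The factor `(2π · 2π)⁻¹` cancels the `(2πi)²` coming from the two derivatives, so that the
    -- bound on `(2π‖ξ‖)²` times the symbol enters with constant one.
    refine (mul_le_mul_of_nonneg_left (norm_fourierMultiplier_toLp_le ((hi u).mul ((hi v).mul hm))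
      (C := ‖u‖ * ‖v‖ * ((2 * Real.pi) * (2 * Real.pi))⁻¹) (fun ξ => ?_) G) (by positivity)).trans
      (le_of_eq (by field_simp))
    simp only [Pi.mul_apply, norm_mul]
    rw [← div_eq_mul_inv, le_div_iff₀ (by positivity)]
    have h1 := (abs_resolventSymbol_mul_le hl ξ).1
    have h2 : ‖(resolventSymbol n lam ξ : ℂ)‖ = |resolventSymbol n lam ξ| := by
      rw [Complex.norm_real, Real.norm_eq_abs]
    rw [h2]
    calc _ ≤ (‖ξ‖ * ‖u‖) * ((‖ξ‖ * ‖v‖) * |resolventSymbol n lam ξ|) *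
          (2 * Real.pi * (2 * Real.pi)) := by gcongr <;> exact hin _ _
      _ = ‖u‖ * ‖v‖ * ((2 * Real.pi * ‖ξ‖) ^ 2 * |resolventSymbol n lam ξ|) := by ring
      _ ≤ ‖u‖ * ‖v‖ * 1 := by gcongr
      _ = _ := mul_one _
  · rw [hder v, hW, fourierMultiplierCLM_fourierMultiplierCLM_apply (hi v) hm,
      norm_smul_toLp, h2pi]
    refine (mul_le_mul_of_nonneg_left (norm_fourierMultiplier_toLp_le ((hi v).mul hm)
      (C := ‖v‖ * (√lam)⁻¹ * (2 * Real.pi)⁻¹) (fun ξ => ?_) G) (by positivity)).trans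
      (le_of_eq (by field_simp))
    simp only [Pi.mul_apply, norm_mul]
    rw [← div_eq_mul_inv, le_div_iff₀ (by positivity)]
    have h1 := (abs_resolventSymbol_mul_le hl ξ).2.1
    have h2 : ‖(resolventSymbol n lam ξ : ℂ)‖ = |resolventSymbol n lam ξ| := by
      rw [Complex.norm_real, Real.norm_eq_abs]
    rw [h2]
    calc _ ≤ (‖ξ‖ * ‖v‖) * |resolventSymbol n lam ξ| * (2 * Real.pi) := by
          gcongr; exact hin _ _
      _ = ‖v‖ * ((2 * Real.pi * ‖ξ‖) * |resolventSymbol n lam ξ|) := by ring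
      _ ≤ ‖v‖ * (√lam)⁻¹ := by gcongr
  · exact norm_fourierMultiplier_toLp_le hm (fun ξ => by
      rw [Complex.norm_real]; exact (abs_resolventSymbol_mul_le hl ξ).2.2) G

end Resolvent

/-! ### Odd solutions with respect to a reflection -/

section OddResolvent

open SchwartzMap LineDeriv
open scoped SchwartzMap

/-- Composition of a Schwartz function with a linear isometry. -/
noncomputable def compIsometry (S : Rn n ≃ₗᵢ[ℝ] Rn n) (f : 𝓢(Rn n, ℂ)) : 𝓢(Rn n, ℂ) :=
  compCLMOfContinuousLinearEquiv ℂ S.toContinuousLinearEquiv f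

theorem compIsometry_apply (S : Rn n ≃ₗᵢ[ℝ] Rn n) (f : 𝓢(Rn n, ℂ)) (x : Rn n) :
    compIsometry S f x = f (S x) := rfl

theorem lineDeriv_compIsometry (S : Rn n ≃ₗᵢ[ℝ] Rn n) (f : 𝓢(Rn n, ℂ)) (v : Rn n) :
    ∂_{v} (compIsometry S f) = compIsometry S (∂_{S v} f) :=
  lineDerivOp_compCLMOfContinuousLinearEquiv ℂ v S.toContinuousLinearEquiv f

/-- The Laplacian may be computed in any orthonormal basis; on the right the image under `S` of the
standard basis is used. -/
theorem laplacian_compIsometry (S : Rn n ≃ₗᵢ[ℝ] Rn n) (f : 𝓢(Rn n, ℂ)) :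
    Δ (compIsometry S f) = compIsometry S (Δ f) := by
  rw [laplacian_eq_sum (EuclideanSpace.basisFun (Fin n) ℝ),
    laplacian_eq_sum ((EuclideanSpace.basisFun (Fin n) ℝ).map S)]
  simp only [lineDeriv_compIsometry, OrthonormalBasis.map_apply]
  simp only [compIsometry, map_sum]

theorem norm_toLp_compIsometry (S : Rn n ≃ₗᵢ[ℝ] Rn n) (f : 𝓢(Rn n, ℂ)) :
    ‖(compIsometry S f).toLp 2‖ = ‖f.toLp 2‖ := by
  rw [norm_toLp, norm_toLp]
  congr 1
  exact eLpNorm_comp_measurePreserving (g := f) f.continuous.aestronglyMeasurable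
    S.measurePreserving

theorem norm_toLp_sub_le (f g : 𝓢(Rn n, ℂ)) : ‖(f - g).toLp 2‖ ≤ ‖f.toLp 2‖ + ‖g.toLp 2‖ :=
  (congrArg norm ((toLpCLM ℂ ℂ 2 (volume : Measure (Rn n))).map_sub f g)).trans_le
    (norm_sub_le _ _)

theorem lineDeriv_sub' (v : Rn n) (f g : 𝓢(Rn n, ℂ)) : ∂_{v} (f - g) = ∂_{v} f - ∂_{v} g :=
  (lineDerivOpCLM ℂ 𝓢(Rn n, ℂ) v).map_sub f g

/-- The equation `Δ W - lam W = G - G ∘ S`, with a solution `W` which is odd with respect to `S`. -/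
theorem exists_odd_resolvent {lam : ℝ} (hl : 1 ≤ lam) (S : Rn n ≃ₗᵢ[ℝ] Rn n) (G : 𝓢(Rn n, ℂ)) :
    ∃ W : 𝓢(Rn n, ℂ), (∀ x, Δ (W : Rn n → ℂ) x - lam * W x = G x - G (S x)) ∧
      (∀ x, S x = x → W x = 0) ∧
      (∀ u v : Rn n, ‖(∂_{u} (∂_{v} W)).toLp 2‖ ≤ 2 * (‖u‖ * ‖v‖ * ‖G.toLp 2‖)) ∧
      (∀ v : Rn n, ‖(∂_{v} W).toLp 2‖ ≤ 2 * (‖v‖ * (√lam)⁻¹ * ‖G.toLp 2‖)) ∧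
      ‖W.toLp 2‖ ≤ 2 * ((√lam)⁻¹ * ‖G.toLp 2‖) := by
  obtain ⟨W, h0, h1, h2, h3⟩ := exists_resolvent_schwartz hl G
  refine ⟨W - compIsometry S W, fun x => ?_, fun x hx => ?_, fun u v => ?_, fun v => ?_, ?_⟩
  · have e : Δ (W - compIsometry S W) x = Δ W x - Δ W (S x) := by
      have : Δ (W - compIsometry S W) = Δ W - compIsometry S (Δ W) := by
        rw [← laplacian_compIsometry]
        exact (LineDeriv.laplacianCLM ℂ (Rn n) 𝓢(Rn n, ℂ)).map_sub _ _ |> fun h => by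
          simpa only [SchwartzMap.laplacianCLM_eq] using h
      rw [this]; rfl
    rw [← SchwartzMap.laplacian_apply, e, SchwartzMap.laplacian_apply, SchwartzMap.laplacian_apply,
      ← h0, ← h0, sub_apply, compIsometry_apply]
    ring
  · rw [sub_apply, compIsometry_apply, hx, sub_self]
  · rw [lineDeriv_sub', lineDeriv_sub', lineDeriv_compIsometry, lineDeriv_compIsometry]
    refine (norm_toLp_sub_le _ _).trans ?_
    rw [norm_toLp_compIsometry]
    have := h1 (S u) (S v)
    rw [S.norm_map, S.norm_map] at this
    linarith [h1 u v]
  · rw [lineDeriv_sub', lineDeriv_compIsometry]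
    refine (norm_toLp_sub_le _ _).trans ?_
    rw [norm_toLp_compIsometry]
    have := h2 (S v)
    rw [S.norm_map] at this
    linarith [h2 v]
  · refine (norm_toLp_sub_le _ _).trans ?_
    rw [norm_toLp_compIsometry]
    linarith

end OddResolvent

/-! ### Charts which flatten the boundary -/

section Straightening

/-- The map which replaces the coordinate in the direction of the unit vector `e` by `ρ`. -/
noncomputable def straighten (ρ : Rn n → ℝ) (e x : Rn n) : Rn n := x + (ρ x - ⟪x, e⟫_ℝ) • e

/-- This is what makes the chart useful: the sign of `ρ` becomes the side of the hyperplane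
orthogonal to `e`, and `{ρ = 0}` is sent into that hyperplane. -/
theorem inner_straighten (ρ : Rn n → ℝ) {e : Rn n} (he : ‖e‖ = 1) (x : Rn n) :
    ⟪straighten ρ e x, e⟫_ℝ = ρ x := by
  simp [straighten, inner_add_left, inner_smul_left, he]

theorem hasFDerivAt_straighten {ρ : Rn n → ℝ} (e : Rn n) {x : Rn n} (h : DifferentiableAt ℝ ρ x) :
    HasFDerivAt (straighten ρ e) (ContinuousLinearMap.id ℝ (Rn n) +
      (fderiv ℝ ρ x - innerSL ℝ e).smulRight e) x := by
  have h1 : HasFDerivAt (fun y : Rn n => ⟪y, e⟫_ℝ) (innerSL ℝ e) x := by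
    have := (innerSL ℝ e).hasFDerivAt (x := x)
    refine this.congr_of_eventuallyEq (Eventually.of_forall fun y => ?_)
    simp [real_inner_comm]
  exact (hasFDerivAt_id x).add ((h.hasFDerivAt.sub h1).smul_const e)

/-- A straightening chart on a ball around `p`. -/
structure IsStraightening (ρ : Rn n → ℝ) (e p : Rn n) (r η M : ℝ) : Prop where
  contDiffAt : ∀ x ∈ ball p r, ContDiffAt ℝ 2 ρ x
  fderiv_sub_le : ∀ x ∈ ball p r, ‖fderiv ℝ ρ x - innerSL ℝ e‖ ≤ η
  injOn : Set.InjOn (straighten ρ e) (ball p r)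
  det_ge : ∀ x ∈ ball p r, 1 / 2 ≤ |(ContinuousLinearMap.id ℝ (Rn n) +
      (fderiv ℝ ρ x - innerSL ℝ e).smulRight e).det|
  det_le : ∀ x ∈ ball p r, |(ContinuousLinearMap.id ℝ (Rn n) +
      (fderiv ℝ ρ x - innerSL ℝ e).smulRight e).det| ≤ 2
  fderiv_fderiv_le : ∀ x ∈ ball p r, ‖fderiv ℝ (fderiv ℝ ρ) x‖ ≤ M

theorem eventually_ball_subset {P : Rn n → Prop} {p : Rn n} (h : ∀ᶠ x in 𝓝 p, P x) :
    ∃ r > 0, ∀ x ∈ ball p r, P x := Metric.eventually_nhds_iff_ball.1 h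

/-- Since the gradient of `ρ` at `p` is `e`, the chart has derivative the identity at `p`. All the
required bounds are strict there and continuous, hence hold on a small ball, with `η` as small as
desired; injectivity comes from strict differentiability. -/
theorem exists_isStraightening {ρ : Rn n → ℝ} {e p : Rn n} (hρ : ContDiffAt ℝ 2 ρ p)
    (hg : fderiv ℝ ρ p = innerSL ℝ e) {η : ℝ} (hη : 0 < η) {P : Rn n → Prop}
    (hP : ∀ᶠ x in 𝓝 p, P x) :
    ∃ r > 0, ∃ M, IsStraightening ρ e p r η M ∧ ∀ x ∈ ball p r, P x := by
  have c1 : ContDiffAt ℝ 1 (fderiv ℝ ρ) p := hρ.fderiv_right (by norm_num)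
  have cn : ContinuousAt (fun x => ‖fderiv ℝ (fderiv ℝ ρ) x‖) p :=
    ContinuousAt.norm (c1.fderiv_right (m := 0) (by norm_num)).continuousAt
  have cs : ContinuousAt (fun x => fderiv ℝ ρ x - innerSL ℝ e) p :=
    c1.continuousAt.sub continuousAt_const
  have e1 : ∀ᶠ x in 𝓝 p, ContDiffAt ℝ 2 ρ x := hρ.eventually (by simp)
  have e2 : ∀ᶠ x in 𝓝 p, ‖fderiv ℝ ρ x - innerSL ℝ e‖ < η :=
    cs.norm.eventually_lt_const (by simpa [hg] using hη)
  have e3 : ∀ᶠ x in 𝓝 p, 1 / 2 < |(ContinuousLinearMap.id ℝ (Rn n) +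
      (fderiv ℝ ρ x - innerSL ℝ e).smulRight e).det| ∧ |(ContinuousLinearMap.id ℝ (Rn n) +
      (fderiv ℝ ρ x - innerSL ℝ e).smulRight e).det| < 2 := by
    have : ContinuousAt (fun x => |(ContinuousLinearMap.id ℝ (Rn n) +
      (fderiv ℝ ρ x - innerSL ℝ e).smulRight e).det|) p := by
      refine (ContinuousLinearMap.continuous_det.continuousAt.comp
        (continuousAt_const.add ?_)).abs
      exact ((ContinuousLinearMap.smulRightL ℝ (Rn n) (Rn n)).flip e).continuous.continuousAt.comp cs
    have e0 : ContinuousLinearMap.id ℝ (Rn n) +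
      (fderiv ℝ ρ p - innerSL ℝ e).smulRight e = ContinuousLinearMap.id ℝ (Rn n) := by
      rw [hg]; ext; simp
    have e5 : (ContinuousLinearMap.id ℝ (Rn n)).det = 1 := LinearMap.det_id
    refine (this.eventually_const_lt ?_).and (this.eventually_lt_const ?_) <;>
      (simp only [e0, e5]; norm_num)
  have e4 : ∀ᶠ x in 𝓝 p, ‖fderiv ℝ (fderiv ℝ ρ) x‖ < ‖fderiv ℝ (fderiv ℝ ρ) p‖ + 1 :=
    cn.eventually_lt_const (by linarith)
  have hst : HasStrictFDerivAt (straighten ρ e)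
      ((ContinuousLinearEquiv.refl ℝ (Rn n) : Rn n ≃L[ℝ] Rn n) : Rn n →L[ℝ] Rn n) p := by
    have hc : ContDiffAt ℝ 1 (straighten ρ e) p := by
      unfold straighten
      have := hρ.of_le (m := 1) (by norm_num)
      exact contDiffAt_id.add ((this.sub (contDiffAt_id.inner ℝ contDiffAt_const)).smul
        contDiffAt_const)
    have h1 := hc.hasStrictFDerivAt (by norm_num)
    have h2 := (hasFDerivAt_straighten e (hρ.differentiableAt (by norm_num))).fderiv
    rw [h2, hg] at h1
    convert! h1 using 1
    ext; simp
  -- A map which differs from the identity by a Lipschitz map of constant less than one is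
  -- injective.
  obtain ⟨s, hs, ha⟩ := hst.approximates_deriv_on_nhds (c := 1 / 2) (Or.inr (by norm_num))
  have hinj : Set.InjOn (straighten ρ e) s := by
    refine ha.injOn ?_
    rcases subsingleton_or_nontrivial (Rn n) with h | h
    · exact Or.inl h
    · right
      rw [ContinuousLinearEquiv.refl_symm, ContinuousLinearEquiv.coe_refl,
        ContinuousLinearMap.nnnorm_id]
      norm_num
  obtain ⟨r, hr, h⟩ := eventually_ball_subset (e1.and (e2.and (e3.and (e4.and (hP.and hs)))))
  exact ⟨r, hr, _, ⟨fun x hx => (h x hx).1, fun x hx => (h x hx).2.1.le,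
    hinj.mono fun x hx => (h x hx).2.2.2.2.2, fun x hx => (h x hx).2.2.1.1.le,
    fun x hx => (h x hx).2.2.1.2.le,
    fun x hx => (h x hx).2.2.2.1.le⟩, fun x hx => (h x hx).2.2.2.2.1⟩

end Straightening

/-! ### Change of variables in `L²` norms -/

section ChangeOfVariables

theorem eLpNorm_two_le_of_lintegral_le {α β E F : Type*} [MeasurableSpace α] [MeasurableSpace β]
    [NormedAddCommGroup E] [NormedAddCommGroup F] {μ : Measure α} {ν : Measure β} {f : α → E}
    {g : β → F} (h : ∫⁻ x, ‖f x‖ₑ ^ 2 ∂μ ≤ 4 * ∫⁻ x, ‖g x‖ₑ ^ 2 ∂ν) :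
    eLpNorm f 2 μ ≤ 2 * eLpNorm g 2 ν := by
  rw [eLpNorm_eq_lintegral_rpow_enorm_toReal (by norm_num) (by norm_num),
    eLpNorm_eq_lintegral_rpow_enorm_toReal (by norm_num) (by norm_num)]
  simp only [ENNReal.toReal_ofNat, ENNReal.rpow_ofNat]
  refine (ENNReal.rpow_le_rpow h (by norm_num)).trans_eq ?_
  rw [ENNReal.mul_rpow_of_nonneg _ _ (by norm_num)]
  congr 1
  rw [show (4 : ℝ≥0∞) = 2 ^ (2 : ℝ) by norm_num, ← ENNReal.rpow_mul]
  norm_num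

variable {ρ : Rn n → ℝ} {e p : Rn n} {r η M : ℝ}

theorem IsStraightening.hasFDerivWithinAt (h : IsStraightening ρ e p r η M) {s : Set (Rn n)}
    (hs : s ⊆ ball p r) : ∀ x ∈ s, HasFDerivWithinAt (straighten ρ e)
      (ContinuousLinearMap.id ℝ (Rn n) + (fderiv ℝ ρ x - innerSL ℝ e).smulRight e) s x :=
  fun x hx => (hasFDerivAt_straighten e
    ((h.contDiffAt x (hs hx)).differentiableAt (by norm_num))).hasFDerivWithinAt

/-- The Jacobian is at least `1/2`, so composition costs a factor 2 under the integral of the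
square; it is relaxed to 4 in order to have the constant 2 for the norm. -/
theorem IsStraightening.eLpNorm_comp_le {E : Type*} [NormedAddCommGroup E]
    (h : IsStraightening ρ e p r η M) {s : Set (Rn n)} (hs : s ⊆ ball p r) (hm : MeasurableSet s)
    (F : Rn n → E) :
    eLpNorm (fun x => F (straighten ρ e x)) 2 (volume.restrict s) ≤ 2 * eLpNorm F 2 volume := by
  refine eLpNorm_two_le_of_lintegral_le ?_
  have key := lintegral_image_eq_lintegral_abs_det_fderiv_mul volume hm (h.hasFDerivWithinAt hs)
    (h.injOn.mono hs) (fun y => ‖F y‖ₑ ^ 2)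
  calc ∫⁻ x in s, ‖F (straighten ρ e x)‖ₑ ^ 2
      ≤ ∫⁻ x in s, 2 * (ENNReal.ofReal |(ContinuousLinearMap.id ℝ (Rn n) +
          (fderiv ℝ ρ x - innerSL ℝ e).smulRight e).det| * ‖F (straighten ρ e x)‖ₑ ^ 2) := by
        refine setLIntegral_mono' hm fun x hx => ?_
        rw [← mul_assoc]
        refine le_mul_of_one_le_left (by positivity) ?_
        calc (1 : ℝ≥0∞) ≤ ENNReal.ofReal (2 * |(ContinuousLinearMap.id ℝ (Rn n) +
              (fderiv ℝ ρ x - innerSL ℝ e).smulRight e).det|) :=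
              ENNReal.one_le_ofReal.2 (by linarith [h.det_ge x (hs hx)])
          _ = _ := by rw [ENNReal.ofReal_mul (by norm_num), ENNReal.ofReal_ofNat]
    _ = 2 * ∫⁻ x in straighten ρ e '' s, ‖F x‖ₑ ^ 2 := by
        rw [lintegral_const_mul' _ _ (by norm_num), key]
    _ ≤ 4 * ∫⁻ x, ‖F x‖ₑ ^ 2 := by
        gcongr
        · norm_num
        · exact Measure.restrict_le_self

/-- The function `g` is `f ∘ Φ⁻¹` extended by zero, and its norm is controlled by the upper bound on
the Jacobian. The vanishing off the image is essential later: the reflection moves the image of `Ω`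
to the other side of the hyperplane, where `g = 0`. -/
theorem IsStraightening.exists_pushforward (h : IsStraightening ρ e p r η M) {s : Set (Rn n)}
    (hs : s ⊆ ball p r) (hm : MeasurableSet s) {f : Rn n → ℂ} (hf : Measurable f) :
    ∃ g : Rn n → ℂ, Measurable g ∧ (∀ x ∈ s, g (straighten ρ e x) = f x) ∧
      (∀ y, y ∉ straighten ρ e '' s → g y = 0) ∧
      eLpNorm g 2 volume ≤ 2 * eLpNorm f 2 (volume.restrict s) := by
  have hd := h.hasFDerivWithinAt hs
  have hinj := h.injOn.mono hs
  have hemb := measurableEmbedding_of_fderivWithin hm hd hinj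
  have him : MeasurableSet (straighten ρ e '' s) :=
    measurable_image_of_fderivWithin hm hd hinj
  obtain ⟨g, hg, hgf⟩ := hemb.exists_measurable_extend (g := fun x : s => f x)
    (hf.comp measurable_subtype_coe) (fun _ => inferInstance)
  have hgs : ∀ x ∈ s, g (straighten ρ e x) = f x := fun x hx => congrFun hgf ⟨x, hx⟩
  refine ⟨(straighten ρ e '' s).indicator g, hg.indicator him, fun x hx => ?_, fun y hy => ?_, ?_⟩
  · rw [Set.indicator_of_mem (Set.mem_image_of_mem _ hx), hgs x hx]
  · exact Set.indicator_of_notMem hy _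
  · rw [eLpNorm_indicator_eq_eLpNorm_restrict him]
    refine eLpNorm_two_le_of_lintegral_le ?_
    rw [lintegral_image_eq_lintegral_abs_det_fderiv_mul volume hm hd hinj (fun y => ‖g y‖ₑ ^ 2),
      ← lintegral_const_mul' _ _ (by norm_num)]
    refine setLIntegral_mono' hm fun x hx => ?_
    rw [hgs x hx]
    gcongr
    refine (ENNReal.ofReal_le_ofReal (h.det_le x (hs hx))).trans ?_
    rw [ENNReal.ofReal_ofNat]; norm_num

end ChangeOfVariables

/-! ### The Laplacian of a localized function in the chart -/

section CutoffComposition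

open SchwartzMap LineDeriv
open scoped SchwartzMap

variable {ρ : Rn n → ℝ} {e p : Rn n} {r η M : ℝ}

theorem fderiv_mul_apply {f g : Rn n → ℂ} {x : Rn n} (hf : DifferentiableAt ℝ f x)
    (hg : DifferentiableAt ℝ g x) (v : Rn n) :
    fderiv ℝ (fun y => f y * g y) x v = fderiv ℝ f x v * g x + f x * fderiv ℝ g x v := by
  rw [fderiv_fun_mul hf hg]
  simp [mul_comm, add_comm]

theorem fderiv_comp_straighten (F : 𝓢(Rn n, ℂ)) {x : Rn n} (h : DifferentiableAt ℝ ρ x)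
    (v : Rn n) : fderiv ℝ (fun y => F (straighten ρ e y)) x v =
      ∂_{v} F (straighten ρ e x) +
        ((fderiv ℝ ρ x v - ⟪e, v⟫_ℝ : ℝ) : ℂ) * ∂_{e} F (straighten ρ e x) := by
  have := (F.hasFDerivAt (straighten ρ e x)).comp x (hasFDerivAt_straighten e h)
  rw [show (fun y => F (straighten ρ e y)) = F ∘ straighten ρ e from rfl, this.fderiv]
  simp [lineDerivOp_apply_eq_fderiv, map_smul]

theorem differentiableAt_comp_straighten (F : 𝓢(Rn n, ℂ)) {x : Rn n}
    (h : DifferentiableAt ℝ ρ x) : DifferentiableAt ℝ (fun y => F (straighten ρ e y)) x :=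
  ((F.hasFDerivAt (straighten ρ e x)).comp x (hasFDerivAt_straighten e h)).differentiableAt

theorem contDiffAt_straighten {x : Rn n} (h : ContDiffAt ℝ 2 ρ x) :
    ContDiffAt ℝ 2 (straighten ρ e) x :=
  contDiffAt_id.add ((h.sub (contDiffAt_id.inner ℝ contDiffAt_const)).smul contDiffAt_const)

theorem IsStraightening.contDiff_mul_comp (h : IsStraightening ρ e p r η M) {χ : Rn n → ℂ}
    (hχ : ContDiff ℝ ∞ χ) (hs : tsupport χ ⊆ ball p r) (W : 𝓢(Rn n, ℂ)) :
    ContDiff ℝ 2 (fun x => χ x * W (straighten ρ e x)) := by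
  rw [contDiff_iff_contDiffAt]
  intro x
  by_cases hx : x ∈ ball p r
  · have h1 : ContDiffAt ℝ 2 χ x := (hχ.of_le (by norm_cast)).contDiffAt
    have h2 : ContDiffAt ℝ 2 (fun x => W (straighten ρ e x)) x :=
      ((W.smooth 2).contDiffAt).comp x (contDiffAt_straighten (h.contDiffAt x hx))
    exact h1.mul h2
  · have : χ =ᶠ[𝓝 x] fun _ => 0 := notMem_tsupport_iff_eventuallyEq.1 fun hc => hx (hs hc)
    refine (contDiffAt_const (c := (0 : ℂ))).congr_of_eventuallyEq ?_
    filter_upwards [this] with y hy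
    rw [hy, zero_mul]

/-- The derivative of the chart in the direction `v` is `v + α e` with `α = Dρ(x) v - ⟪e, v⟫`. The
terms are grouped by size: the principal one; second derivatives of `W` multiplied by `α` or `α²`,
which are small in the chart; and terms with at most one derivative of `W`, which are small for
large `lam`. -/
theorem IsStraightening.fderiv_fderiv_mul_comp (h : IsStraightening ρ e p r η M) {χ : Rn n → ℂ}
    (hχ : ContDiff ℝ ∞ χ) (hs : tsupport χ ⊆ ball p r) (W : 𝓢(Rn n, ℂ)) {x : Rn n}
    (hx : x ∈ ball p r) (v : Rn n) :
    fderiv ℝ (fderiv ℝ (fun x => χ x * W (straighten ρ e x))) x v v =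
      χ x * ∂_{v} (∂_{v} W) (straighten ρ e x) +
      (2 * χ x * (fderiv ℝ ρ x v - ⟪e, v⟫_ℝ : ℝ) * ∂_{v} (∂_{e} W) (straighten ρ e x) +
      χ x * ((fderiv ℝ ρ x v - ⟪e, v⟫_ℝ : ℝ) : ℂ) ^ 2 * ∂_{e} (∂_{e} W) (straighten ρ e x)) +
      (fderiv ℝ (fderiv ℝ χ) x v v * W (straighten ρ e x) +
      2 * fderiv ℝ χ x v * ∂_{v} W (straighten ρ e x) +
      2 * fderiv ℝ χ x v * (fderiv ℝ ρ x v - ⟪e, v⟫_ℝ : ℝ) * ∂_{e} W (straighten ρ e x) +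
      χ x * (fderiv ℝ (fderiv ℝ ρ) x v v : ℝ) * ∂_{e} W (straighten ρ e x)) := by
  have hw := h.contDiff_mul_comp hχ hs W
  have hχ2 : ContDiff ℝ 2 χ := hχ.of_le (by norm_cast)
  have hχd : Differentiable ℝ χ := hχ2.differentiable (by norm_num)
  have hχ1 : Differentiable ℝ (fderiv ℝ χ) :=
    (hχ2.fderiv_right (m := 1) (by norm_num)).differentiable (by norm_num)
  have hw1 : Differentiable ℝ (fderiv ℝ (fun x => χ x * W (straighten ρ e x))) :=
    (hw.fderiv_right (m := 1) (by norm_num)).differentiable (by norm_num)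
  have hρd : ∀ y ∈ ball p r, DifferentiableAt ℝ ρ y := fun y hy =>
    (h.contDiffAt y hy).differentiableAt (by norm_num)
  have hρ1 : DifferentiableAt ℝ (fderiv ℝ ρ) x :=
    ((h.contDiffAt x hx).fderiv_right (m := 1) (by norm_num)).differentiableAt (by norm_num)
  have e1 : fderiv ℝ (fun y => fderiv ℝ (fun x => χ x * W (straighten ρ e x)) y v) x v =
      fderiv ℝ (fderiv ℝ (fun x => χ x * W (straighten ρ e x))) x v v := by
    rw [((hw1 x).hasFDerivAt.clm_apply (hasFDerivAt_const v x)).fderiv]; simp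
  have e2 : fderiv ℝ (fun y => fderiv ℝ χ y v) x v = fderiv ℝ (fderiv ℝ χ) x v v := by
    rw [((hχ1 x).hasFDerivAt.clm_apply (hasFDerivAt_const v x)).fderiv]; simp
  have e3 : HasFDerivAt (fun y => ((fderiv ℝ ρ y v - ⟪e, v⟫_ℝ : ℝ) : ℂ))
      (Complex.ofRealCLM.comp ((fderiv ℝ (fderiv ℝ ρ) x).flip v)) x := by
    have h1 := (hρ1.hasFDerivAt.clm_apply (hasFDerivAt_const v x)).sub_const (⟪e, v⟫_ℝ)
    have h2 := (Complex.ofRealCLM.hasFDerivAt).comp x h1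
    convert! h2 using 1
    ext w; simp
  have d2 : DifferentiableAt ℝ (fun y => fderiv ℝ χ y v) x :=
    ((hχ1 x).hasFDerivAt.clm_apply (hasFDerivAt_const v x)).differentiableAt
  have hev : (fun y => fderiv ℝ (fun x => χ x * W (straighten ρ e x)) y v) =ᶠ[𝓝 x] fun y =>
      fderiv ℝ χ y v * W (straighten ρ e y) + χ y * (∂_{v} W (straighten ρ e y) +
        ((fderiv ℝ ρ y v - ⟪e, v⟫_ℝ : ℝ) : ℂ) * ∂_{e} W (straighten ρ e y)) := by
    filter_upwards [isOpen_ball.mem_nhds hx] with y hy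
    rw [fderiv_mul_apply (hχd y) (differentiableAt_comp_straighten W (hρd y hy)),
      fderiv_comp_straighten W (hρd y hy)]
  have c1 := differentiableAt_comp_straighten (e := e) W (hρd x hx)
  have c2 := differentiableAt_comp_straighten (e := e) (∂_{v} W) (hρd x hx)
  have c3 := differentiableAt_comp_straighten (e := e) (∂_{e} W) (hρd x hx)
  -- Symmetry of second derivatives merges the two cross terms into one with coefficient 2.
  have hsymm : ∂_{e} (∂_{v} W) (straighten ρ e x) = ∂_{v} (∂_{e} W) (straighten ρ e x) := by
    have hd : Differentiable ℝ (fderiv ℝ W) :=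
      ((W.smooth 2).fderiv_right (m := 1) (by norm_num)).differentiable (by norm_num)
    have key : ∀ a b y : Rn n, ∂_{a} (∂_{b} W) y = fderiv ℝ (fderiv ℝ W) y a b := fun a b y => by
      rw [lineDerivOp_apply_eq_fderiv, show ((∂_{b} W : 𝓢(Rn n, ℂ)) : Rn n → ℂ) = fun y => fderiv ℝ W y b from rfl,
        ((hd y).hasFDerivAt.clm_apply (hasFDerivAt_const b y)).fderiv]
      simp
    rw [key, key]
    exact ((W.smooth 2).contDiffAt.isSymmSndFDerivAt (by simp)).eq e v
  have s2 := e3.differentiableAt.fun_mul c3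
  have t0 := congrArg (fun L => L v) (fderiv_fun_add (d2.fun_mul c1)
    ((hχd x).fun_mul (c2.fun_add s2)))
  have t1 := fderiv_mul_apply d2 c1 v
  have t2 := fderiv_mul_apply (hχd x) (c2.fun_add s2) v
  have t3 := fderiv_mul_apply e3.differentiableAt c3 v
  have t4 := congrArg (fun L => L v) (fderiv_fun_add c2 s2)
  simp only [add_apply] at t0 t4
  rw [← e1, hev.fderiv_eq, t0, t1, t2, t4, t3, e2, e3.fderiv, fderiv_comp_straighten W (hρd x hx),
    fderiv_comp_straighten (∂_{v} W) (hρd x hx), fderiv_comp_straighten (∂_{e} W) (hρd x hx), hsymm]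
  simp only [ContinuousLinearMap.comp_apply, ContinuousLinearMap.flip_apply,
    Complex.ofRealCLM_apply]
  ring

/-- Sum of the second derivatives which occur in the error of the straightened Laplacian. -/
noncomputable def secondOrderSum (e : Rn n) (W : 𝓢(Rn n, ℂ)) (y : Rn n) : ℝ :=
  ∑ i, (‖∂_{EuclideanSpace.basisFun (Fin n) ℝ i} (∂_{e} W) y‖ + ‖∂_{e} (∂_{e} W) y‖)

/-- Sum of the lower order derivatives which occur in the error of the straightened Laplacian. -/
noncomputable def firstOrderSum (e : Rn n) (W : 𝓢(Rn n, ℂ)) (y : Rn n) : ℝ :=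
  ∑ i, (‖W y‖ + ‖∂_{EuclideanSpace.basisFun (Fin n) ℝ i} W y‖ + ‖∂_{e} W y‖)

theorem IsStraightening.norm_laplacian_sub_le (h : IsStraightening ρ e p r η M) (hη : η ≤ 1)
    (hη0 : 0 ≤ η) (hM : 0 ≤ M) {χ : Rn n → ℂ}
    (hχ : ContDiff ℝ ∞ χ) (hs : tsupport χ ⊆ ball p r) {K : ℝ} (hK : 0 ≤ K)
    (hK0 : ∀ x, ‖χ x‖ ≤ K) (hK1 : ∀ x, ‖fderiv ℝ χ x‖ ≤ K)
    (hK2 : ∀ x, ‖fderiv ℝ (fderiv ℝ χ) x‖ ≤ K) (W : 𝓢(Rn n, ℂ)) {x : Rn n}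
    (hx : x ∈ ball p r) :
    ‖Δ (fun x => χ x * W (straighten ρ e x)) x - χ x * Δ (W : Rn n → ℂ) (straighten ρ e x)‖ ≤
      2 * η * ‖χ x‖ * secondOrderSum e W (straighten ρ e x) +
        K * (4 + M) * firstOrderSum e W (straighten ρ e x) := by
  rw [laplacian_apply, ← SchwartzMap.laplacian_apply,
    SchwartzMap.laplacian_eq_sum (EuclideanSpace.basisFun (Fin n) ℝ), sum_apply, Finset.mul_sum,
    ← Finset.sum_sub_distrib, secondOrderSum, firstOrderSum, Finset.mul_sum, Finset.mul_sum,
    ← Finset.sum_add_distrib]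
  refine (norm_sum_le _ _).trans (Finset.sum_le_sum fun i _ => ?_)
  set v := EuclideanSpace.basisFun (Fin n) ℝ i with hv
  have hv1 : ‖v‖ = 1 := (EuclideanSpace.basisFun (Fin n) ℝ).norm_eq_one i
  rw [h.fderiv_fderiv_mul_comp hχ hs W hx v]
  set y := straighten ρ e x
  set α := fderiv ℝ ρ x v - ⟪e, v⟫_ℝ with hα
  have hα1 : ‖(α : ℂ)‖ ≤ η := by
    rw [Complex.norm_real]
    have := (fderiv ℝ ρ x - innerSL ℝ e).le_of_opNorm_le (h.fderiv_sub_le x hx) v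
    simpa [hv1] using this
  have hb : ‖((fderiv ℝ (fderiv ℝ ρ) x v v : ℝ) : ℂ)‖ ≤ M := by
    rw [Complex.norm_real]
    have := (fderiv ℝ (fderiv ℝ ρ) x).le_of_opNorm₂_le_of_le (h.fderiv_fderiv_le x hx)
      hv1.le hv1.le
    simpa using this
  have hc1 : ‖fderiv ℝ χ x v‖ ≤ K := by
    simpa [hv1] using (fderiv ℝ χ x).le_of_opNorm_le (hK1 x) v
  have hc2 : ‖fderiv ℝ (fderiv ℝ χ) x v v‖ ≤ K := by
    simpa using (fderiv ℝ (fderiv ℝ χ) x).le_of_opNorm₂_le_of_le (hK2 x) hv1.le hv1.le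
  rw [add_assoc, add_sub_cancel_left]
  refine (norm_add_le _ _).trans (add_le_add ?_ ?_)
  · refine (norm_add_le _ _).trans ?_
    simp only [norm_mul, norm_pow, Complex.norm_ofNat]
    -- As `|α| ≤ η ≤ 1`, the square is bounded linearly in `η`, so that both second order errors
    -- carry the same factor `2 * η`.
    have h2 : ‖(α : ℂ)‖ ^ 2 ≤ 2 * η := by nlinarith [norm_nonneg (α : ℂ)]
    calc _ ≤ 2 * ‖χ x‖ * η * ‖∂_{v} (∂_{e} W) y‖ + ‖χ x‖ * (2 * η) * ‖∂_{e} (∂_{e} W) y‖ := by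
          gcongr
      _ = _ := by ring
  · refine (norm_add_le _ _).trans ((add_le_add (norm_add₃_le ..) le_rfl).trans ?_)
    simp only [norm_mul, Complex.norm_ofNat]
    calc _ ≤ K * ‖W y‖ + 2 * K * ‖∂_{v} W y‖ + 2 * K * 1 * ‖∂_{e} W y‖ + K * M * ‖∂_{e} W y‖ := by
          gcongr
          · exact hα1.trans hη
          · exact hK0 x
      _ ≤ _ := by
          have a0 := mul_nonneg hK (norm_nonneg (W y))
          have a1 := mul_nonneg hK (norm_nonneg (∂_{v} W y))
          have a2 := mul_nonneg hK (norm_nonneg (∂_{e} W y))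
          have b0 := mul_nonneg hM a0
          have b1 := mul_nonneg hM a1
          nlinarith

end CutoffComposition

/-! ### Real valued `L²` norms -/

section L2Norm

variable {α : Type*} [MeasurableSpace α] {μ : Measure α}
variable {E : Type*} [NormedAddCommGroup E]

/-- The `L²` norm, as a real number. -/
noncomputable def l2norm (μ : Measure α) (f : α → E) : ℝ := (eLpNorm f 2 μ).toReal

theorem l2norm_nonneg (f : α → E) : 0 ≤ l2norm μ f := ENNReal.toReal_nonneg

theorem l2norm_norm (f : α → E) : l2norm μ (fun x => ‖f x‖) = l2norm μ f := by
  rw [l2norm, eLpNorm_norm, l2norm]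

theorem l2norm_add_le {f g : α → E} (hf : MemLp f 2 μ) (hg : MemLp g 2 μ) :
    l2norm μ (fun x => f x + g x) ≤ l2norm μ f + l2norm μ g := by
  rw [l2norm, l2norm, l2norm, ← ENNReal.toReal_add hf.2.ne hg.2.ne]
  exact ENNReal.toReal_mono (ENNReal.add_ne_top.2 ⟨hf.2.ne, hg.2.ne⟩)
    (eLpNorm_add_le hf.1 hg.1 (by norm_num))

theorem l2norm_sum_le {ι : Type*} (s : Finset ι) {f : ι → α → E} (hf : ∀ i ∈ s, MemLp (f i) 2 μ) :
    l2norm μ (fun x => ∑ i ∈ s, f i x) ≤ ∑ i ∈ s, l2norm μ (f i) := by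
  have e : (fun x => ∑ i ∈ s, f i x) = ∑ i ∈ s, f i := by ext; simp
  simp only [l2norm]
  rw [e, ← ENNReal.toReal_sum fun i hi => (hf i hi).2.ne]
  exact ENNReal.toReal_mono (ENNReal.sum_ne_top.2 fun i hi => (hf i hi).2.ne)
    (eLpNorm_sum_le (fun i hi => (hf i hi).1) (by norm_num))

theorem norm_integral_mul_le_l2norm {𝕜 : Type*} [RCLike 𝕜] {f g : α → 𝕜} (hf : MemLp f 2 μ)
    (hg : MemLp g 2 μ) : ‖∫ x, f x * g x ∂μ‖ ≤ l2norm μ f * l2norm μ g := by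
  have h1 : ‖∫ x, f x * g x ∂μ‖ₑ ≤ eLpNorm f 2 μ * eLpNorm g 2 μ := by
    refine (enorm_integral_le_lintegral_enorm _).trans ?_
    rw [← eLpNorm_one_eq_lintegral_enorm]
    have h0 : eLpNorm (f • g) 1 μ ≤ eLpNorm f 2 μ * eLpNorm g 2 μ :=
      eLpNorm_smul_le_mul_eLpNorm hg.1 hf.1
    exact h0
  rw [l2norm, l2norm, ← ENNReal.toReal_mul, ← toReal_enorm]
  exact ENNReal.toReal_mono (ENNReal.mul_ne_top hf.2.ne hg.2.ne) h1

theorem l2norm_sq_eq {f : α → ℂ} (hf : MemLp f 2 μ) :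
    ((l2norm μ f ^ 2 : ℝ) : ℂ) = ∫ x, f x * starRingEnd ℂ (f x) ∂μ := by
  have h1 : l2norm μ f ^ 2 = ∫ x, ‖f x‖ ^ 2 ∂μ := by
    have := hf.eLpNorm_eq_integral_rpow_norm (by norm_num) (by norm_num)
    rw [l2norm, this, ENNReal.toReal_ofReal (by positivity)]
    simp only [ENNReal.toReal_ofNat, Real.rpow_ofNat]
    rw [← Real.rpow_natCast, ← Real.rpow_mul (integral_nonneg fun x => by positivity)]
    norm_num
  rw [h1, ← integral_complex_ofReal]
  refine integral_congr_ae (ae_of_all _ fun x => ?_)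
  simp only [Complex.mul_conj, Complex.normSq_eq_norm_sq]

theorem l2norm_mono_measure {ν : Measure α} {f : α → E} (h : ν ≤ μ) (hf : MemLp f 2 μ) :
    l2norm ν f ≤ l2norm μ f :=
  ENNReal.toReal_mono hf.2.ne (eLpNorm_mono_measure f h)

end L2Norm

/-! ### `L²` bounds for the derivatives of the odd solution -/

section LocalEstimate

open SchwartzMap LineDeriv
open scoped SchwartzMap

variable {ρ : Rn n → ℝ} {e p : Rn n} {r η M : ℝ}

theorem IsStraightening.memLp_comp {E : Type*} [NormedAddCommGroup E] [MeasurableSpace E]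
    [BorelSpace E] [SecondCountableTopology E]
    (h : IsStraightening ρ e p r η M) {s : Set (Rn n)} (hs : s ⊆ ball p r) (hm : MeasurableSet s)
    {F : Rn n → E} (hFm : Measurable F) (hF : MemLp F 2 volume) :
    MemLp (fun x => F (straighten ρ e x)) 2 (volume.restrict s) ∧
    l2norm (volume.restrict s) (fun x => F (straighten ρ e x)) ≤ 2 * l2norm volume F := by
  have hc : ContinuousOn (straighten ρ e) s := fun x hx =>
    (h.hasFDerivWithinAt hs x hx).continuousWithinAt
  have hle := h.eLpNorm_comp_le hs hm F
  have hfin : 2 * eLpNorm F 2 volume ≠ ⊤ := ENNReal.mul_ne_top (by norm_num) hF.2.ne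
  refine ⟨⟨(hFm.comp_aemeasurable (hc.aemeasurable hm)).aestronglyMeasurable,
    hle.trans_lt hfin.lt_top⟩, ?_⟩
  have := ENNReal.toReal_mono hfin hle
  rwa [ENNReal.toReal_mul, ENNReal.toReal_ofNat] at this

theorem l2norm_schwartz (f : 𝓢(Rn n, ℂ)) : l2norm volume f = ‖f.toLp 2‖ := (norm_toLp).symm

/-- In the application `B` is the norm of `G`: no power of `lam` is gained, so smallness must come
from the chart. -/
theorem secondOrderSum_estimate (he : ‖e‖ = 1) {W : 𝓢(Rn n, ℂ)} {B : ℝ}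
    (hW : ∀ u v : Rn n, ‖(∂_{u} (∂_{v} W)).toLp 2‖ ≤ 2 * (‖u‖ * ‖v‖ * B)) :
    Measurable (secondOrderSum e W) ∧ MemLp (secondOrderSum e W) 2 volume ∧
      l2norm volume (secondOrderSum e W) ≤ 4 * n * B := by
  have hm : ∀ F : 𝓢(Rn n, ℂ), MemLp (fun y => ‖F y‖) 2 volume := fun F => (F.memLp 2 volume).norm
  have hadd := fun i : Fin n => (hm (∂_{EuclideanSpace.basisFun (Fin n) ℝ i} (∂_{e} W))).add
    (hm (∂_{e} (∂_{e} W)))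
  refine ⟨?_, memLp_finsetSum _ fun i _ => hadd i, ?_⟩
  · refine Finset.measurable_sum _ fun i _ => ?_
    exact (SchwartzMap.continuous _).measurable.norm.add (SchwartzMap.continuous _).measurable.norm
  · refine (l2norm_sum_le _ fun i _ => hadd i).trans ?_
    calc _ ≤ ∑ _i : Fin n, 4 * B := by
          refine Finset.sum_le_sum fun i _ => (l2norm_add_le (hm _) (hm _)).trans ?_
          rw [l2norm_norm, l2norm_norm, l2norm_schwartz, l2norm_schwartz]
          have h1 := hW (EuclideanSpace.basisFun (Fin n) ℝ i) e
          have h2 := hW e e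
          rw [OrthonormalBasis.norm_eq_one, he] at h1
          rw [he] at h2
          linarith
      _ = _ := by simp; ring

/-- In the application `B` is `(√lam)⁻¹` times the norm of `G`, so that these terms are small for
large `lam` whatever the chart and the cutoff. -/
theorem firstOrderSum_estimate (he : ‖e‖ = 1) {W : 𝓢(Rn n, ℂ)} {B : ℝ}
    (hW1 : ∀ v : Rn n, ‖(∂_{v} W).toLp 2‖ ≤ 2 * (‖v‖ * B)) (hW0 : ‖W.toLp 2‖ ≤ 2 * B) :
    Measurable (firstOrderSum e W) ∧ MemLp (firstOrderSum e W) 2 volume ∧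
      l2norm volume (firstOrderSum e W) ≤ 6 * n * B := by
  have hm : ∀ F : 𝓢(Rn n, ℂ), MemLp (fun y => ‖F y‖) 2 volume := fun F => (F.memLp 2 volume).norm
  have hadd0 := fun i : Fin n => (hm W).add (hm (∂_{EuclideanSpace.basisFun (Fin n) ℝ i} W))
  have hadd := fun i : Fin n => (hadd0 i).add (hm (∂_{e} W))
  refine ⟨?_, memLp_finsetSum _ fun i _ => hadd i, ?_⟩
  · refine Finset.measurable_sum _ fun i _ => ?_
    exact ((SchwartzMap.continuous _).measurable.norm.add
      (SchwartzMap.continuous _).measurable.norm).add (SchwartzMap.continuous _).measurable.norm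
  · refine (l2norm_sum_le _ fun i _ => hadd i).trans ?_
    calc _ ≤ ∑ _i : Fin n, 6 * B := by
          refine Finset.sum_le_sum fun i _ => (l2norm_add_le (hadd0 i) (hm _)).trans ?_
          have h0 := l2norm_add_le (hm W) (hm (∂_{EuclideanSpace.basisFun (Fin n) ℝ i} W))
          rw [l2norm_norm, l2norm_norm, l2norm_schwartz, l2norm_schwartz] at h0
          rw [l2norm_norm, l2norm_schwartz]
          have h1 := hW1 (EuclideanSpace.basisFun (Fin n) ℝ i)
          have h2 := hW1 e
          rw [OrthonormalBasis.norm_eq_one] at h1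
          rw [he] at h2
          refine (add_le_add h0 le_rfl).trans ?_
          linarith
      _ = _ := by simp; ring

end LocalEstimate

/-! ### Local estimates for functions orthogonal to the range of `Δ - lam` -/

section LocalEstimate

open SchwartzMap LineDeriv
open scoped SchwartzMap

variable {ρ : Rn n → ℝ} {e p : Rn n} {r η M : ℝ}

/-- Orthogonality to the range of `Δ - lam`, on `C²` functions vanishing on the boundary. -/
def IsOrthogonalToRange (Ω : Set (Rn n)) (lam : ℝ) (z : Rn n → ℂ) : Prop :=
  ∀ w : Rn n → ℂ, ContDiff ℝ 2 w → (∀ x ∈ frontier Ω, w x = 0) →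
    ∫ x in Ω, z x * (Δ w x - lam * w x) = 0

theorem reflection_eq_of_inner_eq_zero {y : Rn n} (h : ⟪y, e⟫_ℝ = 0) :
    (ℝ ∙ e)ᗮ.reflection y = y :=
  Submodule.reflection_mem_subspace_eq_self
    (Submodule.mem_orthogonal_singleton_iff_inner_left.2 h)

theorem inner_reflection (y : Rn n) : ⟪(ℝ ∙ e)ᗮ.reflection y, e⟫_ℝ = -⟪y, e⟫_ℝ := by
  have h := (ℝ ∙ e)ᗮ.reflection.inner_map_map y e
  rw [Submodule.reflection_orthogonalComplement_singleton_eq_neg, inner_neg_right] at h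
  linarith

theorem laplacian_eq_zero_of_eventuallyEq {f : Rn n → ℂ} {x : Rn n}
    (h : f =ᶠ[𝓝 x] fun _ => 0) : Δ f x = 0 := by
  have h2 := (h.fderiv (𝕜 := ℝ)).fderiv (𝕜 := ℝ)
  rw [laplacian_apply, h2.eq_of_nhds]
  simp

theorem IsStraightening.memLp_comp_isometry (h : IsStraightening ρ e p r η M) {s : Set (Rn n)}
    (hs : s ⊆ ball p r) (hm : MeasurableSet s) (S : Rn n ≃ₗᵢ[ℝ] Rn n) {F : Rn n → ℂ}
    (hFm : Measurable F) (hF : MemLp F 2 volume) :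
    MemLp (fun x => F (S (straighten ρ e x))) 2 (volume.restrict s) ∧
    l2norm (volume.restrict s) (fun x => F (S (straighten ρ e x))) ≤ 2 * l2norm volume F := by
  have hS : MeasurePreserving S volume volume := S.measurePreserving
  have h1 := h.memLp_comp hs hm (hFm.comp hS.measurable) (hF.comp_measurePreserving hS)
  have h2 : l2norm volume (F ∘ S) = l2norm volume F :=
    congrArg ENNReal.toReal (eLpNorm_comp_measurePreserving hFm.aestronglyMeasurable hS)
  rw [h2] at h1
  exact h1

theorem memLp_schwartz_sub_reflection (h : IsStraightening ρ e p r η M) {s : Set (Rn n)}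
    (hs : s ⊆ ball p r) (hm : MeasurableSet s) (S : Rn n ≃ₗᵢ[ℝ] Rn n) (G : 𝓢(Rn n, ℂ)) :
    MemLp (fun x => G (straighten ρ e x) - G (S (straighten ρ e x))) 2 (volume.restrict s) :=
  (h.memLp_comp hs hm G.continuous.measurable (G.memLp 2 volume)).1.sub
    (h.memLp_comp hs hm (compIsometry S G).continuous.measurable
      ((compIsometry S G).memLp 2 volume)).1

/-- The function `w = χ · (W ∘ Φ)`, with `W` the odd solution for the datum `G`, is an admissible
test function, so `z` annihilates `Δw - lam w`. The integral to be estimated is therefore only the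
error made by the chart and the cutoff, which is bounded by Cauchy–Schwarz. -/
theorem IsStraightening.norm_integral_odd_le (h : IsStraightening ρ e p r η M) (he : ‖e‖ = 1)
    (hη : η ≤ 1) (hη0 : 0 ≤ η) (hM : 0 ≤ M) {Ω : Set (Rn n)} (hΩ : IsOpen Ω)
    (hfr : ∀ x ∈ ball p r, x ∈ frontier Ω → ρ x = 0)
    {χ : Rn n → ℂ} (hχ : ContDiff ℝ ∞ χ) (hs : tsupport χ ⊆ ball p r) {K : ℝ} (hK : 0 ≤ K)
    (hK0 : ∀ x, ‖χ x‖ ≤ K) (hK1 : ∀ x, ‖fderiv ℝ χ x‖ ≤ K)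
    (hK2 : ∀ x, ‖fderiv ℝ (fderiv ℝ χ) x‖ ≤ K)
    {lam : ℝ} (hl : 1 ≤ lam) {z : Rn n → ℂ} (hz : MemLp z 2 (volume.restrict Ω))
    (hzo : IsOrthogonalToRange Ω lam z) (G : 𝓢(Rn n, ℂ)) :
    ‖∫ x in Ω ∩ ball p r, (z x * χ x) *
        (G (straighten ρ e x) - G ((ℝ ∙ e)ᗮ.reflection (straighten ρ e x)))‖ ≤
      (16 * n * η * l2norm (volume.restrict (Ω ∩ ball p r)) (fun x => z x * χ x) +
        12 * n * K * (4 + M) * (√lam)⁻¹ * l2norm (volume.restrict Ω) z) * ‖G.toLp 2‖ := by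
  set S := (ℝ ∙ e)ᗮ.reflection with hS
  set U := Ω ∩ ball p r with hU
  have hUs : U ⊆ ball p r := Set.inter_subset_right
  have hUm : MeasurableSet U := (hΩ.inter isOpen_ball).measurableSet
  have hUle : volume.restrict U ≤ volume.restrict Ω :=
    Measure.restrict_mono Set.inter_subset_left le_rfl
  obtain ⟨W, hW0, hWodd, hW2, hW1, hW00⟩ := exists_odd_resolvent hl S G
  set w : Rn n → ℂ := fun x => χ x * W (straighten ρ e x) with hw
  have hwc : ContDiff ℝ 2 w := h.contDiff_mul_comp hχ hs W
  have hwz : ∀ x, x ∉ tsupport χ → w =ᶠ[𝓝 x] fun _ => 0 := fun x hx => by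
    filter_upwards [notMem_tsupport_iff_eventuallyEq.1 hx] with y hy
    simp only [hw]; rw [hy]; simp
  have hwfr : ∀ x ∈ frontier Ω, w x = 0 := by
    intro x hx
    by_cases hxb : x ∈ ball p r
    -- Boundary points are mapped into the hyperplane, which the reflection fixes pointwise and
    -- where the odd function `W` vanishes.
    · have : W (straighten ρ e x) = 0 := hWodd _ <| reflection_eq_of_inner_eq_zero <| by
        rw [inner_straighten ρ he, hfr x hxb hx]
      simp only [hw, this, mul_zero]
    · exact (hwz x fun hc => hxb (hs hc)).eq_of_nhds
  have hint := hzo w hwc hwfr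
  have hzU : MemLp z 2 (volume.restrict U) := hz.mono_measure hUle
  have hzχ : MemLp (fun x => z x * χ x) 2 (volume.restrict U) := by
    refine MemLp.of_le_mul (c := K) hzU (hzU.1.mul hχ.continuous.aestronglyMeasurable)
      (ae_of_all _ fun x => ?_)
    rw [norm_mul, mul_comm]
    gcongr
    exact hK0 x
  have hwsupp : HasCompactSupport w := by
    have hcs : HasCompactSupport χ := by
      refine (isCompact_closedBall p r).of_isClosed_subset (isClosed_tsupport χ)
        (hs.trans ball_subset_closedBall)
    exact hcs.mul_right
  have hLsupp : HasCompactSupport (fun x => Δ w x - lam * w x) := by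
    refine HasCompactSupport.of_support_subset_isCompact hwsupp.isCompact fun x hx => ?_
    by_contra hc
    have h0 := notMem_tsupport_iff_eventuallyEq.1 hc
    exact hx (by simp only [laplacian_eq_zero_of_eventuallyEq h0, h0.eq_of_nhds]; simp)
  have hLc : Continuous (fun x => Δ w x - lam * w x) :=
    (continuous_laplacian hwc).sub (continuous_const.mul hwc.continuous)
  have hLm : MemLp (fun x => Δ w x - lam * w x) 2 (volume.restrict U) :=
    (hLc.memLp_of_hasCompactSupport hLsupp).restrict U
  have hintU : ∫ x in U, z x * (Δ w x - lam * w x) = 0 := by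
    rw [← hint, hU]
    refine (setIntegral_eq_of_subset_of_forall_sdiff_eq_zero hΩ.measurableSet
      Set.inter_subset_left fun x hx => ?_).symm
    have h0 := hwz x fun hc => hx.2 ⟨hx.1, hs hc⟩
    rw [laplacian_eq_zero_of_eventuallyEq h0, h0.eq_of_nhds]
    simp
  have hGm := memLp_schwartz_sub_reflection h hUs hUm S G
  obtain ⟨P1, P2, P3⟩ := secondOrderSum_estimate he hW2
  have hW1' : ∀ v : Rn n, ‖(∂_{v} W).toLp 2‖ ≤ 2 * (‖v‖ * ((√lam)⁻¹ * ‖G.toLp 2‖)) := fun v =>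
    (hW1 v).trans_eq (by rw [mul_assoc ‖v‖])
  obtain ⟨Q1, Q2, Q3⟩ := firstOrderSum_estimate he hW1' hW00
  obtain ⟨P4, P5⟩ := h.memLp_comp hUs hUm P1 P2
  obtain ⟨Q4, Q5⟩ := h.memLp_comp hUs hUm Q1 Q2
  have i1 : Integrable (fun x => (z x * χ x) * (G (straighten ρ e x) - G (S (straighten ρ e x))))
      (volume.restrict U) := hzχ.integrable_mul hGm
  have i2 : Integrable (fun x => z x * (Δ w x - lam * w x)) (volume.restrict U) :=
    hzU.integrable_mul hLm
  have i3 : Integrable (fun x => ‖z x * χ x‖ * secondOrderSum e W (straighten ρ e x))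
      (volume.restrict U) := hzχ.norm.integrable_mul P4
  have i4 : Integrable (fun x => ‖z x‖ * firstOrderSum e W (straighten ρ e x))
      (volume.restrict U) := hzU.norm.integrable_mul Q4
  have hdiff : ∫ x in U, (z x * χ x) * (G (straighten ρ e x) - G (S (straighten ρ e x))) =
      ∫ x in U, ((z x * χ x) * (G (straighten ρ e x) - G (S (straighten ρ e x))) -
        z x * (Δ w x - lam * w x)) := by
    rw [integral_sub i1 i2, hintU, sub_zero]
  rw [hdiff]
  have hbound : ‖∫ x in U, ((z x * χ x) * (G (straighten ρ e x) - G (S (straighten ρ e x))) -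
        z x * (Δ w x - lam * w x))‖ ≤
      ∫ x in U, (2 * η * (‖z x * χ x‖ * secondOrderSum e W (straighten ρ e x)) +
        K * (4 + M) * (‖z x‖ * firstOrderSum e W (straighten ρ e x))) := by
    refine norm_integral_le_of_norm_le ((i3.const_mul _).add (i4.const_mul _)) ?_
    filter_upwards [ae_restrict_mem hUm] with x hx
    have h1 := h.norm_laplacian_sub_le hη hη0 hM hχ hs hK hK0 hK1 hK2 W (hUs hx)
    -- The terms with `lam` cancel exactly: the error involves only the difference of the two
    -- Laplacians, so no constant grows with `lam`.
    have e1 : (z x * χ x) * (G (straighten ρ e x) - G (S (straighten ρ e x))) -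
        z x * (Δ w x - lam * w x) =
        -(z x * (Δ w x - χ x * Δ (W : Rn n → ℂ) (straighten ρ e x))) := by
      rw [← hW0]; simp only [hw]; ring
    rw [e1, norm_neg, norm_mul, norm_mul]
    refine (mul_le_mul_of_nonneg_left h1 (norm_nonneg _)).trans (le_of_eq ?_)
    ring
  refine hbound.trans ?_
  rw [integral_add (i3.const_mul _) (i4.const_mul _), integral_const_mul, integral_const_mul]
  have b1 := (le_abs_self _).trans (norm_integral_mul_le_l2norm hzχ.norm P4)
  have b2 := (le_abs_self _).trans (norm_integral_mul_le_l2norm hzU.norm Q4)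
  rw [l2norm_norm] at b1 b2
  have b3 := l2norm_mono_measure hUle hz
  have n1 := l2norm_nonneg (μ := volume.restrict U) (fun x => z x * χ x)
  have n2 := l2norm_nonneg (μ := volume.restrict U) z
  have n3 := l2norm_nonneg (μ := volume.restrict Ω) z
  calc _ ≤ 2 * η * (l2norm (volume.restrict U) (fun x => z x * χ x) *
        (2 * (4 * n * ‖G.toLp 2‖))) + K * (4 + M) * (l2norm (volume.restrict Ω) z *
        (2 * (6 * n * ((√lam)⁻¹ * ‖G.toLp 2‖)))) := by
        gcongr
        · exact b1.trans (mul_le_mul_of_nonneg_left (P5.trans (by linarith)) n1)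
        · exact b2.trans (mul_le_mul b3 (Q5.trans (by linarith)) (l2norm_nonneg _) n3)
    _ = _ := by ring

/-- As `ε → 0` one gets `A² ≤ 2aA² + 2bA`, and `2a ≤ 1/2` lets the quadratic term be absorbed on the
left. -/
theorem le_of_forall_eps_sq {A a b : ℝ} (ha : a ≤ 1 / 4) (hb : 0 ≤ b)
    (h : ∀ ε > 0, A ^ 2 ≤ (a * A + b) * (2 * A + ε) + 4 * ε * A) : A ≤ 4 * b := by
  have h1 : A ^ 2 ≤ (a * A + b) * (2 * A) := by
    have ht : Tendsto (fun ε : ℝ => (a * A + b) * (2 * A + ε) + 4 * ε * A) (𝓝[>] 0)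
        (𝓝 ((a * A + b) * (2 * A + 0) + 4 * 0 * A)) :=
      (Continuous.tendsto (by fun_prop) 0).mono_left nhdsWithin_le_nhds
    have := ge_of_tendsto ht (eventually_mem_nhdsWithin.mono fun ε hε => h ε hε)
    simpa using this
  by_contra! hc
  have hA' : 0 < A := by linarith
  nlinarith [mul_pos hA' hA', mul_le_mul_of_nonneg_right ha (sq_nonneg A)]

/-- Duality: testing `z χ` against its own conjugate gives the square of the norm `A`. The conjugate
is transported by the chart and approximated by a Schwartz function `G`, whose reflected part is
negligible on `Ω` since the transported function lives on the other side of the hyperplane. The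
preceding bound then has the norm `A` on both sides, with a small coefficient on the right. -/
theorem IsStraightening.l2norm_mul_le (h : IsStraightening ρ e p r η M) (he : ‖e‖ = 1)
    (hη : η ≤ 1) (hη0 : 0 ≤ η) (hηn : 64 * n * η ≤ 1) (hM : 0 ≤ M) {Ω : Set (Rn n)} (hΩ : IsOpen Ω)
    (hneg : ∀ x ∈ ball p r, x ∈ Ω → ρ x < 0)
    (hfr : ∀ x ∈ ball p r, x ∈ frontier Ω → ρ x = 0)
    {χ : Rn n → ℂ} (hχ : ContDiff ℝ ∞ χ) (hs : tsupport χ ⊆ ball p r) {K : ℝ} (hK : 0 ≤ K)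
    (hK0 : ∀ x, ‖χ x‖ ≤ K) (hK1 : ∀ x, ‖fderiv ℝ χ x‖ ≤ K)
    (hK2 : ∀ x, ‖fderiv ℝ (fderiv ℝ χ) x‖ ≤ K)
    {lam : ℝ} (hl : 1 ≤ lam) {z : Rn n → ℂ} (hzm : Measurable z)
    (hz : MemLp z 2 (volume.restrict Ω)) (hzo : IsOrthogonalToRange Ω lam z) :
    l2norm (volume.restrict (Ω ∩ ball p r)) (fun x => z x * χ x) ≤
      48 * n * K * (4 + M) * (√lam)⁻¹ * l2norm (volume.restrict Ω) z := by
  set S := (ℝ ∙ e)ᗮ.reflection with hS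
  set U := Ω ∩ ball p r with hU
  have hUs : U ⊆ ball p r := Set.inter_subset_right
  have hUm : MeasurableSet U := (hΩ.inter isOpen_ball).measurableSet
  have hUle : volume.restrict U ≤ volume.restrict Ω :=
    Measure.restrict_mono Set.inter_subset_left le_rfl
  have hzU : MemLp z 2 (volume.restrict U) := hz.mono_measure hUle
  have hzχ : MemLp (fun x => z x * χ x) 2 (volume.restrict U) := by
    refine MemLp.of_le_mul (c := K) hzU (hzU.1.mul hχ.continuous.aestronglyMeasurable)
      (ae_of_all _ fun x => ?_)
    rw [norm_mul, mul_comm]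
    gcongr
    exact hK0 x
  set A := l2norm (volume.restrict U) (fun x => z x * χ x) with hA
  have hA0 : 0 ≤ A := l2norm_nonneg _
  set f : Rn n → ℂ := fun x => starRingEnd ℂ (z x * χ x) with hf
  have hfm : Measurable f := Complex.continuous_conj.measurable.comp
    (hzm.mul hχ.continuous.measurable)
  obtain ⟨g, hgm, hgΦ, hg0, hgle⟩ := h.exists_pushforward hUs hUm hfm
  have hfe : eLpNorm f 2 (volume.restrict U) =
      eLpNorm (fun x => z x * χ x) 2 (volume.restrict U) :=
    eLpNorm_congr_norm_ae (ae_of_all _ fun x => RCLike.norm_conj _)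
  rw [hfe] at hgle
  have hfin : 2 * eLpNorm (fun x => z x * χ x) 2 (volume.restrict U) ≠ ⊤ :=
    ENNReal.mul_ne_top (by norm_num) hzχ.2.ne
  have hgL : MemLp g 2 volume := ⟨hgm.aestronglyMeasurable, hgle.trans_lt hfin.lt_top⟩
  have hgA : l2norm volume g ≤ 2 * A := by
    have := ENNReal.toReal_mono hfin hgle
    rwa [ENNReal.toReal_mul, ENNReal.toReal_ofNat] at this
  refine (le_of_forall_eps_sq (a := 16 * n * η)
    (b := 12 * n * K * (4 + M) * (√lam)⁻¹ * l2norm (volume.restrict Ω) z)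
    (by linarith) (by have := l2norm_nonneg (μ := volume.restrict Ω) z; positivity)
    fun ε hε => ?_).trans (le_of_eq (by ring))
  -- The pushforward `g` is merely in `L²`, whereas a `C²` solution requires a smooth datum; hence
  -- the approximation and the terms in `ε`.
  obtain ⟨G, hG⟩ : ∃ G : 𝓢(Rn n, ℂ), l2norm volume (fun y => G y - g y) ≤ ε := by
    obtain ⟨G, hG⟩ := (denseRange_toLpCLM (E := Rn n) (F := ℂ) (p := 2) (μ := volume)
      (by norm_num)).exists_dist_lt (hgL.toLp g) hε
    refine ⟨G, ?_⟩
    rw [dist_comm, dist_eq_norm, Lp.norm_def] at hG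
    refine le_of_eq_of_le ?_ hG.le
    refine congrArg ENNReal.toReal (eLpNorm_congr_ae ?_)
    filter_upwards [Lp.coeFn_sub (SchwartzMap.toLpCLM ℝ ℂ 2 volume G) (hgL.toLp g),
      hgL.coeFn_toLp, G.coeFn_toLp 2 volume] with x h1 h2 h3
    rw [h1, Pi.sub_apply, h2, toLpCLM_apply, h3]
  have hDm : Measurable fun y => G y - g y := G.continuous.measurable.sub hgm
  have hDL : MemLp (fun y => G y - g y) 2 volume := (G.memLp 2 volume).sub hgL
  obtain ⟨D1, D2⟩ := h.memLp_comp hUs hUm hDm hDL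
  obtain ⟨D3, D4⟩ := h.memLp_comp_isometry hUs hUm S hDm hDL
  have hGn : ‖G.toLp 2‖ ≤ 2 * A + ε := by
    rw [← l2norm_schwartz]
    have := l2norm_add_le hDL hgL
    simp only [sub_add_cancel] at this
    change l2norm volume G ≤ _ at this
    linarith
  have hmain := h.norm_integral_odd_le he hη hη0 hM hΩ hfr hχ hs hK hK0 hK1 hK2 hl hz hzo G
  have hGm := memLp_schwartz_sub_reflection h hUs hUm S G
  have hsq := l2norm_sq_eq hzχ
  have hsplit : ∫ x in U, (z x * χ x) * starRingEnd ℂ (z x * χ x) =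
      (∫ x in U, (z x * χ x) * (G (straighten ρ e x) - G (S (straighten ρ e x)))) -
      (∫ x in U, (z x * χ x) * (G (straighten ρ e x) - g (straighten ρ e x))) +
      ∫ x in U, (z x * χ x) * (G (S (straighten ρ e x)) - g (S (straighten ρ e x))) := by
    have i1 : Integrable (fun x => (z x * χ x) *
        (G (straighten ρ e x) - G (S (straighten ρ e x)))) (volume.restrict U) :=
      hzχ.integrable_mul hGm
    have i2 : Integrable (fun x => (z x * χ x) *
        (G (straighten ρ e x) - g (straighten ρ e x))) (volume.restrict U) :=
      hzχ.integrable_mul D1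
    have i3 : Integrable (fun x => (z x * χ x) *
        (G (S (straighten ρ e x)) - g (S (straighten ρ e x)))) (volume.restrict U) :=
      hzχ.integrable_mul D3
    rw [← integral_sub i1 i2]
    refine Eq.trans ?_ (integral_add (i1.sub i2) i3)
    refine setIntegral_congr_fun hUm fun x hx => ?_
    -- On the image of `Ω` the coordinate along `e` is `ρ < 0`, while at the reflected point it is
    -- positive; so that point is not in the image, and `g` vanishes there.
    have e1 : g (S (straighten ρ e x)) = 0 := by
      refine hg0 _ ?_
      rintro ⟨y, hy, hyx⟩
      have h1 := congrArg (fun v => ⟪v, e⟫_ℝ) hyx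
      simp only [hS, inner_reflection, inner_straighten ρ he] at h1
      linarith [hneg x (hUs hx) hx.1, hneg y (hUs hy) hy.1]
    have e2 := hgΦ x hx
    simp only [e1, e2, hf]
    ring
  have c1 := norm_integral_mul_le_l2norm hzχ D1
  have c2 := norm_integral_mul_le_l2norm hzχ D3
  have hA2 : ‖((A ^ 2 : ℝ) : ℂ)‖ = A ^ 2 := by
    rw [Complex.norm_real, Real.norm_of_nonneg (by positivity)]
  have hn : 0 ≤ l2norm (volume.restrict Ω) z := l2norm_nonneg _
  rw [← hA2, hsq, hsplit]
  refine (norm_add_le _ _).trans ((add_le_add (norm_sub_le _ _) le_rfl).trans ?_)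
  calc _ ≤ (16 * n * η * A + 12 * n * K * (4 + M) * (√lam)⁻¹ * l2norm (volume.restrict Ω) z) *
        (2 * A + ε) + A * (2 * ε) + A * (2 * ε) := by
        gcongr
        · exact hmain.trans (by gcongr)
        · exact c1.trans (by gcongr; linarith)
        · exact c2.trans (by gcongr; linarith)
    _ = _ := by ring

end LocalEstimate

/-! ### Density of the range of `Δ - lam` for large `lam` -/

section DenseRange

theorem exists_cutoff (p : Rn n) {r : ℝ} (hr : 0 < r) : ∃ (χ : Rn n → ℂ) (K : ℝ),
    ContDiff ℝ ∞ χ ∧ tsupport χ ⊆ ball p r ∧ 0 ≤ K ∧ (∀ x, ‖χ x‖ ≤ K) ∧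
    (∀ x, ‖fderiv ℝ χ x‖ ≤ K) ∧ (∀ x, ‖fderiv ℝ (fderiv ℝ χ) x‖ ≤ K) ∧
    ∀ x ∈ ball p (r / 4), χ x = 1 := by
  let b : ContDiffBump p := ⟨r / 4, r / 2, by linarith, by linarith⟩
  have hc : ContDiff ℝ ∞ (fun x => (b x : ℂ)) := Complex.ofRealCLM.contDiff.comp b.contDiff
  have ht : tsupport (fun x => (b x : ℂ)) ⊆ closedBall p (r / 2) := by
    refine (closure_mono fun z hz => ?_).trans (b.tsupport_eq).subset
    simpa using hz
  have hcs : HasCompactSupport (fun x => (b x : ℂ)) :=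
    (isCompact_closedBall p (r / 2)).of_isClosed_subset (isClosed_tsupport _) ht
  set χ : Rn n → ℂ := fun x => (b x : ℂ) with hχ
  have h2 : ContDiff ℝ 2 χ := hc.of_le (by norm_cast)
  have h1 : ContDiff ℝ 1 (fderiv ℝ χ) := h2.fderiv_right (by norm_num)
  obtain ⟨K0, hK0⟩ := hcs.exists_bound_of_continuous hc.continuous
  obtain ⟨K1, hK1⟩ := (hcs.fderiv ℝ).exists_bound_of_continuous h1.continuous
  have h3 : ∃ K2, ∀ x, ‖iteratedFDeriv ℝ 2 χ x‖ ≤ K2 :=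
    (hcs.iteratedFDeriv 2).exists_bound_of_continuous (h2.continuous_iteratedFDeriv le_rfl)
  obtain ⟨K2, hK2⟩ := h3
  have hK2' : ∀ x, ‖fderiv ℝ (fderiv ℝ χ) x‖ ≤ K2 := fun x => by
    have := hK2 x
    rwa [← norm_iteratedFDeriv_fderiv (n := 1), norm_iteratedFDeriv_one] at this
  have m0 : K0 ≤ max (max K0 K1) K2 := (le_max_left _ _).trans (le_max_left _ _)
  have m1 : K1 ≤ max (max K0 K1) K2 := (le_max_right _ _).trans (le_max_left _ _)
  have m2 : K2 ≤ max (max K0 K1) K2 := le_max_right _ _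
  refine ⟨χ, max (max K0 K1) K2, hc,
    ht.trans (closedBall_subset_ball (by linarith)),
    (norm_nonneg (χ p)).trans ((hK0 p).trans m0), fun x => (hK0 x).trans m0,
    fun x => (hK1 x).trans m1, fun x => (hK2' x).trans m2, fun x hx => ?_⟩
  have : b x = 1 := b.one_of_mem_closedBall (ball_subset_closedBall hx)
  simp [hχ, this]

/-- One defining function serves all nearby boundary points; in particular it vanishes at each of
them. -/
theorem IsDefiningFunctionAt.eventually {Ω : Set (Rn n)} {ρ : Rn n → ℝ} {p : Rn n}
    (h : IsDefiningFunctionAt Ω ρ p) : ∀ᶠ x in 𝓝 p, IsDefiningFunctionAt Ω ρ x := by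
  have hd : fderiv ℝ ρ p ≠ 0 := fun h0 => h.gradient_ne_zero (by simp [gradient, h0])
  have hc : ContinuousAt (fderiv ℝ ρ) p :=
    (h.contDiffAt.fderiv_right (m := 1) (by norm_num)).continuousAt
  filter_upwards [h.eventually_mem_iff.eventually_nhds, hc.eventually_ne hd,
    h.contDiffAt.eventually (by simp)] with x h1 h2 h3
  exact ⟨h3, fun h0 => h2 (by simpa [gradient] using h0), h1⟩

/-- Near any point of the closure of `Ω` there is a function which is negative in `Ω`, vanishes on
the boundary, and has a unit gradient at the given point. -/
theorem C2Domain.exists_normalized_definingFunction (hn : 0 < n) (Ω : C2Domain n) {p : Rn n}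
    (hp : p ∈ closure Ω.carrier) : ∃ (ρ : Rn n → ℝ) (e : Rn n), ‖e‖ = 1 ∧ ContDiffAt ℝ 2 ρ p ∧
      fderiv ℝ ρ p = innerSL ℝ e ∧
      ∀ᶠ x in 𝓝 p, (x ∈ Ω.carrier → ρ x < 0) ∧ (x ∈ frontier Ω.carrier → ρ x = 0) := by
  by_cases hpΩ : p ∈ Ω.carrier
  -- At an interior point an affine function with value `-1` at `p` is used; there are no boundary
  -- points nearby, so interior and boundary points are treated alike.
  · refine ⟨fun x => innerSL ℝ (EuclideanSpace.single ⟨0, hn⟩ 1) x -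
      (innerSL ℝ (EuclideanSpace.single ⟨0, hn⟩ 1) p + 1), EuclideanSpace.single ⟨0, hn⟩ 1,
      by simp, by fun_prop, by rw [fderiv_sub_const]; exact ContinuousLinearMap.fderiv _, ?_⟩
    have hc : ContinuousAt (fun x : Rn n => innerSL ℝ (EuclideanSpace.single ⟨0, hn⟩ 1) x -
      (innerSL ℝ (EuclideanSpace.single ⟨0, hn⟩ 1) p + 1)) p := by fun_prop
    filter_upwards [hc.eventually_lt_const (u := 0) (by simp), Ω.isOpen.mem_nhds hpΩ] with x h1 h2
    refine ⟨fun _ => h1, fun h3 => absurd h2 ?_⟩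
    have := h3.2
    rwa [Ω.isOpen.interior_eq] at this
  · have hpf : p ∈ frontier Ω.carrier := ⟨hp, by rwa [Ω.isOpen.interior_eq]⟩
    obtain ⟨ρ, hρ⟩ := Ω.exists_definingFunction p hpf
    have hg := norm_pos_iff.2 hρ.gradient_ne_zero
    refine ⟨fun x => ‖gradient ρ p‖⁻¹ * ρ x, ‖gradient ρ p‖⁻¹ • gradient ρ p, ?_,
      contDiffAt_const.mul hρ.contDiffAt, ?_, ?_⟩
    · rw [norm_smul, norm_inv, norm_norm, inv_mul_cancel₀ hg.ne']
    · rw [fderiv_const_mul (hρ.contDiffAt.differentiableAt (by norm_num)), map_smul]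
      congr 1
      ext v
      have : fderiv ℝ ρ p = InnerProductSpace.toDual ℝ (Rn n) (gradient ρ p) := by simp [gradient]
      rw [this]; rfl
    · filter_upwards [hρ.eventually_mem_iff, hρ.eventually] with x h1 h2
      refine ⟨fun hx => mul_neg_of_pos_of_neg (inv_pos.2 hg) (h1.1 hx), fun hx => ?_⟩
      rw [h2.eq_zero hx, mul_zero]

/-- The radius and the constant depend on the chart and the cutoff only, not on `lam` or `z`. This
uniformity is what allows `lam` to be chosen after the cover. -/
theorem C2Domain.exists_local_estimate (hn : 0 < n) (Ω : C2Domain n) {p : Rn n}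
    (hp : p ∈ closure Ω.carrier) : ∃ r > 0, ∃ C ≥ 0, ∀ lam : ℝ, 1 ≤ lam → ∀ z : Rn n → ℂ,
      Measurable z → MemLp z 2 Ω.measure → IsOrthogonalToRange Ω.carrier lam z →
      l2norm (volume.restrict (Ω.carrier ∩ ball p r)) z ≤ C * (√lam)⁻¹ * l2norm Ω.measure z := by
  obtain ⟨ρ, e, he, hρ, hg, hP⟩ := Ω.exists_normalized_definingFunction hn hp
  have hn' : (1 : ℝ) ≤ n := by exact_mod_cast hn
  -- With this `η` the coefficient `16 * n * η` of the term to be absorbed is exactly `1/4`.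
  obtain ⟨r, hr, M, hM, hPr⟩ := exists_isStraightening hρ hg (η := (64 * (n : ℝ))⁻¹)
    (by positivity) hP
  obtain ⟨χ, K, hχ, hχs, hK, hK0, hK1, hK2, hχ1⟩ := exists_cutoff p hr
  have hM0 : 0 ≤ M := by
    have h0 : 0 ≤ ‖fderiv ℝ (fderiv ℝ ρ) p‖ := norm_nonneg (fderiv ℝ (fderiv ℝ ρ) p)
    exact h0.trans (hM.fderiv_fderiv_le p (mem_ball_self hr))
  refine ⟨r / 4, by linarith, 48 * n * K * (4 + M), by positivity, fun lam hl z hzm hz hzo => ?_⟩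
  have key := hM.l2norm_mul_le he (inv_le_one_of_one_le₀ (by linarith)) (by positivity)
    (by rw [mul_inv_cancel₀ (by positivity)]) hM0 Ω.isOpen (fun x hx => (hPr x hx).1)
    (fun x hx => (hPr x hx).2) hχ hχs hK hK0 hK1 hK2 hl hzm hz hzo
  refine le_trans ?_ key
  have hsub : Ω.carrier ∩ ball p (r / 4) ⊆ Ω.carrier ∩ ball p r :=
    Set.inter_subset_inter_right _ (ball_subset_ball (by linarith))
  have hzχ : MemLp (fun x => z x * χ x) 2 (volume.restrict (Ω.carrier ∩ ball p r)) := by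
    have hzU := hz.mono_measure
      (Measure.restrict_mono (Set.inter_subset_left (t := ball p r)) le_rfl)
    refine MemLp.of_le_mul (c := K) hzU (hzU.1.mul hχ.continuous.aestronglyMeasurable)
      (ae_of_all _ fun x => ?_)
    rw [norm_mul, mul_comm]
    gcongr
    exact hK0 x
  refine le_trans (le_of_eq ?_) (l2norm_mono_measure (Measure.restrict_mono hsub le_rfl) hzχ)
  refine congrArg ENNReal.toReal (eLpNorm_congr_ae ?_)
  filter_upwards [ae_restrict_mem (Ω.isOpen.inter isOpen_ball).measurableSet] with x hx
  rw [hχ1 x hx.2, mul_one]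

/-- For large `lam`, the range of `Δ - lam` on the `C²` functions vanishing on the boundary is dense
in `L²(Ω)`. -/
theorem C2Domain.exists_lam_orthogonal_eq_zero (hn : 0 < n) (Ω : C2Domain n) :
    ∃ lam : ℝ, 1 ≤ lam ∧ ∀ z : Ω.L2, IsOrthogonalToRange Ω.carrier lam z → z = 0 := by
  choose! r hr C hC hest using fun p (hp : p ∈ closure Ω.carrier) =>
    Ω.exists_local_estimate hn hp
  obtain ⟨t, ht, hcov⟩ := Ω.isBounded.isCompact_closure.elim_nhds_subcover
    (fun p => ball p (r p)) (fun p hp => ball_mem_nhds p (hr p hp))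
  have hCs : 0 ≤ ∑ p ∈ t, C p := Finset.sum_nonneg fun p hp => hC p (ht p hp)
  -- This choice makes `√lam` exceed the sum of the local constants, so that summing the local
  -- estimates gives `‖z‖ ≤ θ ‖z‖` with `θ < 1`.
  refine ⟨(∑ p ∈ t, C p + 1) ^ 2, by nlinarith, fun z hz => ?_⟩
  set lam := (∑ p ∈ t, C p + 1) ^ 2 with hlam
  have hl : 1 ≤ lam := by nlinarith
  have hsq : √lam = ∑ p ∈ t, C p + 1 := Real.sqrt_sq (by linarith)
  have hzL : MemLp z 2 Ω.measure := Lp.memLp z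
  have hz0 := l2norm_nonneg (μ := Ω.measure) z
  have hle : l2norm Ω.measure z ≤ ∑ p ∈ t, l2norm (volume.restrict (Ω.carrier ∩ ball p (r p))) z := by
    have hAm : ∀ p, MeasurableSet (Ω.carrier ∩ ball p (r p)) := fun p =>
      (Ω.isOpen.inter isOpen_ball).measurableSet
    have hind : ∀ p, MemLp ((Ω.carrier ∩ ball p (r p)).indicator fun x => ‖z x‖) 2 Ω.measure :=
      fun p => hzL.norm.indicator (hAm p)
    have hl2 : ∀ p, l2norm Ω.measure ((Ω.carrier ∩ ball p (r p)).indicator fun x => ‖z x‖) =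
        l2norm (volume.restrict (Ω.carrier ∩ ball p (r p))) z := fun p => by
      rw [l2norm, eLpNorm_indicator_eq_eLpNorm_restrict (hAm p), Measure.restrict_restrict (hAm p),
        Set.inter_eq_left.2 Set.inter_subset_left, eLpNorm_norm, l2norm]
    simp only [← hl2]
    refine le_trans ?_ (l2norm_sum_le t fun p _ => hind p)
    refine ENNReal.toReal_mono (memLp_finsetSum t fun p _ => hind p).2.ne (eLpNorm_mono_ae ?_)
    filter_upwards [ae_restrict_mem Ω.isOpen.measurableSet] with x hx
    obtain ⟨p, hp, hxp⟩ := Set.mem_iUnion₂.1 (hcov (subset_closure hx))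
    rw [Real.norm_eq_abs]
    refine le_trans ?_ (le_abs_self _)
    have h1 : (Ω.carrier ∩ ball p (r p)).indicator (fun x => ‖z x‖) x = ‖z x‖ :=
      Set.indicator_of_mem (show x ∈ Ω.carrier ∩ ball p (r p) from ⟨hx, hxp⟩) _
    rw [← h1]
    exact Finset.single_le_sum
      (f := fun p => (Ω.carrier ∩ ball p (r p)).indicator (fun x => ‖z x‖) x)
      (fun q _ => Set.indicator_nonneg (fun y _ => norm_nonneg _) x) hp
  have hle2 : l2norm Ω.measure z ≤ (∑ p ∈ t, C p) * (√lam)⁻¹ * l2norm Ω.measure z := by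
    refine hle.trans ?_
    rw [Finset.sum_mul, Finset.sum_mul]
    exact Finset.sum_le_sum fun p hp => hest p (ht p hp) lam hl z (Lp.stronglyMeasurable z).measurable
      hzL hz
  have hz1 : l2norm Ω.measure z = 0 := by
    by_contra hne
    have hpos : 0 < l2norm Ω.measure z := lt_of_le_of_ne hz0 (Ne.symm hne)
    have : (∑ p ∈ t, C p) * (√lam)⁻¹ < 1 := by
      rw [hsq, mul_inv_lt_iff₀ (by linarith)]; linarith
    nlinarith
  rw [← norm_eq_zero, Lp.norm_def]
  exact hz1

end DenseRange

/-! ### Test functions, weak gradients and `H¹₀(Ω)` -/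

section TestFunctions

/-- The `i`-th standard basis vector. -/
noncomputable abbrev stdVec (i : Fin n) : Rn n := EuclideanSpace.basisFun (Fin n) ℝ i

namespace IsTestFunction

variable {Ω : Set (Rn n)} {φ ψ : Rn n → ℂ}

theorem zero : IsTestFunction Ω (0 : Rn n → ℂ) := by
  refine ⟨contDiff_const, HasCompactSupport.zero, ?_⟩
  have : tsupport (0 : Rn n → ℂ) = ∅ := tsupport_eq_empty_iff.2 rfl
  simp [this]

theorem add (hφ : IsTestFunction Ω φ) (hψ : IsTestFunction Ω ψ) : IsTestFunction Ω (φ + ψ) :=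
  ⟨hφ.smooth.add hψ.smooth, hφ.compact.add hψ.compact,
    (tsupport_add φ ψ).trans (Set.union_subset hφ.support_subset hψ.support_subset)⟩

theorem smul (c : ℂ) (hφ : IsTestFunction Ω φ) : IsTestFunction Ω (c • φ) := by
  have hs : tsupport (c • φ) ⊆ tsupport φ := closure_mono (Function.support_const_smul_subset c φ)
  exact ⟨hφ.smooth.const_smul c, hφ.compact.of_isClosed_subset (isClosed_tsupport _) hs,
    hs.trans hφ.support_subset⟩

theorem conj (hφ : IsTestFunction Ω φ) : IsTestFunction Ω (fun x => starRingEnd ℂ (φ x)) := by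
  have hs : tsupport (fun x => starRingEnd ℂ (φ x)) ⊆ tsupport φ :=
    closure_mono fun x hx => by simpa using hx
  exact ⟨Complex.conjCLE.contDiff.comp hφ.smooth,
    hφ.compact.of_isClosed_subset (isClosed_tsupport _) hs, hs.trans hφ.support_subset⟩

theorem partialDeriv (hφ : IsTestFunction Ω φ) (v : Rn n) :
    IsTestFunction Ω (fun x => fderiv ℝ φ x v) := by
  have hs : tsupport (fun x => fderiv ℝ φ x v) ⊆ tsupport φ := tsupport_fderiv_apply_subset ℝ v
  exact ⟨(hφ.smooth.fderiv_right (m := ∞) (by simp)).clm_apply contDiff_const,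
    hφ.compact.of_isClosed_subset (isClosed_tsupport _) hs, hs.trans hφ.support_subset⟩

theorem eq_zero (hφ : IsTestFunction Ω φ) {x : Rn n} (hx : x ∉ Ω) : φ x = 0 :=
  image_eq_zero_of_notMem_tsupport fun h => hx (hφ.support_subset h)

theorem differentiable (hφ : IsTestFunction Ω φ) : Differentiable ℝ φ :=
  hφ.contDiff_two.differentiable (by norm_num)

/-- Integration by parts against a test function. -/
theorem integral_fderiv_mul (hφ : IsTestFunction Ω φ) {a : Rn n → ℂ} (ha : ContDiff ℝ 1 a)
    (v : Rn n) : ∫ x in Ω, fderiv ℝ φ x v * a x = -∫ x in Ω, φ x * fderiv ℝ a x v := by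
  rw [setIntegral_eq_integral_of_forall_compl_eq_zero fun x hx => by
      rw [(hφ.partialDeriv v).eq_zero hx, zero_mul],
    setIntegral_eq_integral_of_forall_compl_eq_zero fun x hx => by
      rw [hφ.eq_zero hx, zero_mul]]
  have c1 : Continuous fun x => fderiv ℝ a x v :=
    (ha.continuous_fderiv (by norm_num)).clm_apply continuous_const
  have c2 := (hφ.partialDeriv v).smooth.continuous
  have := integral_mul_fderiv_eq_neg_fderiv_mul_of_integrable (𝕜 := ℂ) (μ := volume)
      (f := φ) (g := a) (v := v)
      (Continuous.integrable_of_hasCompactSupport (c2.mul ha.continuous)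
        (hφ.partialDeriv v).compact.mul_right)
      (Continuous.integrable_of_hasCompactSupport (hφ.smooth.continuous.mul c1)
        hφ.compact.mul_right)
      (Continuous.integrable_of_hasCompactSupport (hφ.smooth.continuous.mul ha.continuous)
        hφ.compact.mul_right)
      (fun x _ => hφ.differentiable x) (fun x _ => ha.differentiable (by norm_num) x)
  rw [this, neg_neg]

theorem memLp (hφ : IsTestFunction Ω φ) (s : Set (Rn n)) : MemLp φ 2 (volume.restrict s) :=
  (hφ.smooth.continuous.memLp_of_hasCompactSupport hφ.compact).restrict s

end IsTestFunction

namespace C2Domain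

variable (Ω : C2Domain n)

/-- The space of test functions. -/
def testSpace : Submodule ℂ (Rn n → ℂ) where
  carrier := {φ | IsTestFunction Ω.carrier φ}
  zero_mem' := IsTestFunction.zero
  add_mem' := fun ha hb => ha.add hb
  smul_mem' := fun c _ h => h.smul c

/-- A test function as an element of `L²(Ω)`. -/
noncomputable def testL2 : Ω.testSpace →ₗ[ℂ] Ω.L2 where
  toFun φ := MemLp.toLp (φ : Rn n → ℂ) (φ.2.memLp Ω.carrier)
  map_add' _ _ := rfl
  map_smul' _ _ := rfl

theorem coeFn_testL2 (φ : Ω.testSpace) : Ω.testL2 φ =ᵐ[Ω.measure] (φ : Rn n → ℂ) :=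
  MemLp.coeFn_toLp (φ.2.memLp Ω.carrier)

/-- The partial derivatives of a test function as test functions. -/
noncomputable def testPartial (i : Fin n) : Ω.testSpace →ₗ[ℂ] Ω.testSpace where
  toFun φ := ⟨fun x => fderiv ℝ (φ : Rn n → ℂ) x (stdVec i), φ.2.partialDeriv (stdVec i)⟩
  map_add' φ ψ := by
    ext x
    simp [fderiv_add (φ.2.differentiable x) (ψ.2.differentiable x)]
  map_smul' c φ := by
    ext x
    simp [fderiv_const_smul (φ.2.differentiable x) c]

theorem memLp_continuous {a : Rn n → ℂ} (ha : Continuous a) : MemLp a 2 Ω.measure := by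
  obtain ⟨R, hR⟩ := Ω.isBounded.subset_closedBall (0 : Rn n)
  obtain ⟨C, hC⟩ := (isCompact_closedBall (0 : Rn n) R).exists_bound_of_continuousOn
    ha.continuousOn
  exact MemLp.of_bound ha.aestronglyMeasurable C (by
    filter_upwards [ae_restrict_mem Ω.isOpen.measurableSet] with x hx using hC x (hR hx))

theorem l2norm_coe (u : Ω.L2) : l2norm Ω.measure u = ‖u‖ := (Lp.norm_def u).symm

/-- Integration against a continuous function, as a functional on `L²(Ω)`. -/
noncomputable def pairing (a : Rn n → ℂ) (ha : Continuous a) : Ω.L2 →L[ℂ] ℂ :=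
  LinearMap.mkContinuous
    { toFun := fun u => ∫ x in Ω.carrier, u x * a x
      map_add' := fun u v => by
        rw [← integral_add (Ω.integrable_mul u ha) (Ω.integrable_mul v ha)]
        refine integral_congr_ae ?_
        filter_upwards [Lp.coeFn_add u v] with x hx
        rw [hx, Pi.add_apply, add_mul]
      map_smul' := fun c u => by
        rw [RingHom.id_apply, smul_eq_mul, ← integral_const_mul]
        refine integral_congr_ae ?_
        filter_upwards [Lp.coeFn_smul c u] with x hx
        rw [hx, Pi.smul_apply, smul_eq_mul, mul_assoc] }
    (l2norm Ω.measure a) fun u => by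
      rw [mul_comm, ← Ω.l2norm_coe]
      exact norm_integral_mul_le_l2norm (Lp.memLp u) (Ω.memLp_continuous ha)

theorem pairing_apply {a : Rn n → ℂ} (ha : Continuous a) (u : Ω.L2) :
    Ω.pairing a ha u = ∫ x in Ω.carrier, u x * a x := rfl

theorem norm_pairing_le {a : Rn n → ℂ} (ha : Continuous a) (u : Ω.L2) :
    ‖Ω.pairing a ha u‖ ≤ l2norm Ω.measure a * ‖u‖ := by
  rw [mul_comm, ← Ω.l2norm_coe]
  exact norm_integral_mul_le_l2norm (Lp.memLp u) (Ω.memLp_continuous ha)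

theorem pairing_testL2 {a : Rn n → ℂ} (ha : Continuous a) (φ : Ω.testSpace) :
    Ω.pairing a ha (Ω.testL2 φ) = ∫ x in Ω.carrier, (φ : Rn n → ℂ) x * a x := by
  rw [pairing_apply]
  refine integral_congr_ae ?_
  filter_upwards [Ω.coeFn_testL2 φ] with x hx
  rw [hx]

/-- `v` is the limit in `H¹(Ω)` of test functions, and its partial derivatives are `G`. -/
def HasH10Gradient (v : Ω.L2) (G : Fin n → Ω.L2) : Prop :=
  ∃ φ : ℕ → Ω.testSpace, Tendsto (fun k => Ω.testL2 (φ k)) atTop (𝓝 v) ∧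
    ∀ i, Tendsto (fun k => Ω.testL2 (Ω.testPartial i (φ k))) atTop (𝓝 (G i))

variable {Ω}

theorem continuous_partial {w : Rn n → ℂ} (hw : ContDiff ℝ 2 w) (v : Rn n) :
    Continuous fun x => fderiv ℝ w x v :=
  (hw.continuous_fderiv (by norm_num)).clm_apply continuous_const

theorem sum_pairing_testPartial (φ : Ω.testSpace) {w : Rn n → ℂ} (hw : ContDiff ℝ 2 w) :
    ∑ i, Ω.pairing _ (continuous_partial hw (stdVec i)) (Ω.testL2 (Ω.testPartial i φ)) =
      -Ω.pairing _ (continuous_laplacian hw) (Ω.testL2 φ) := by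
  simp only [pairing_testL2]
  have h1 : ContDiff ℝ 1 (fderiv ℝ w) := hw.fderiv_right (by norm_num)
  have key : ∀ i : Fin n, ∀ x, fderiv ℝ (fun y => fderiv ℝ w y (stdVec i)) x (stdVec i) =
      fderiv ℝ (fderiv ℝ w) x (stdVec i) (stdVec i) := fun i x => by
    rw [(((h1.differentiable (by norm_num)) x).hasFDerivAt.clm_apply
      (hasFDerivAt_const (stdVec i) x)).fderiv]
    simp
  have e : ∀ i : Fin n, ∫ x in Ω.carrier, (Ω.testPartial i φ : Rn n → ℂ) x *
      fderiv ℝ w x (stdVec i) = -∫ x in Ω.carrier, (φ : Rn n → ℂ) x *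
        fderiv ℝ (fderiv ℝ w) x (stdVec i) (stdVec i) := fun i => by
    simp only [← key]
    exact φ.2.integral_fderiv_mul (h1.clm_apply contDiff_const) (stdVec i)
  rw [Finset.sum_congr rfl fun i _ => e i, Finset.sum_neg_distrib]
  congr 1
  simp only [laplacian_apply, Finset.mul_sum]
  rw [integral_finsetSum]
  intro i _
  have c2 : Continuous fun x => fderiv ℝ (fderiv ℝ w) x (stdVec i) (stdVec i) :=
    ((h1.continuous_fderiv (by norm_num)).clm_apply continuous_const).clm_apply continuous_const
  exact integrable_mul_continuous Ω.isOpen Ω.isBounded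
    ((φ.2.memLp Ω.carrier).integrable (by norm_num)) c2

/-- For test functions this is integration by parts, and both sides are continuous for `L²`
convergence of the function and of its partial derivatives. No boundary condition on `w` is needed.
-/
theorem HasH10Gradient.sum_pairing {v : Ω.L2} {G : Fin n → Ω.L2} (h : Ω.HasH10Gradient v G)
    {w : Rn n → ℂ} (hw : ContDiff ℝ 2 w) :
    ∑ i, Ω.pairing _ (continuous_partial hw (stdVec i)) (G i) =
      -Ω.pairing _ (continuous_laplacian hw) v := by
  obtain ⟨φ, h0, h1⟩ := h
  refine tendsto_nhds_unique
    (f := fun k => ∑ i, Ω.pairing _ (continuous_partial hw (stdVec i))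
      (Ω.testL2 (Ω.testPartial i (φ k))))
    (tendsto_finsetSum _ fun i _ => ((ContinuousLinearMap.continuous _).tendsto _).comp (h1 i)) ?_
  exact ((((Ω.pairing _ (continuous_laplacian hw)).continuous.tendsto v).comp h0).neg).congr
    fun k => (sum_pairing_testPartial (φ k) hw).symm

/-- The real linear map with prescribed partial derivatives. -/
noncomputable def ofPartials (c : Fin n → ℂ) : Rn n →L[ℝ] ℂ :=
  ∑ i, (EuclideanSpace.proj i : Rn n →L[ℝ] ℝ).smulRight (c i)

theorem ofPartials_apply_stdVec (A : Rn n →L[ℝ] ℂ) :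
    ofPartials (fun i => A (stdVec i)) = A := by
  refine ContinuousLinearMap.ext fun y => ?_
  conv_rhs => rw [← (EuclideanSpace.basisFun (Fin n) ℝ).sum_repr y]
  simp [stdVec, ofPartials]

theorem ofPartials_sub (c d : Fin n → ℂ) :
    ofPartials c - ofPartials d = ofPartials fun i => c i - d i := by
  refine ContinuousLinearMap.ext fun y => ?_
  simp [ofPartials, mul_sub]

theorem norm_ofPartials_le (c : Fin n → ℂ) : ‖ofPartials c‖ ≤ ∑ i, ‖c i‖ := by
  refine ContinuousLinearMap.opNorm_le_bound _ (Finset.sum_nonneg fun i _ => norm_nonneg _)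
    fun y => ?_
  rw [Finset.sum_mul]
  have : ofPartials c y = ∑ i, y i • c i := by simp [ofPartials]
  rw [this]
  refine (norm_sum_le _ _).trans (Finset.sum_le_sum fun i _ => ?_)
  rw [norm_smul, mul_comm]
  gcongr
  exact PiLp.norm_apply_le y i

theorem continuous_ofPartials : Continuous (ofPartials : (Fin n → ℂ) → (Rn n →L[ℝ] ℂ)) := by
  have : ∀ i : Fin n, Continuous fun c : Fin n → ℂ =>
      (EuclideanSpace.proj i : Rn n →L[ℝ] ℝ).smulRight (c i) := fun i =>
    (ContinuousLinearMap.smulRightL ℝ (Rn n) ℂ (EuclideanSpace.proj i)).continuous.comp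
      (continuous_apply i)
  exact continuous_finsetSum _ fun i _ => this i

theorem memLp_ofPartials {μ : Measure (Rn n)} {g : Fin n → Rn n → ℂ}
    (hg : ∀ i, MemLp (g i) 2 μ) : MemLp (fun x => ofPartials fun i => g i x) 2 μ := by
  have hm : AEStronglyMeasurable (fun x => ofPartials fun i => g i x) μ :=
    continuous_ofPartials.comp_aestronglyMeasurable
      (aemeasurable_pi_lambda _ fun i => (hg i).1.aemeasurable).aestronglyMeasurable
  have hs : MemLp (fun x => ∑ i, ‖g i x‖) 2 μ :=
    memLp_finsetSum Finset.univ fun i _ => (hg i).norm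
  refine hs.mono hm (ae_of_all _ fun x => (norm_ofPartials_le _).trans ?_)
  exact le_abs_self _

theorem eLpNorm_ofPartials_le {μ : Measure (Rn n)} {g : Fin n → Rn n → ℂ}
    (hg : ∀ i, AEStronglyMeasurable (g i) μ) :
    eLpNorm (fun x => ofPartials fun i => g i x) 2 μ ≤ ∑ i, eLpNorm (g i) 2 μ := by
  have h1 : eLpNorm (fun x => ofPartials fun i => g i x) 2 μ ≤
      eLpNorm (∑ i, fun x => ‖g i x‖) 2 μ := by
    refine eLpNorm_mono_real fun x => ?_
    rw [Finset.sum_apply]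
    exact norm_ofPartials_le _
  refine h1.trans ((eLpNorm_sum_le (fun i _ => (hg i).norm) (by norm_num)).trans_eq ?_)
  exact Finset.sum_congr rfl fun i _ => eLpNorm_norm _

theorem tendsto_eLpNorm_sub {u : ℕ → Ω.L2} {v : Ω.L2} (h : Tendsto u atTop (𝓝 v)) :
    Tendsto (fun k => eLpNorm (fun x => u k x - v x) 2 Ω.measure) atTop (𝓝 0) :=
  (Lp.tendsto_Lp_iff_tendsto_eLpNorm' u v).1 h

/-- The two descriptions of `H¹₀(Ω)` are compared through `ofPartials`: the norm of a linear map is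
at most the sum of the absolute values of its partial derivatives, so componentwise `L²` convergence
suffices. -/
theorem HasH10Gradient.memH10 {v : Ω.L2} {G : Fin n → Ω.L2} (h : Ω.HasH10Gradient v G) :
    Ω.MemH10 v := by
  obtain ⟨φ, h0, h1⟩ := h
  refine ⟨fun k => φ k, fun x => ofPartials fun i => G i x,
    memLp_ofPartials fun i => Lp.memLp (G i), fun k => (φ k).2, ?_, ?_⟩
  · refine (tendsto_eLpNorm_sub h0).congr fun k => eLpNorm_congr_ae ?_
    filter_upwards [Ω.coeFn_testL2 (φ k)] with x hx
    rw [hx]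
  · have hsum : Tendsto (fun k => ∑ i, eLpNorm (fun x => Ω.testL2 (Ω.testPartial i (φ k)) x - G i x)
        2 Ω.measure) atTop (𝓝 (∑ _i : Fin n, 0)) :=
      tendsto_finsetSum Finset.univ fun i _ => tendsto_eLpNorm_sub (h1 i)
    rw [Finset.sum_const_zero] at hsum
    refine tendsto_of_tendsto_of_tendsto_of_le_of_le tendsto_const_nhds hsum
      (fun k => zero_le) fun k => ?_
    refine le_trans (eLpNorm_congr_ae ?_).le (eLpNorm_ofPartials_le fun i =>
      (Lp.aestronglyMeasurable _).sub (Lp.aestronglyMeasurable _))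
    filter_upwards [ae_all_iff.2 fun i => Ω.coeFn_testL2 (Ω.testPartial i (φ k))] with x hx
    conv_lhs => rw [← ofPartials_apply_stdVec (fderiv ℝ (φ k : Rn n → ℂ) x), ofPartials_sub]
    refine congrArg ofPartials (funext fun i => ?_)
    have e : Ω.testL2 (Ω.testPartial i (φ k)) x =
      fderiv ℝ (φ k : Rn n → ℂ) x (stdVec i) := hx i
    rw [← e]

end C2Domain

end TestFunctions

/-! ### Functions of `H¹₀(Ω) ∩ H_Δ(Ω)` have trace zero -/

section TraceZero

/-- A smooth map of the complex plane which vanishes near `0` and is the identity near `∞`. -/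
theorem exists_truncation : ∃ (Θ : ℂ → ℂ) (K : ℝ), 0 ≤ K ∧ ContDiff ℝ ∞ Θ ∧
    (∀ z, ‖z‖ ≤ 1 → Θ z = 0) ∧ (∀ z, 2 ≤ ‖z‖ → Θ z = z) ∧ (∀ z, ‖Θ z‖ ≤ ‖z‖) ∧
    ∀ z, ‖fderiv ℝ Θ z‖ ≤ K := by
  let b : ContDiffBump (0 : ℂ) := ⟨1, 2, by norm_num, by norm_num⟩
  have hb : ContDiff ℝ ∞ (fun z : ℂ => b z • z) := b.contDiff.smul contDiff_id
  have hc : HasCompactSupport (fun z : ℂ => b z • z) := b.hasCompactSupport.smul_right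
  obtain ⟨C, hC⟩ := (hb.continuous_fderiv (by simp)).bounded_above_of_compact_support
    (hc.fderiv ℝ)
  refine ⟨fun z => z - b z • z, 1 + C, ?_, contDiff_id.sub hb, fun z hz => ?_, fun z hz => ?_,
    fun z => ?_, fun z => ?_⟩
  · linarith [(norm_nonneg _).trans (hC 0)]
  · beta_reduce
    rw [b.one_of_mem_closedBall (by simpa [b] using hz), one_smul, sub_self]
  · beta_reduce
    rw [b.zero_of_le_dist (by simpa [b] using hz), zero_smul, sub_zero]
  · have : z - b z • z = (1 - b z) • z := by rw [sub_smul, one_smul]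
    beta_reduce
    rw [this, norm_smul, Real.norm_eq_abs, abs_of_nonneg (by linarith [b.le_one (x := z)])]
    exact mul_le_of_le_one_left (norm_nonneg _) (by linarith [b.nonneg (x := z)])
  · have hz : HasFDerivAt (fun z : ℂ => z - b z • z) _ z := (hasFDerivAt_id z).sub
      ((hb.differentiable (by simp)) z).hasFDerivAt
    rw [hz.fderiv]
    refine (norm_sub_le _ _).trans (add_le_add ContinuousLinearMap.norm_id_le (hC z))

/-- A `C²` function vanishing on a set is the limit of `C²` functions vanishing near that set, with
gradients bounded by a multiple of the gradient. -/
theorem exists_truncation_seq {w : Rn n → ℂ} (hw : ContDiff ℝ 2 w) :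
    ∃ (wk : ℕ → Rn n → ℂ) (K : ℝ), 0 ≤ K ∧ (∀ k, ContDiff ℝ 2 (wk k)) ∧
      (∀ k x, w x = 0 → wk k =ᶠ[𝓝 x] 0) ∧ (∀ k x, ‖wk k x‖ ≤ ‖w x‖) ∧
      (∀ x, Tendsto (fun k => wk k x) atTop (𝓝 (w x))) ∧
      ∀ k x v, ‖fderiv ℝ (wk k) x v‖ ≤ K * ‖fderiv ℝ w x v‖ := by
  obtain ⟨Θ, K, hK, hΘ, h0, h1, hle, hd⟩ := exists_truncation
  have hk : ∀ k : ℕ, (0 : ℝ) < k + 1 := fun k => by positivity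
  -- The scaling inside cancels the one outside in the chain rule: the gradient is `DΘ` applied to
  -- the gradient of `w`, bounded independently of `k`, while the region where `w` is cut to zero
  -- shrinks to its zero set.
  refine ⟨fun k x => ((k : ℝ) + 1)⁻¹ • Θ (((k : ℝ) + 1) • w x), K, hK, fun k => ?_,
    fun k x hx => ?_, fun k x => ?_, fun x => ?_, fun k x v => ?_⟩
  · exact ((hΘ.of_le (by norm_cast)).comp (hw.const_smul _)).const_smul _
  · have hc : Continuous fun y => ‖((k : ℝ) + 1) • w y‖ := (hw.continuous.const_smul ((k : ℝ) + 1)).norm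
    have : ∀ᶠ y in 𝓝 x, ‖((k : ℝ) + 1) • w y‖ < 1 :=
      hc.continuousAt.eventually_lt continuousAt_const (by simp [hx])
    filter_upwards [this] with y hy
    rw [h0 _ hy.le, smul_zero, Pi.zero_apply]
  · rw [norm_smul, norm_inv, Real.norm_of_nonneg (hk k).le, inv_mul_le_iff₀ (hk k)]
    refine (hle _).trans_eq ?_
    rw [norm_smul, Real.norm_of_nonneg (hk k).le]
  · by_cases hx : w x = 0
    · simp [hx, h0]
    · refine tendsto_const_nhds.congr' ?_
      have hpos : 0 < ‖w x‖ := norm_pos_iff.2 hx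
      obtain ⟨N, hN⟩ := exists_nat_ge (2 / ‖w x‖)
      filter_upwards [eventually_ge_atTop N] with k hkN
      have h2 : 2 ≤ ‖((k : ℝ) + 1) • w x‖ := by
        rw [norm_smul, Real.norm_of_nonneg (hk k).le]
        have : 2 / ‖w x‖ ≤ (k : ℝ) + 1 := by
          have : (N : ℝ) ≤ k := by exact_mod_cast hkN
          linarith
        rwa [div_le_iff₀ hpos] at this
      rw [h1 _ h2, smul_smul, inv_mul_cancel₀ (hk k).ne', one_smul]
  · have hwx := (hw.differentiable (by norm_num) x).hasFDerivAt
    have hΘx := ((hΘ.differentiable (by simp)) (((k : ℝ) + 1) • w x)).hasFDerivAt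
    have hx : HasFDerivAt (fun x => ((k : ℝ) + 1)⁻¹ • Θ (((k : ℝ) + 1) • w x)) _ x :=
      (hΘx.comp x (hwx.const_smul ((k : ℝ) + 1))).const_smul ((k : ℝ) + 1)⁻¹
    rw [hx.fderiv]
    have e : (((k : ℝ) + 1)⁻¹ • (fderiv ℝ Θ (((k : ℝ) + 1) • w x)).comp
        (((k : ℝ) + 1) • fderiv ℝ w x)) v = fderiv ℝ Θ (((k : ℝ) + 1) • w x) (fderiv ℝ w x v) := by
      simp [smul_smul, (hk k).ne']
    rw [e]
    exact (ContinuousLinearMap.le_opNorm _ _).trans (by gcongr; exact hd _)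

theorem l2norm_le_mul {α E : Type*} [NormedAddCommGroup E] {m : MeasurableSpace α} {μ : Measure α}
    {f g : α → E} {K : ℝ} (hK : 0 ≤ K) (h : ∀ x, ‖f x‖ ≤ K * ‖g x‖) (hg : MemLp g 2 μ) :
    l2norm μ f ≤ K * l2norm μ g := by
  have := eLpNorm_le_mul_eLpNorm_of_ae_le_mul (ae_of_all μ h) 2
  have h2 := ENNReal.toReal_mono (ENNReal.mul_ne_top ENNReal.ofReal_ne_top hg.2.ne) this
  rwa [ENNReal.toReal_mul, ENNReal.toReal_ofReal hK] at h2

namespace C2Domain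

variable {Ω : C2Domain n}

/-- Uniformly bounded functionals which converge along a sequence of points also converge at the limit
of the sequence. -/
theorem tendsto_apply_of_bounded {X : Type*} [NormedAddCommGroup X] [NormedSpace ℂ X]
    {F : ℕ → X →L[ℂ] ℂ} {F0 : X →L[ℂ] ℂ} {C : ℝ} (hC : ∀ k, ‖F k‖ ≤ C) {u : ℕ → X} {v : X}
    (hu : Tendsto u atTop (𝓝 v)) (h : ∀ j, Tendsto (fun k => F k (u j)) atTop (𝓝 (F0 (u j)))) :
    Tendsto (fun k => F k v) atTop (𝓝 (F0 v)) := by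
  have hC0 : 0 ≤ C := (norm_nonneg _).trans (hC 0)
  rw [Metric.tendsto_atTop]
  intro ε hε
  have hM : 0 < C + ‖F0‖ + 1 := by positivity
  obtain ⟨j, hj⟩ := (Metric.tendsto_atTop.1 hu (ε / 2 / (C + ‖F0‖ + 1)) (by positivity))
  obtain ⟨N, hN⟩ := Metric.tendsto_atTop.1 (h j) (ε / 2) (by positivity)
  refine ⟨N, fun k hk => ?_⟩
  have h1 := hN k hk
  have h2 := hj j le_rfl
  rw [dist_eq_norm] at h1 h2 ⊢
  rw [lt_div_iff₀ hM] at h2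
  have e : F k v - F0 v = (F k (u j) - F0 (u j)) - (F k (u j - v) - F0 (u j - v)) := by
    simp only [map_sub]; ring
  have h3 : ‖F k (u j - v)‖ ≤ C * ‖u j - v‖ :=
    ((F k).le_opNorm _).trans (by gcongr; exact hC k)
  have h4 : ‖F0 (u j - v)‖ ≤ ‖F0‖ * ‖u j - v‖ := F0.le_opNorm _
  rw [e]
  have h5 := norm_sub_le (F k (u j) - F0 (u j)) (F k (u j - v) - F0 (u j - v))
  have h6 := norm_sub_le (F k (u j - v)) (F0 (u j - v))
  have h7 := norm_nonneg (u j - v)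
  nlinarith

theorem tendsto_pairing {a : ℕ → Rn n → ℂ} {a0 : Rn n → ℂ} (ha : ∀ k, Continuous (a k))
    (ha0 : Continuous a0) (hle : ∀ k x, ‖a k x‖ ≤ ‖a0 x‖)
    (hlim : ∀ x, Tendsto (fun k => a k x) atTop (𝓝 (a0 x))) (u : Ω.L2) :
    Tendsto (fun k => Ω.pairing (a k) (ha k) u) atTop (𝓝 (Ω.pairing a0 ha0 u)) := by
  simp only [pairing_apply]
  refine tendsto_integral_of_dominated_convergence (fun x => ‖u x * a0 x‖)
    (fun k => (Ω.integrable_mul u (ha k)).aestronglyMeasurable)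
    (Ω.integrable_mul u ha0).norm (fun k => ae_of_all _ fun x => ?_)
    (ae_of_all _ fun x => (hlim x).const_mul _)
  rw [norm_mul, norm_mul]
  gcongr
  exact hle k x

/-- The Dirichlet form against a `C²` function, on vector fields. -/
noncomputable def gradPairing (Ω : C2Domain n) {w : Rn n → ℂ} (hw : ContDiff ℝ 2 w) :
    (Fin n → Ω.L2) →L[ℂ] ℂ :=
  ∑ i, (Ω.pairing _ (continuous_partial hw (stdVec i))).comp (ContinuousLinearMap.proj i)

theorem gradPairing_apply {w : Rn n → ℂ} (hw : ContDiff ℝ 2 w) (G : Fin n → Ω.L2) :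
    Ω.gradPairing hw G = ∑ i, Ω.pairing _ (continuous_partial hw (stdVec i)) (G i) := by
  simp [gradPairing]

/-- A further integration by parts puts all derivatives on the test function. The right side needs
only the values of `w`, so it passes to the limit along the truncations although nothing is known
about convergence of their gradients. -/
theorem gradPairing_test {w : Rn n → ℂ} (hw : ContDiff ℝ 2 w) (φ : Ω.testSpace) :
    Ω.gradPairing hw (fun i => Ω.testL2 (Ω.testPartial i φ)) =
      -∑ i, Ω.pairing w hw.continuous (Ω.testL2 (Ω.testPartial i (Ω.testPartial i φ))) := by
  rw [gradPairing_apply, ← Finset.sum_neg_distrib]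
  refine Finset.sum_congr rfl fun i _ => ?_
  rw [pairing_testL2, pairing_testL2]
  have := (Ω.testPartial i φ).2.integral_fderiv_mul (hw.of_le (by norm_num)) (stdVec i)
  exact neg_eq_iff_eq_neg.1 this.symm

theorem norm_gradPairing_le {w : Rn n → ℂ} (hw : ContDiff ℝ 2 w) :
    ‖Ω.gradPairing hw‖ ≤ ∑ i, l2norm Ω.measure fun x => fderiv ℝ w x (stdVec i) := by
  refine ContinuousLinearMap.opNorm_le_bound _
    (Finset.sum_nonneg fun i _ => l2norm_nonneg _) fun G => ?_
  rw [gradPairing_apply, Finset.sum_mul]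
  refine (norm_sum_le _ _).trans (Finset.sum_le_sum fun i _ => ?_)
  refine (Ω.norm_pairing_le _ _).trans ?_
  gcongr
  · exact l2norm_nonneg _
  · exact norm_le_pi_norm G i

/-- Functions of `H¹₀(Ω) ∩ H_Δ(Ω)` have vanishing trace. -/
theorem HasH10Gradient.pairing_laplacian {v : Ω.L2} {G : Fin n → Ω.L2}
    (h : Ω.HasH10Gradient v G) {f : Ω.L2} (hf : HasDistribLaplacian Ω.carrier v f)
    {w : Rn n → ℂ} (hw : ContDiff ℝ 2 w) (hw0 : ∀ x ∈ frontier Ω.carrier, w x = 0) :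
    Ω.pairing _ (continuous_laplacian hw) v = Ω.pairing w hw.continuous f := by
  obtain ⟨wk, K, hK, hwk, hz, hle, hlim, hgrad⟩ := exists_truncation_seq hw
  -- The truncations vanish near every boundary point, hence together with their gradients, and
  -- `green_of_cauchy_zero` applies to them.
  have e1 : ∀ k, Ω.gradPairing (hwk k) G = -Ω.pairing (wk k) (hwk k).continuous f := fun k => by
    rw [gradPairing_apply, h.sum_pairing (hwk k), pairing_apply, pairing_apply]
    congr 1
    exact green_of_cauchy_zero Ω.isOpen Ω.isBounded (Ω.integrable_L2 _) (Ω.integrable_L2 _) hf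
      (hwk k) (fun x hx => (hz k x (hw0 x hx)).self_of_nhds)
      (fun x hx => by rw [(hz k x (hw0 x hx)).fderiv_eq]; simp)
  have e2 : Ω.gradPairing hw G = -Ω.pairing _ (continuous_laplacian hw) v := by
    rw [gradPairing_apply, h.sum_pairing hw]
  have l1 : Tendsto (fun k => Ω.gradPairing (hwk k) G) atTop
      (𝓝 (-Ω.pairing w hw.continuous f)) :=
    (tendsto_pairing (fun k => (hwk k).continuous) hw.continuous hle hlim f).neg.congr
      fun k => (e1 k).symm
  -- Weak convergence of the gradients: they are bounded in `L²`, and they converge against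
  -- gradients of test functions, which approximate `G`.
  have l2 : Tendsto (fun k => Ω.gradPairing (hwk k) G) atTop (𝓝 (Ω.gradPairing hw G)) := by
    obtain ⟨φ, -, hφ⟩ := h
    refine tendsto_apply_of_bounded
      (C := ∑ i, K * l2norm Ω.measure fun x => fderiv ℝ w x (stdVec i)) (fun k => ?_)
      (tendsto_pi_nhds.2 hφ) fun j => ?_
    · refine (norm_gradPairing_le (hwk k)).trans (Finset.sum_le_sum fun i _ => ?_)
      exact l2norm_le_mul hK (fun x => hgrad k x _) (Ω.memLp_continuous (continuous_partial hw _))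
    · simp only [gradPairing_test]
      exact (tendsto_finsetSum _ fun i _ =>
        tendsto_pairing (fun k => (hwk k).continuous) hw.continuous hle hlim _).neg
  have := tendsto_nhds_unique l1 l2
  rw [e2] at this
  exact (neg_injective this).symm

end C2Domain

end TraceZero

/-! ### The Dirichlet resolvent and its compactness -/

section Resolvent

/-- A sufficient condition for compactness, in the form of Ehrling's inequality. -/
theorem isCompactOperator_of_le {X Y : Type} [NormedAddCommGroup X] [NormedSpace ℂ X]
    [NormedAddCommGroup Y] [NormedSpace ℂ Y] [CompleteSpace Y] (T : X →L[ℂ] Y)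
    (h : ∀ ε : ℝ, 0 < ε → ∃ (m : ℕ) (P : Y →L[ℂ] (Fin m → ℂ)),
      ∀ x, ‖T x‖ ≤ ε * ‖x‖ + ‖P (T x)‖) : IsCompactOperator T := by
  refine (isCompactOperator_iff_isCompact_closure_image_closedBall (T : X →ₗ[ℂ] Y)
    one_pos).2 ?_
  refine TotallyBounded.isCompact_of_isClosed (TotallyBounded.closure ?_) isClosed_closure
  refine Metric.totallyBounded_of_finite_discretization fun ε hε => ?_
  -- Points of the unit ball differ by at most 2, and two points assigned to the same centre have
  -- images under `P ∘ T` at distance less than `2 · ε/6`. Altogether the images under `T` are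
  -- closer than `2ε/3`.
  obtain ⟨m, P, hP⟩ := h (ε / 6) (by positivity)
  have hb : TotallyBounded (closedBall (0 : Fin m → ℂ) ‖P.comp T‖) :=
    (isCompact_closedBall _ _).totallyBounded
  obtain ⟨t, -, htf, ht⟩ := Metric.finite_approx_of_totallyBounded hb (ε / 6) (by positivity)
  have hmem : ∀ x : X, x ∈ closedBall (0 : X) 1 → ∃ c : t, dist (P (T x)) c < ε / 6 := by
    intro x hx
    have : P (T x) ∈ closedBall (0 : Fin m → ℂ) ‖P.comp T‖ := by
      rw [mem_closedBall_zero_iff] at hx ⊢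
      exact ((P.comp T).le_opNorm x).trans (mul_le_of_le_one_right (norm_nonneg _) hx)
    obtain ⟨c, hc, hd⟩ := Set.mem_iUnion₂.1 (ht this)
    exact ⟨⟨c, hc⟩, hd⟩
  have hpre : ∀ y : (T : X →ₗ[ℂ] Y) '' closedBall (0 : X) 1, ∃ x ∈ closedBall (0 : X) 1, T x = y :=
    fun y => y.2
  choose g hg hgy using hpre
  choose F hF using fun y => hmem _ (hg y)
  refine ⟨t, htf.fintype, F, fun y z hyz => ?_⟩
  have h1 := hF y
  have h2 := hF z
  have h3 := hP (g y - g z)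
  rw [hyz] at h1
  have h4 := dist_triangle_right (P (T (g y))) (P (T (g z))) (F z)
  rw [map_sub, map_sub, hgy, hgy, ← dist_eq_norm, ← dist_eq_norm (P y)] at h3
  rw [hgy, hgy] at h4
  rw [hgy] at h1 h2
  have h5 : ‖g y - g z‖ ≤ 2 := by
    have := mem_closedBall_zero_iff.1 (hg y)
    have := mem_closedBall_zero_iff.1 (hg z)
    linarith [norm_sub_le (g y) (g z)]
  nlinarith

namespace C2Domain

variable (Ω : C2Domain n)

/-- The ambient Hilbert space of functions and gradients. -/
abbrev GradSpace : Type := PiLp 2 fun _ : Option (Fin n) => Ω.L2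

/-- A test function together with its gradient. -/
noncomputable def testGrad (s : ℝ) : Ω.testSpace →ₗ[ℂ] Ω.GradSpace :=
  (WithLp.linearEquiv 2 ℂ (Option (Fin n) → Ω.L2)).symm.toLinearMap ∘ₗ
    LinearMap.pi fun o => o.elim ((s : ℂ) • Ω.testL2) fun i => Ω.testL2 ∘ₗ Ω.testPartial i

theorem testGrad_none (s : ℝ) (φ : Ω.testSpace) : Ω.testGrad s φ none = (s : ℂ) • Ω.testL2 φ := rfl

theorem testGrad_some (s : ℝ) (φ : Ω.testSpace) (i : Fin n) :
    Ω.testGrad s φ (some i) = Ω.testL2 (Ω.testPartial i φ) := rfl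

/-- The space `H¹₀(Ω)`, embedded by `v ↦ (s v, ∇v)`. -/
noncomputable def H10Space (s : ℝ) : Submodule ℂ Ω.GradSpace :=
  (LinearMap.range (Ω.testGrad s)).topologicalClosure

instance (s : ℝ) : CompleteSpace (Ω.H10Space s) :=
  (Submodule.isClosed_topologicalClosure _).completeSpace_coe

/-- The embedding of `H¹₀(Ω)` in `L²(Ω)`. -/
noncomputable def embedL2 (s : ℝ) : Ω.H10Space s →L[ℂ] Ω.L2 :=
  ((s : ℂ)⁻¹ • (PiLp.proj 2 (fun _ : Option (Fin n) => Ω.L2) none : Ω.GradSpace →L[ℂ] Ω.L2)).comp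
    (Ω.H10Space s).subtypeL

variable {Ω}

theorem embedL2_apply {s : ℝ} (X : Ω.H10Space s) :
    Ω.embedL2 s X = (s : ℂ)⁻¹ • (X : Ω.GradSpace) none := rfl

theorem testGrad_mem (s : ℝ) (φ : Ω.testSpace) : Ω.testGrad s φ ∈ Ω.H10Space s :=
  Submodule.le_topologicalClosure _ ⟨φ, rfl⟩

theorem embedL2_testGrad {s : ℝ} (hs : s ≠ 0) (φ : Ω.testSpace) :
    Ω.embedL2 s ⟨Ω.testGrad s φ, testGrad_mem s φ⟩ = Ω.testL2 φ := by
  rw [embedL2_apply, testGrad_none, smul_smul, inv_mul_cancel₀ (by exact_mod_cast hs), one_smul]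

theorem exists_tendsto_testGrad {s : ℝ} (X : Ω.H10Space s) :
    ∃ φ : ℕ → Ω.testSpace, Tendsto (fun k => Ω.testGrad s (φ k)) atTop (𝓝 (X : Ω.GradSpace)) := by
  have hX : (X : Ω.GradSpace) ∈ closure (LinearMap.range (Ω.testGrad s) : Set Ω.GradSpace) := X.2
  obtain ⟨x, hx, hlim⟩ := mem_closure_iff_seq_limit.1 hX
  choose φ hφ using hx
  exact ⟨φ, by simpa only [hφ] using hlim⟩

theorem hasH10Gradient_embedL2 {s : ℝ} (hs : s ≠ 0) (X : Ω.H10Space s) :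
    Ω.HasH10Gradient (Ω.embedL2 s X) fun i => (X : Ω.GradSpace) (some i) := by
  obtain ⟨φ, hφ⟩ := exists_tendsto_testGrad X
  have hc : ∀ o : Option (Fin n), Tendsto (fun k => Ω.testGrad s (φ k) o) atTop
      (𝓝 ((X : Ω.GradSpace) o)) := fun o =>
    ((PiLp.proj 2 (fun _ : Option (Fin n) => Ω.L2) o :
      Ω.GradSpace →L[ℂ] Ω.L2).continuous.tendsto _).comp hφ
  refine ⟨φ, ?_, fun i => hc (some i)⟩
  refine ((hc none).const_smul (s : ℂ)⁻¹).congr fun k => ?_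
  rw [testGrad_none, smul_smul, inv_mul_cancel₀ (by exact_mod_cast hs), one_smul]

/-- The complex conjugate of a test function. -/
noncomputable def conjTest (φ : Ω.testSpace) : Ω.testSpace :=
  ⟨fun x => starRingEnd ℂ ((φ : Rn n → ℂ) x), φ.2.conj⟩

theorem testPartial_conjTest (φ : Ω.testSpace) (i : Fin n) :
    Ω.testPartial i (conjTest φ) = conjTest (Ω.testPartial i φ) := by
  ext x
  have h := Complex.conjCLE.hasFDerivAt.comp x (φ.2.differentiable x).hasFDerivAt
  exact DFunLike.congr_fun h.fderiv (stdVec i)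

/-- Distributional equations use the bilinear pairing and the Hilbert space argument the
sesquilinear one; conjugating the test function converts between them. -/
theorem inner_conjTest (φ : Ω.testSpace) (u : Ω.L2) :
    ⟪Ω.testL2 (conjTest φ), u⟫_ℂ = Ω.pairing φ φ.2.smooth.continuous u := by
  rw [L2.inner_def, pairing_apply]
  refine integral_congr_ae ?_
  filter_upwards [Ω.coeFn_testL2 (conjTest φ)] with x hx
  rw [hx]
  simp [conjTest]

variable (Ω) in
/-- The Dirichlet resolvent of the Laplacian. -/
noncomputable def resolvent (lam : ℝ) : Ω.L2 →L[ℂ] Ω.L2 :=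
  (Ω.embedL2 (√lam)).comp (ContinuousLinearMap.adjoint (Ω.embedL2 (√lam)))

/-- With `s = √lam` the norm induced on `H10Space` is that of `lam ‖v‖² + ‖∇v‖²`. If `E` is the
embedding in `L²(Ω)`, then `X = E* g` is the Riesz representative of the functional given by `g`:
for test functions `φ`, `lam ∫ φ v + ∫ ∇φ · ∇v = ∫ φ g` with `v = E X`. This is the weak form of `Δv
= lam v - g`, and it explains the definition of the resolvent as `E E*`. -/
theorem resolvent_spec {lam : ℝ} (hlam : 0 < lam) (g : Ω.L2) :
    ∃ G, Ω.HasH10Gradient (Ω.resolvent lam g) G ∧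
      HasDistribLaplacian Ω.carrier (Ω.resolvent lam g)
        ((lam : ℂ) • Ω.resolvent lam g - g : Ω.L2) := by
  have hs : √lam ≠ 0 := (Real.sqrt_pos.2 hlam).ne'
  set X := ContinuousLinearMap.adjoint (Ω.embedL2 (√lam)) g with hX
  have hR : Ω.resolvent lam g = Ω.embedL2 (√lam) X := rfl
  rw [hR]
  have hG := hasH10Gradient_embedL2 hs X
  refine ⟨_, hG, fun φ hφ => ?_⟩
  set v := Ω.embedL2 (√lam) X with hv
  let Φ : Ω.testSpace := ⟨φ, hφ⟩
  have hnone : (X : Ω.GradSpace) none = ((√lam : ℝ) : ℂ) • v := by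
    rw [hv, embedL2_apply, smul_smul, mul_inv_cancel₀ (by exact_mod_cast hs), one_smul]
  have h1 : ⟪Ω.testGrad (√lam) (conjTest Φ), (X : Ω.GradSpace)⟫_ℂ =
      Ω.pairing φ hφ.smooth.continuous g := by
    rw [← inner_conjTest Φ, ← embedL2_testGrad hs, ← ContinuousLinearMap.adjoint_inner_right]
    rfl
  have hsum := hG.sum_pairing hφ.contDiff_two
  rw [PiLp.inner_apply, Fintype.sum_option, hnone, testGrad_none, inner_smul_left,
    inner_smul_right, inner_conjTest, Complex.conj_ofReal, ← mul_assoc, ← Complex.ofReal_mul,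
    Real.mul_self_sqrt hlam.le] at h1
  have h2 : ∀ i, ⟪Ω.testGrad (√lam) (conjTest Φ) (some i), (X : Ω.GradSpace) (some i)⟫_ℂ =
      Ω.pairing _ (continuous_partial hφ.contDiff_two (stdVec i)) ((X : Ω.GradSpace) (some i)) := by
    intro i
    rw [testGrad_some, testPartial_conjTest, inner_conjTest]
    rfl
  rw [Finset.sum_congr rfl fun i _ => h2 i, hsum] at h1
  change Ω.pairing _ (continuous_laplacian hφ.contDiff_two) v =
    Ω.pairing φ hφ.smooth.continuous ((lam : ℂ) • v - g)
  rw [map_sub, map_smul, smul_eq_mul, ← h1]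
  ring

/-- It is enough that the embedding be compact. The inequality assumed for test functions extends by
density to all of `H10Space`. -/
theorem isCompactOperator_resolvent {lam : ℝ} (hlam : 0 < lam)
    (h : ∀ ε : ℝ, 0 < ε → ∃ (m : ℕ) (P : Ω.L2 →L[ℂ] (Fin m → ℂ)), ∀ φ : Ω.testSpace,
      ‖Ω.testL2 φ‖ ≤ ε * (‖Ω.testL2 φ‖ + ∑ i, ‖Ω.testL2 (Ω.testPartial i φ)‖) + ‖P (Ω.testL2 φ)‖) :
    IsCompactOperator (Ω.resolvent lam) := by
  have hs : 0 < √lam := Real.sqrt_pos.2 hlam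
  refine IsCompactOperator.comp_clm (isCompactOperator_of_le (Ω.embedL2 (√lam)) fun ε hε => ?_) _
  -- This constant compares `‖φ‖ + ∑ ‖∂ᵢ φ‖` with the norm of `H10Space`, where the function itself
  -- carries the weight `√lam`.
  have hM : 0 < (√lam)⁻¹ + n := by positivity
  obtain ⟨m, P, hP⟩ := h (ε / ((√lam)⁻¹ + n)) (by positivity)
  refine ⟨m, P, fun X => ?_⟩
  obtain ⟨φ, hφ⟩ := exists_tendsto_testGrad X
  have hX : Tendsto (fun k => (⟨Ω.testGrad (√lam) (φ k), testGrad_mem _ _⟩ : Ω.H10Space (√lam)))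
      atTop (𝓝 X) := tendsto_subtype_rng.2 hφ
  have hc : Continuous fun X : Ω.H10Space (√lam) => ‖Ω.embedL2 (√lam) X‖ :=
    (Ω.embedL2 (√lam)).continuous.norm
  have hc' : Continuous fun X : Ω.H10Space (√lam) => ε * ‖X‖ + ‖P (Ω.embedL2 (√lam) X)‖ :=
    (continuous_const.mul continuous_norm).add
      (P.continuous.comp (Ω.embedL2 (√lam)).continuous).norm
  refine le_of_tendsto_of_tendsto' ((hc.tendsto X).comp hX) ((hc'.tendsto X).comp hX) fun k => ?_
  simp only [Function.comp_apply, embedL2_testGrad hs.ne']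
  refine (hP (φ k)).trans (add_le_add ?_ le_rfl)
  set N : ℝ := ‖(⟨Ω.testGrad (√lam) (φ k), testGrad_mem _ _⟩ : Ω.H10Space (√lam))‖ with hN
  have hle : ∀ o, ‖Ω.testGrad (√lam) (φ k) o‖ ≤ N := fun o => PiLp.norm_apply_le _ o
  have h0 : ‖Ω.testL2 (φ k)‖ ≤ (√lam)⁻¹ * N := by
    have := hle none
    rw [testGrad_none, norm_smul, Complex.norm_real, Real.norm_of_nonneg hs.le] at this
    rwa [← div_eq_inv_mul, le_div_iff₀' hs]
  have h1 : ∑ i, ‖Ω.testL2 (Ω.testPartial i (φ k))‖ ≤ n * N := by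
    refine (Finset.sum_le_sum fun i _ => hle (some i)).trans_eq ?_
    simp
  rw [div_mul_eq_mul_div, div_le_iff₀ hM]
  have := add_le_add h0 h1
  calc _ ≤ ε * ((√lam)⁻¹ * N + n * N) := by gcongr
    _ = _ := by ring

end C2Domain

end Resolvent

/-! ### Rellich's theorem by sampling the Fourier transform -/

section Rellich

open SchwartzMap LineDeriv FourierTransform

theorem sum_norm_sq_fourier_lineDeriv (f : 𝓢(Rn n, ℂ)) (ξ : Rn n) :
    ∑ i : Fin n, ‖(𝓕 (∂_{stdVec i} f : 𝓢(Rn n, ℂ)) : 𝓢(Rn n, ℂ)) ξ‖ ^ 2 =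
      (2 * Real.pi * ‖ξ‖) ^ 2 * ‖𝓕 f ξ‖ ^ 2 := by
  have hpart : ∀ i, ‖(𝓕 (∂_{stdVec i} f : 𝓢(Rn n, ℂ)) : 𝓢(Rn n, ℂ)) ξ‖ ^ 2 =
      ξ i ^ 2 * ((2 * Real.pi) ^ 2 * ‖𝓕 f ξ‖ ^ 2) := by
    intro i
    rw [fourier_lineDerivOp_eq, smul_apply, smulLeftCLM_apply_apply (by fun_prop), norm_smul,
      norm_smul]
    have : ⟪ξ, stdVec i⟫_ℝ = ξ i := by
      simp [stdVec, EuclideanSpace.inner_single_right]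
    rw [this]
    simp only [norm_mul, Complex.norm_ofNat, Complex.norm_real, Complex.norm_I, mul_one,
      Real.norm_eq_abs, mul_pow, sq_abs]
    ring
  rw [Finset.sum_congr rfl fun i _ => hpart i, ← Finset.sum_mul, ← EuclideanSpace.real_norm_sq_eq]
  ring

theorem integrable_norm_sq_schwartz (f : 𝓢(Rn n, ℂ)) : Integrable fun x => ‖f x‖ ^ 2 :=
  (f.memLp 2).integrable_norm_pow (by norm_num)

theorem sum_integral_norm_sq_lineDeriv (f : 𝓢(Rn n, ℂ)) :
    ∑ i : Fin n, ∫ x, ‖fderiv ℝ f x (stdVec i)‖ ^ 2 = ∫ ξ, (2 * Real.pi * ‖ξ‖) ^ 2 * ‖𝓕 f ξ‖ ^ 2 := by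
  have e : ∀ i, ∫ x, ‖fderiv ℝ f x (stdVec i)‖ ^ 2 =
      ∫ ξ, ‖(𝓕 (∂_{stdVec i} f : 𝓢(Rn n, ℂ)) : 𝓢(Rn n, ℂ)) ξ‖ ^ 2 :=
    fun i => (integral_norm_sq_fourier (∂_{stdVec i} f : 𝓢(Rn n, ℂ))).symm
  rw [Finset.sum_congr rfl fun i _ => e i,
    ← integral_finsetSum _ fun i _ =>
      integrable_norm_sq_schwartz (𝓕 (∂_{stdVec i} f : 𝓢(Rn n, ℂ)))]
  simp only [sum_norm_sq_fourier_lineDeriv]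

theorem integrable_norm_mul_sq_fourier (f : 𝓢(Rn n, ℂ)) :
    Integrable fun ξ => (2 * Real.pi * ‖ξ‖) ^ 2 * ‖𝓕 f ξ‖ ^ 2 := by
  have : Integrable fun ξ => ∑ i : Fin n, ‖(𝓕 (∂_{stdVec i} f : 𝓢(Rn n, ℂ)) : 𝓢(Rn n, ℂ)) ξ‖ ^ 2 :=
    integrable_finsetSum _ fun i _ =>
      integrable_norm_sq_schwartz (𝓕 (∂_{stdVec i} f : 𝓢(Rn n, ℂ)))
  simpa only [sum_norm_sq_fourier_lineDeriv] using this

/-- Off the ball `(2π‖x‖ / R)² ≥ 1`, so that the weighted integral controls the tail. -/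
theorem integral_norm_sq_le_add_of_integrable {g : Rn n → ℂ} {R : ℝ} (hR : 0 < R)
    (h1 : Integrable fun x => ‖g x‖ ^ 2)
    (h2 : Integrable fun x => (2 * Real.pi * ‖x‖) ^ 2 * ‖g x‖ ^ 2) :
    ∫ x, ‖g x‖ ^ 2 ≤ (∫ x in closedBall (0 : Rn n) R, ‖g x‖ ^ 2) +
      R⁻¹ ^ 2 * ∫ x, (2 * Real.pi * ‖x‖) ^ 2 * ‖g x‖ ^ 2 := by
  rw [← integral_add_compl (measurableSet_closedBall (x := (0 : Rn n)) (ε := R)) h1]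
  refine add_le_add le_rfl ?_
  rw [← integral_const_mul]
  refine le_trans ?_ (setIntegral_le_integral (h2.const_mul _)
    (ae_of_all _ fun ξ => by positivity) (s := (closedBall (0 : Rn n) R)ᶜ))
  refine setIntegral_mono_on h1.integrableOn (h2.const_mul _).integrableOn
    measurableSet_closedBall.compl fun ξ hξ => ?_
  have h1 : R ≤ ‖ξ‖ := (not_le.1 fun h => hξ (mem_closedBall_zero_iff.2 h)).le
  have h2 : 1 ≤ 2 * Real.pi := by linarith [Real.pi_gt_three]
  have h3 : R ≤ 2 * Real.pi * ‖ξ‖ := h1.trans (le_mul_of_one_le_left (norm_nonneg _) h2)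
  have h4 : 1 ≤ R⁻¹ ^ 2 * (2 * Real.pi * ‖ξ‖) ^ 2 := by
    rw [← mul_pow, ← div_eq_inv_mul]
    exact one_le_pow₀ ((one_le_div hR).2 h3)
  calc ‖g ξ‖ ^ 2 ≤ (R⁻¹ ^ 2 * (2 * Real.pi * ‖ξ‖) ^ 2) * ‖g ξ‖ ^ 2 :=
        le_mul_of_one_le_left (by positivity) h4
    _ = _ := by ring

/-- The low frequencies and the gradient control the `L²` norm. -/
theorem integral_norm_sq_le_of_fourier (f : 𝓢(Rn n, ℂ)) {R : ℝ} (hR : 0 < R) :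
    ∫ x, ‖f x‖ ^ 2 ≤ (∫ ξ in closedBall (0 : Rn n) R, ‖𝓕 f ξ‖ ^ 2) +
      R⁻¹ ^ 2 * ∑ i : Fin n, ∫ x, ‖fderiv ℝ f x (stdVec i)‖ ^ 2 := by
  rw [← integral_norm_sq_fourier f, sum_integral_norm_sq_lineDeriv]
  exact integral_norm_sq_le_add_of_integrable hR (integrable_norm_sq_schwartz (𝓕 f))
    (integrable_norm_mul_sq_fourier f)

/-- The exponentials `x ↦ exp (-2πi ξ·x)`. -/
noncomputable def waveChar (ξ x : Rn n) : ℂ := (Real.fourierChar (-⟪x, ξ⟫_ℝ) : ℂ)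

theorem continuous_waveChar (ξ : Rn n) : Continuous (waveChar ξ) := by
  unfold waveChar
  fun_prop

/-- Factoring out one exponential leaves `exp(ia) - 1` with `|a| ≤ 2π ‖x‖ ‖ξ - η‖`. Boundedness of
`Ω` turns this into a Lipschitz dependence on the frequency in `L²(Ω)`. -/
theorem norm_waveChar_sub_le (ξ η x : Rn n) :
    ‖waveChar ξ x - waveChar η x‖ ≤ 2 * Real.pi * ‖x‖ * ‖ξ - η‖ := by
  have e : waveChar ξ x - waveChar η x =
      waveChar η x * (Complex.exp (Complex.I * (2 * Real.pi * (-⟪x, ξ - η⟫_ℝ) : ℝ)) - 1) := by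
    rw [waveChar, waveChar, mul_sub, mul_one, Real.fourierChar_apply, Real.fourierChar_apply,
      ← Complex.exp_add, inner_sub_right]
    congr 2
    push_cast
    ring
  rw [e, norm_mul]
  have h1 : ‖waveChar η x‖ = 1 := Circle.norm_coe _
  rw [h1, one_mul]
  refine Real.norm_exp_I_mul_ofReal_sub_one_le.trans ?_
  have h2 : (0 : ℝ) ≤ 2 * Real.pi := by positivity
  rw [norm_mul, norm_neg, Real.norm_of_nonneg h2, mul_assoc (2 * Real.pi)]
  exact mul_le_mul_of_nonneg_left (norm_inner_le_norm (𝕜 := ℝ) x (ξ - η)) h2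

namespace C2Domain

variable (Ω : C2Domain n)

theorem exists_l2norm_waveChar_sub_le : ∃ D : ℝ, 0 ≤ D ∧ ∀ ξ η : Rn n,
    l2norm Ω.measure (fun x => waveChar ξ x - waveChar η x) ≤ D * ‖ξ - η‖ := by
  have hm : MemLp (fun x : Rn n => ((‖x‖ : ℝ) : ℂ)) 2 Ω.measure :=
    Ω.memLp_continuous (by fun_prop)
  refine ⟨2 * Real.pi * l2norm Ω.measure fun x : Rn n => ((‖x‖ : ℝ) : ℂ),
    mul_nonneg (by positivity) (l2norm_nonneg _), fun ξ η => ?_⟩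
  refine (l2norm_le_mul (K := 2 * Real.pi * ‖ξ - η‖) (by positivity) (fun x => ?_) hm).trans_eq
    (by ring)
  refine (norm_waveChar_sub_le ξ η x).trans_eq ?_
  rw [Complex.norm_real, norm_norm]
  ring

theorem norm_testL2_sq (φ : Ω.testSpace) :
    ‖Ω.testL2 φ‖ ^ 2 = ∫ x, ‖(φ : Rn n → ℂ) x‖ ^ 2 := by
  have h1 : ‖Ω.testL2 φ‖ ^ 2 = ∫ x in Ω.carrier, ‖(φ : Rn n → ℂ) x‖ ^ 2 := by
    rw [← Ω.l2norm_coe]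
    have h := l2norm_sq_eq (Lp.memLp (Ω.testL2 φ))
    have e : ∫ x in Ω.carrier, Ω.testL2 φ x * starRingEnd ℂ (Ω.testL2 φ x) =
        ((∫ x in Ω.carrier, ‖(φ : Rn n → ℂ) x‖ ^ 2 : ℝ) : ℂ) := by
      rw [← integral_complex_ofReal]
      refine integral_congr_ae ?_
      filter_upwards [Ω.coeFn_testL2 φ] with x hx
      rw [hx, Complex.mul_conj, Complex.normSq_eq_norm_sq]
    exact_mod_cast h.trans e
  rw [h1]
  refine setIntegral_eq_integral_of_forall_compl_eq_zero fun x hx => ?_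
  rw [φ.2.eq_zero hx]
  simp

/-- Sampling of the Fourier transform. -/
noncomputable def sampling {m : ℕ} (p : Fin m → Rn n) : Ω.L2 →L[ℂ] (Fin m → ℂ) :=
  ContinuousLinearMap.pi fun j => Ω.pairing _ (continuous_waveChar (p j))

theorem fourier_test_eq (φ : Ω.testSpace) (ξ : Rn n) :
    𝓕 (φ : Rn n → ℂ) ξ = Ω.pairing _ (continuous_waveChar ξ) (Ω.testL2 φ) := by
  rw [pairing_testL2, Real.fourier_eq, setIntegral_eq_integral_of_forall_compl_eq_zero]
  · refine integral_congr_ae (ae_of_all _ fun x => ?_)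
    simp only [Circle.smul_def, smul_eq_mul, waveChar]
    ring
  · intro x hx
    rw [φ.2.eq_zero hx, zero_mul]

/-- Ehrling's inequality: the embedding of `H¹₀(Ω)` in `L²(Ω)` is compact. -/
theorem exists_sampling_le {ε : ℝ} (hε : 0 < ε) : ∃ (m : ℕ) (P : Ω.L2 →L[ℂ] (Fin m → ℂ)),
    ∀ φ : Ω.testSpace, ‖Ω.testL2 φ‖ ≤
      ε * (‖Ω.testL2 φ‖ + ∑ i, ‖Ω.testL2 (Ω.testPartial i φ)‖) + ‖P (Ω.testL2 φ)‖ := by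
  obtain ⟨D, hD, hDle⟩ := Ω.exists_l2norm_waveChar_sub_le
  -- With this cutoff the high frequencies contribute at most `ε` times the gradient.
  set R : ℝ := ε⁻¹ with hR
  have hR0 : 0 < R := inv_pos.2 hε
  set B : ℝ := volume.real (closedBall (0 : Rn n) R) with hB
  have hB0 : 0 ≤ B := measureReal_nonneg
  -- The mesh is fine enough that replacing a low frequency by a nearby sample costs at most `ε ‖u‖`
  -- after integration over the ball of volume `B`; the `+ 1` avoids division by zero.
  set δ : ℝ := ε / (√B * D + 1) with hδ
  have hδ0 : 0 < δ := by positivity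
  obtain ⟨t, -, htf, ht⟩ := Metric.finite_approx_of_totallyBounded
    (isCompact_closedBall (0 : Rn n) R).totallyBounded δ hδ0
  obtain ⟨m, p, -, rfl⟩ := htf.fin_param
  -- The factor `√B` comes from bounding the `L²` norm over the ball by the supremum.
  refine ⟨m, ((√B : ℝ) : ℂ) • Ω.sampling p, fun φ => ?_⟩
  set u := Ω.testL2 φ with hu
  let f : 𝓢(Rn n, ℂ) := φ.2.compact.toSchwartzMap φ.2.smooth
  have hf : (f : Rn n → ℂ) = φ := rfl
  have hlow : ∀ ξ ∈ closedBall (0 : Rn n) R, ‖𝓕 f ξ‖ ≤ ‖Ω.sampling p u‖ + D * δ * ‖u‖ := by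
    intro ξ hξ
    obtain ⟨_, ⟨j, rfl⟩, hj⟩ := Set.mem_iUnion₂.1 (ht hξ)
    have e : 𝓕 f ξ = Ω.pairing _ (continuous_waveChar ξ) u := by
      rw [fourier_coe, hf, fourier_test_eq]
    have e2 : Ω.pairing _ (continuous_waveChar ξ) u = Ω.sampling p u j +
        Ω.pairing (fun x => waveChar ξ x - waveChar (p j) x)
          ((continuous_waveChar ξ).sub (continuous_waveChar (p j))) u := by
      change Ω.pairing _ (continuous_waveChar ξ) u = Ω.pairing _ (continuous_waveChar (p j)) u + _
      simp only [pairing_apply]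
      have i1 := Ω.integrable_mul u (continuous_waveChar (p j))
      have i2 : Integrable (fun x => u x * (waveChar ξ x - waveChar (p j) x)) Ω.measure :=
        Ω.integrable_mul u ((continuous_waveChar ξ).sub (continuous_waveChar (p j)))
      rw [← integral_add i1 i2]
      refine integral_congr_ae (ae_of_all _ fun x => ?_)
      ring
    rw [e, e2]
    refine (norm_add_le _ _).trans (add_le_add (norm_le_pi_norm _ j) ?_)
    refine (Ω.norm_pairing_le _ u).trans ?_
    gcongr
    refine (hDle ξ (p j)).trans ?_
    gcongr
    rw [← dist_eq_norm]
    exact (mem_ball.1 hj).le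
  set A : ℝ := ‖Ω.sampling p u‖ + D * δ * ‖u‖ with hA
  have hA0 : 0 ≤ A := by positivity
  set S : ℝ := ∑ i, ‖Ω.testL2 (Ω.testPartial i φ)‖ with hS
  have hS0 : 0 ≤ S := Finset.sum_nonneg fun i _ => norm_nonneg _
  have hball : ∫ ξ in closedBall (0 : Rn n) R, ‖𝓕 f ξ‖ ^ 2 ≤ B * A ^ 2 := by
    have := norm_setIntegral_le_of_norm_le_const (μ := volume) (s := closedBall (0 : Rn n) R)
      (f := fun ξ => ‖𝓕 f ξ‖ ^ 2) (C := A ^ 2) measure_closedBall_lt_top fun ξ hξ => by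
        rw [norm_pow, norm_norm]
        exact pow_le_pow_left₀ (norm_nonneg _) (hlow ξ hξ) 2
    exact (le_abs_self _).trans (this.trans_eq (mul_comm _ _))
  have hgrad : ∑ i : Fin n, ∫ x, ‖fderiv ℝ f x (stdVec i)‖ ^ 2 ≤ S ^ 2 := by
    have e : ∀ i, ∫ x, ‖fderiv ℝ f x (stdVec i)‖ ^ 2 = ‖Ω.testL2 (Ω.testPartial i φ)‖ ^ 2 :=
      fun i => (Ω.norm_testL2_sq (Ω.testPartial i φ)).symm
    rw [Finset.sum_congr rfl fun i _ => e i]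
    exact Finset.sum_sq_le_sq_sum_of_nonneg fun i _ => norm_nonneg _
  have hsq : ‖u‖ ^ 2 ≤ (√B * A + ε * S) ^ 2 := by
    have h1 := integral_norm_sq_le_of_fourier f hR0
    have h2 : ‖u‖ ^ 2 = ∫ x, ‖f x‖ ^ 2 := Ω.norm_testL2_sq φ
    have h3 : R⁻¹ = ε := inv_inv ε
    rw [← h2, h3] at h1
    have h4 : ε ^ 2 * ∑ i : Fin n, ∫ x, ‖fderiv ℝ f x (stdVec i)‖ ^ 2 ≤ ε ^ 2 * S ^ 2 := by gcongr
    have h5 : 0 ≤ √B * A * (ε * S) := by positivity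
    have h6 : √B ^ 2 = B := Real.sq_sqrt hB0
    calc ‖u‖ ^ 2 ≤ √B ^ 2 * A ^ 2 + ε ^ 2 * S ^ 2 := by rw [h6]; linarith
      _ ≤ _ := by nlinarith
  have hle : ‖u‖ ≤ √B * A + ε * S := le_of_sq_le_sq hsq (by positivity)
  have hδle : √B * (D * δ) ≤ ε := by
    rw [hδ, ← mul_assoc, mul_div_assoc', div_le_iff₀ (by positivity)]
    nlinarith
  have hP : ‖(((√B : ℝ) : ℂ) • Ω.sampling p) u‖ = √B * ‖Ω.sampling p u‖ := by
    rw [smul_apply, norm_smul, Complex.norm_real,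
      Real.norm_of_nonneg (Real.sqrt_nonneg _)]
  rw [hP]
  have := mul_le_mul_of_nonneg_right hδle (norm_nonneg u)
  calc ‖u‖ ≤ √B * A + ε * S := hle
    _ = √B * ‖Ω.sampling p u‖ + √B * (D * δ) * ‖u‖ + ε * S := by rw [hA]; ring
    _ ≤ _ := by linarith

end C2Domain

end Rellich

/-! ### The Fredholm alternative and bijectivity of the trace -/

section Bijectivity

namespace C2Domain

variable (Ω : C2Domain n)

/-- Multiplication by the potential on `L²(Ω)`, as a linear map. -/
noncomputable def mulPotentialLM (q : Ω.LInfty) : Ω.L2 →ₗ[ℂ] Ω.L2 where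
  toFun u := (Ω.memLp_potential_mul q u).toLp _
  map_add' u v := by
    refine Lp.ext ?_
    filter_upwards [MemLp.coeFn_toLp (Ω.memLp_potential_mul q (u + v)),
      MemLp.coeFn_toLp (Ω.memLp_potential_mul q u), MemLp.coeFn_toLp (Ω.memLp_potential_mul q v),
      Lp.coeFn_add u v, Lp.coeFn_add ((Ω.memLp_potential_mul q u).toLp _)
        ((Ω.memLp_potential_mul q v).toLp _)] with x h1 h2 h3 h4 h5
    rw [h1, h5, Pi.add_apply, h2, h3, h4, Pi.add_apply, mul_add]
  map_smul' c u := by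
    refine Lp.ext ?_
    filter_upwards [MemLp.coeFn_toLp (Ω.memLp_potential_mul q (c • u)),
      MemLp.coeFn_toLp (Ω.memLp_potential_mul q u), Lp.coeFn_smul c u,
      Lp.coeFn_smul c ((Ω.memLp_potential_mul q u).toLp _)] with x h1 h2 h3 h4
    rw [h1, RingHom.id_apply, h4, Pi.smul_apply, h2, h3, Pi.smul_apply, smul_eq_mul,
      smul_eq_mul, mul_left_comm]

theorem norm_mulPotentialLM_le (q : Ω.LInfty) (u : Ω.L2) :
    ‖Ω.mulPotentialLM q u‖ ≤ ‖q‖ * ‖u‖ := by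
  have h : eLpNorm (fun x => q x * u x) 2 Ω.measure ≤
      eLpNorm q ⊤ Ω.measure * eLpNorm u 2 Ω.measure :=
    eLpNorm_smul_le_eLpNorm_top_mul_eLpNorm 2 (Lp.aestronglyMeasurable u) q
  have h1 : ‖Ω.mulPotentialLM q u‖ = (eLpNorm (fun x => q x * u x) 2 Ω.measure).toReal :=
    Lp.norm_toLp _ (Ω.memLp_potential_mul q u)
  rw [h1, Lp.norm_def q, Lp.norm_def u, ← ENNReal.toReal_mul]
  exact ENNReal.toReal_mono (ENNReal.mul_ne_top (Lp.eLpNorm_ne_top q) (Lp.eLpNorm_ne_top u)) h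

/-- Multiplication by the potential on `L²(Ω)`. -/
noncomputable def mulPotential (q : Ω.LInfty) : Ω.L2 →L[ℂ] Ω.L2 :=
  (Ω.mulPotentialLM q).mkContinuous ‖q‖ (Ω.norm_mulPotentialLM_le q)

theorem coeFn_mulPotential (q : Ω.LInfty) (u : Ω.L2) :
    Ω.mulPotential q u =ᵐ[Ω.measure] fun x => q x * u x :=
  MemLp.coeFn_toLp (Ω.memLp_potential_mul q u)

variable {Ω}

theorem hasDistribLaplacian_sub {u v f g : Ω.L2} (hu : HasDistribLaplacian Ω.carrier u f)
    (hv : HasDistribLaplacian Ω.carrier v g) :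
    HasDistribLaplacian Ω.carrier (u - v : Ω.L2) (f - g : Ω.L2) := by
  intro φ hφ
  have h1 : Ω.pairing _ (continuous_laplacian hφ.contDiff_two) u =
    Ω.pairing φ hφ.smooth.continuous f := hu φ hφ
  have h2 : Ω.pairing _ (continuous_laplacian hφ.contDiff_two) v =
    Ω.pairing φ hφ.smooth.continuous g := hv φ hφ
  change Ω.pairing _ (continuous_laplacian hφ.contDiff_two) (u - v) =
    Ω.pairing φ hφ.smooth.continuous (f - g)
  rw [map_sub, map_sub, h1, h2]

theorem distribLaplacian_eq {u : Ω.HDelta} {f : Ω.L2}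
    (h : HasDistribLaplacian Ω.carrier (u : Ω.L2) f) : Ω.distribLaplacian u = f :=
  Lp.ext (HasDistribLaplacian.unique Ω.isOpen Ω.isBounded (Ω.integrable_L2 _) (Ω.integrable_L2 _)
    (Ω.hasDistribLaplacian u) h)

theorem mem_bergman_iff {q : Ω.LInfty} {u : Ω.L2} :
    u ∈ Ω.bergman q ↔ HasDistribLaplacian Ω.carrier u (Ω.mulPotential q u) :=
  ⟨fun h => HasDistribLaplacian.congr h (ae_eq_refl _) (Ω.coeFn_mulPotential q u).symm,
    fun h => HasDistribLaplacian.congr h (ae_eq_refl _) (Ω.coeFn_mulPotential q u)⟩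

/-- Every element of `NormalData` is the normal derivative of some `w`, so the trace vanishes
exactly when Green's form vanishes against all `w`; uniqueness of the distributional Laplacian
allows any representative `f`. -/
theorem trace_eq_zero_iff {u : Ω.HDelta} {f : Ω.L2}
    (h : HasDistribLaplacian Ω.carrier (u : Ω.L2) f) :
    Ω.trace u = 0 ↔ ∀ (w : Rn n → ℂ) (hw : ContDiff ℝ 2 w), (∀ x ∈ frontier Ω.carrier, w x = 0) →
      Ω.pairing _ (continuous_laplacian hw) (u : Ω.L2) = Ω.pairing w hw.continuous f := by
  have key : ∀ w : Ω.C2Zero, Ω.traceFunctional u (Ω.toNormalData w) =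
      Ω.pairing _ (continuous_laplacian w.2.1) (u : Ω.L2) - Ω.pairing w w.2.1.continuous f := by
    intro w
    rw [traceFunctional_apply, greenForm_apply, distribLaplacian_eq h]
    exact integral_sub (Ω.integrable_mul _ (continuous_laplacian w.2.1))
      (Ω.integrable_mul _ w.2.1.continuous)
  constructor
  · intro h0 w hw hw0
    have h1 : Ω.traceFunctional u = 0 := congrArg Subtype.val h0
    have h2 := key ⟨w, hw, hw0⟩
    rw [h1, LinearMap.zero_apply] at h2
    exact sub_eq_zero.1 h2.symm
  · intro h0
    apply Subtype.ext
    apply LinearMap.ext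
    rintro ⟨_, w, rfl⟩
    exact (key w).trans (sub_eq_zero.2 (h0 w w.2.1 w.2.2))

/-- The Fredholm alternative for the Dirichlet problem. -/
theorem exists_eq_resolvent {q : Ω.LInfty} (hq : ¬ Ω.IsDirichletEigenvalue q 0) {lam : ℝ}
    (hlam : 0 < lam) :
    (∀ v : Ω.L2, v = Ω.resolvent lam ((lam : ℂ) • v - Ω.mulPotential q v) → v = 0) ∧
      ∀ g : Ω.L2, ∃ v : Ω.L2,
        v = Ω.resolvent lam (g + ((lam : ℂ) • v - Ω.mulPotential q v)) := by
  have hinj : ∀ v : Ω.L2, v = Ω.resolvent lam ((lam : ℂ) • v - Ω.mulPotential q v) → v = 0 := by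
    intro v hv
    by_contra hne
    obtain ⟨G, hG, hL⟩ := resolvent_spec hlam ((lam : ℂ) • v - Ω.mulPotential q v)
    rw [← hv, sub_sub_cancel] at hL
    rw [← hv] at hG
    -- A nonzero fixed point would lie in `H¹₀(Ω)` and satisfy `Δv = lam v - (lam v - q v) = q v`,
    -- making `0` a Dirichlet eigenvalue.
    refine hq ⟨v, hne, hG.memH10, HasDistribLaplacian.congr hL (ae_eq_refl _) ?_⟩
    filter_upwards [Ω.coeFn_mulPotential q v] with x hx
    rw [hx, sub_zero]
  refine ⟨hinj, fun g => ?_⟩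
  let M : Ω.L2 →L[ℂ] Ω.L2 := (lam : ℂ) • ContinuousLinearMap.id ℂ Ω.L2 - Ω.mulPotential q
  have hM : ∀ v, M v = (lam : ℂ) • v - Ω.mulPotential q v := fun _ => rfl
  have hc : IsCompactOperator ((Ω.resolvent lam).comp M) :=
    (isCompactOperator_resolvent hlam fun ε hε => Ω.exists_sampling_le hε).comp_clm M
  -- For the compact operator `R ∘ (lam - q)` the number 1 is either an eigenvalue, excluded by the
  -- first part, or in the resolvent set, which gives the solution.
  rcases hc.hasEigenvalue_or_mem_resolventSet (μ := 1) one_ne_zero with h | h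
  · obtain ⟨v, hv⟩ := h.exists_hasEigenvector
    have h1 : Ω.resolvent lam (M v) = v := by simpa using hv.apply_eq_smul
    exact absurd (hinj v h1.symm) hv.2
  · rw [spectrum.mem_resolventSet_iff, map_one] at h
    obtain ⟨S, hS⟩ := h.exists_right_inv
    refine ⟨S (Ω.resolvent lam g), ?_⟩
    have h1 := DFunLike.congr_fun hS (Ω.resolvent lam g)
    have h2 : S (Ω.resolvent lam g) - Ω.resolvent lam (M (S (Ω.resolvent lam g))) =
      Ω.resolvent lam g := h1
    rw [map_add, ← hM]
    exact sub_eq_iff_eq_add.1 h2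

/-- Comparing `u` with the element `v = R(lam u - q u)` of `H¹₀(Ω)` gives a difference with zero
trace and `Δ(u - v) = lam (u - v)`. The density of the range of `Δ - lam` shows `u = v`, so the `L²`
solution `u` is in fact in `H¹₀(Ω)`, and uniqueness there concludes. -/
theorem bergmanTrace_injective (hn : 0 < n) {q : Ω.LInfty} (hq : ¬ Ω.IsDirichletEigenvalue q 0) :
    Function.Injective (Ω.bergmanTrace q) := by
  obtain ⟨lam, hlam, hdense⟩ := C2Domain.exists_lam_orthogonal_eq_zero hn Ω
  have hlam0 : 0 < lam := one_pos.trans_le hlam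
  refine (injective_iff_map_eq_zero _).2 fun u hu => ?_
  have hu0 : Ω.trace (Submodule.inclusion (Ω.bergman_le_HDelta q) u) = 0 := congrArg Subtype.val hu
  have hL : HasDistribLaplacian Ω.carrier (u : Ω.L2) (Ω.mulPotential q u) := mem_bergman_iff.1 u.2
  rw [trace_eq_zero_iff hL] at hu0
  set M : Ω.L2 := (lam : ℂ) • (u : Ω.L2) - Ω.mulPotential q u with hM
  obtain ⟨G, hG, hR⟩ := resolvent_spec hlam0 M
  obtain ⟨v, hv⟩ : ∃ v, v = Ω.resolvent lam M := ⟨_, rfl⟩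
  rw [← hv] at hG hR
  have hz : (u : Ω.L2) - v = 0 := by
    refine hdense _ fun w hw hw0 => ?_
    have h1 := hu0 w hw hw0
    have h2 := hG.pairing_laplacian hR hw hw0
    change Ω.pairing _ (continuous_laplacian hw) (u : Ω.L2) = _ at h1
    set d : Ω.L2 := (u : Ω.L2) - v with hd
    have h3 : ∫ x in Ω.carrier, d x * (Δ w x - lam * w x) =
        Ω.pairing _ (continuous_laplacian hw) d - lam * Ω.pairing w hw.continuous d := by
      rw [pairing_apply, pairing_apply, ← integral_const_mul,
        ← integral_sub (Ω.integrable_mul d (continuous_laplacian hw))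
          ((Ω.integrable_mul d hw.continuous).const_mul _)]
      refine integral_congr_ae (ae_of_all _ fun x => ?_)
      ring
    rw [h3, hd, map_sub, map_sub, h1, h2, hM]
    simp only [map_sub, map_smul, smul_eq_mul]
    ring
  exact Subtype.ext ((exists_eq_resolvent hq hlam0).1 u ((sub_eq_zero.1 hz).trans hv))

/-- Any `u ∈ H_Δ(Ω)` is corrected by an element of `H¹₀(Ω)`, which does not change the trace, so as
to solve the homogeneous equation. -/
theorem bergmanTrace_surjective {q : Ω.LInfty} (hq : ¬ Ω.IsDirichletEigenvalue q 0) :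
    Function.Surjective (Ω.bergmanTrace q) := by
  rintro ⟨_, u, rfl⟩
  set f := Ω.distribLaplacian u with hf
  -- With the datum `q u - f` the solution satisfies `Δv = q v - q u + f`, so that `Δ(u - v) = q (u
  -- - v)`. Any positive `lam` will do here, and 1 is taken.
  obtain ⟨v, hv⟩ := (exists_eq_resolvent hq one_pos).2 (Ω.mulPotential q u - f)
  obtain ⟨G, hG, hL⟩ := resolvent_spec one_pos
    (Ω.mulPotential q u - f + (((1 : ℝ) : ℂ) • v - Ω.mulPotential q v))
  rw [← hv] at hG hL
  have hu : HasDistribLaplacian Ω.carrier (u : Ω.L2) f := Ω.hasDistribLaplacian u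
  have hd : (u : Ω.L2) - v ∈ Ω.bergman q := by
    have e : Ω.mulPotential q ((u : Ω.L2) - v) = f - (((1 : ℝ) : ℂ) • v -
        (Ω.mulPotential q u - f + (((1 : ℝ) : ℂ) • v - Ω.mulPotential q v))) := by
      rw [map_sub]
      abel
    rw [mem_bergman_iff, e]
    exact hasDistribLaplacian_sub hu hL
  have hvΔ : v ∈ Ω.HDelta := ⟨_, hL⟩
  have htr : Ω.trace ⟨v, hvΔ⟩ = 0 :=
    (trace_eq_zero_iff hL).2 fun w hw hw0 => hG.pairing_laplacian hL hw hw0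
  refine ⟨⟨_, hd⟩, Subtype.ext ?_⟩
  have e : Submodule.inclusion (Ω.bergman_le_HDelta q) ⟨(u : Ω.L2) - v, hd⟩ = u - ⟨v, hvΔ⟩ := rfl
  change Ω.trace (Submodule.inclusion (Ω.bergman_le_HDelta q) ⟨(u : Ω.L2) - v, hd⟩) = Ω.trace u
  rw [e, map_sub, htr, sub_zero]

end C2Domain

end Bijectivity

end PDETrace

theorem proposition2p1 (n : ℕ) (hn : 3 ≤ n) (Ω : PDETrace.C2Domain n) (q : Ω.LInfty)
    (hq : ¬ Ω.IsDirichletEigenvalue q 0) :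
    Function.Bijective (Ω.bergmanTrace q) :=
  ⟨PDETrace.C2Domain.bergmanTrace_injective (by omega) hq,
    PDETrace.C2Domain.bergmanTrace_surjective hq⟩
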